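/- **Theorem (well-posedness in the time domain).** Let $\alpha\in(0,1)$, $D=(0,1)$. There is a constant $C>0$, depending only on $\alpha$, such that the following holds. Let $W=(W_x)_{x\ge 0}$ be a standard real Brownian motion in the space variable on a probability space $\Omega$, and let $F\in H^1(\mathbb R_+)$ (real- or complex-valued) with $F(0)=0$. Then the initial boundary value problem $$\partial_t^\alpha u-\partial_{xx}u=F(t)\,\dot W_x\ \text{ in } D\times\mathbb R_+,\qquad u(x,0)=0,\qquad \partial_xu(0,t)=0,\quad u(1,t)=0,$$ where $\partial_t^\alpha u(x,t)=\frac1{\Gamma(1-\alpha)}\int_0^t \partial_su(x,s)(t-s)^{-\alpha}\,ds$ is the Caputo derivative, has a solution $u$ with $\partial_t u\in L^2(\Omega;L^2(\mathbb R_+;L^2(D)))$. The solution is unique in this class: any two solutions coincide for almost every $(x,\omega')\in D\times\Omega$ and all $t\ge0$. It satisfies $$\mathbb E\,\|\partial_t u\|_{L^2(\mathbb R_+;L^2(D))}^2\le C\,\|F\|_{H^1(\mathbb R_+)}^2 .$$ Here $u$ is a solution if, almost surely, for a.e. $x$ the function $u(x,\cdot)$ is locally absolutely continuous on $[0,\infty)$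 with $u(x,0)=0$, and if, almost surely, for a.e. $t>0$ the function $u(\cdot,t)$ has a representative in $C^1([0,1])$ that satisfies $\partial_xu(0,t)=0$, $u(1,t)=0$ and $$\partial_xu(x,t)-\partial_xu(0,t)=\int_0^x\partial_t^\alpha u(y,t)\,dy-F(t)W_x\qquad\text{for all }x\in[0,1].$$ Moreover, $u$ is the inverse Fourier transform in time of the frequency-domain solution. Let $\hat F(\omega)=\int_0^\infty e^{-i\omega t}F(t)\,dt$ (in the $L^2$ sense) and let $U(x,\omega)=-\hat F(\omega)\int_0^1 g_\omega(x,y)\,dW_y$ be the mild solution of $\partial_{xx}U-(i\omega)^\alpha U=-\hat F(\omega)\dot W_x$, $\partial_xU(0,\omega)=0$, $U(1,\omega)=0$. Here $g_0(x,y)=\max\{x,y\}-1$ and, for $\omega\ne0$, $$g_\omega(x,y)=\frac{e^{r(x+y)}+e^{r|x-y|}-e^{r(2-x-y)}-e^{r(2-|x-y|)}}{2r(1+e^{2r})},\qquad r=|\omega|^{\alpha/2}e^{\frac{i\pi\alpha}{4}\operatorname{sgn}\omega}.$$ Then for a.e. $x$, almost surely, $U(x,\cdot)\in L^1(\mathbb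 R)$ and $\frac1{2\pi}\int_{\mathbb R}e^{i\omega t}U(x,\omega)\,d\omega$ equals $u(x,t)$ for $t\ge0$ and $0$ for $t<0$. If $F$ is real-valued, then so is $u$ (for a.e. $x$, almost surely, for all $t\ge0$). -/

import Mathlib

open MeasureTheory ProbabilityTheory Set
open scoped ENNReal NNReal

noncomputable section

/-- `f` is locally absolutely continuous on `[0,∞)` with weak (equivalently a.e.) derivative `f'`. -/
def HasWeakDerivHalfLine (f f' : ℝ → ℂ) : Prop :=
  ∀ t : ℝ, 0 ≤ t → IntervalIntegrable f' volume 0 t ∧ f t = f 0 + ∫ s in (0 : ℝ)..t, f' s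

/-- `F` is (the continuous representative of) an element of the Sobolev space `H¹(0,∞)`,
with weak derivative `F'`. -/
structure IsH1HalfLine (F F' : ℝ → ℂ) : Prop where
  memLp : MemLp F 2 (volume.restrict (Ioi (0 : ℝ)))
  memLp_deriv : MemLp F' 2 (volume.restrict (Ioi (0 : ℝ)))
  hasWeakDeriv : HasWeakDerivHalfLine F F'

/-- `‖F‖²` in `H¹(0,∞)`, for `F` with weak derivative `F'`. -/
def h1NormSq (F F' : ℝ → ℂ) : ℝ :=
  (∫ t in Ioi (0 : ℝ), ‖F t‖ ^ 2) + ∫ t in Ioi (0 : ℝ), ‖F' t‖ ^ 2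

/-- The Caputo derivative `∂_t^α f (t) = 1/Γ(1-α) ∫_0^t f'(s) (t-s)^{-α} ds` of a function `f`
whose first derivative is `f'`. -/
def caputo (α : ℝ) (f' : ℝ → ℂ) (t : ℝ) : ℂ :=
  ((Real.Gamma (1 - α) : ℝ) : ℂ)⁻¹ * ∫ s in (0 : ℝ)..t, f' s * (((t - s) ^ (-α) : ℝ) : ℂ)

/-- `u(x,t)`, a random field on `(0,1) × (0,∞)`, solves
`∂_t^α u - ∂_xx u = F(t) Ẇ_x`, `u(x,0) = 0`, `∂_x u(0,t) = 0`, `u(1,t) = 0`,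
and `ut` is its time derivative.
The equation, driven by white noise in `x`, is understood as the Itô equation
`d(∂_x u) = ∂_t^α u dx - F(t) dW_x` in the space variable; it and the boundary conditions hold for
the continuously differentiable representative `v` of `u(·,t)`, with derivative `v'`. -/
structure IsTimeSolution {Ω : Type*} [MeasurableSpace Ω] (α : ℝ) (F : ℝ → ℂ) (μ : Measure Ω)
    (W : ℝ≥0 → Ω → ℝ) (u ut : ℝ → ℝ → Ω → ℂ) : Prop where
  /-- `∂_t u ∈ L²(Ω; L²((0,∞); L²(0,1)))` -/
  memLp_ut : MemLp (fun p : (ℝ × ℝ) × Ω => ut p.1.1 p.1.2 p.2) 2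
    (((volume.restrict (Ioo (0 : ℝ) 1)).prod (volume.restrict (Ioi (0 : ℝ)))).prod μ)
  /-- `ut` is the time derivative of `u` -/
  time_deriv : ∀ᵐ p ∂((volume.restrict (Ioo (0 : ℝ) 1)).prod μ),
    HasWeakDerivHalfLine (fun t => u p.1 t p.2) (fun t => ut p.1 t p.2)
  initial : ∀ᵐ p ∂((volume.restrict (Ioo (0 : ℝ) 1)).prod μ), u p.1 0 p.2 = 0
  equation : ∀ᵐ q ∂((volume.restrict (Ioi (0 : ℝ))).prod μ),
    IntegrableOn (fun y => caputo α (fun s => ut y s q.2) q.1) (Ioo (0 : ℝ) 1) ∧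
    ∃ v v' : ℝ → ℂ,
      (∀ᵐ x ∂(volume.restrict (Ioo (0 : ℝ) 1)), u x q.1 q.2 = v x) ∧
      ContinuousOn v' (Icc 0 1) ∧
      (∀ x ∈ Icc (0 : ℝ) 1, HasDerivWithinAt v (v' x) (Icc 0 1) x) ∧
      v' 0 = 0 ∧ v 1 = 0 ∧
      ∀ x ∈ Icc (0 : ℝ) 1,
        v' x - v' 0 = (∫ y in (0 : ℝ)..x, caputo α (fun s => ut y s q.2) q.1)
          - F q.1 * ((W x.toNNReal q.2 : ℝ) : ℂ)

/-- The branch `(iω)^β = |ω|^β exp(i π β sgn(ω) / 2)` for `ω ≠ 0`, and `0` for `ω = 0`. -/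
def iPow (β ω : ℝ) : ℂ :=
  if ω = 0 then 0
  else ((|ω| ^ β : ℝ) : ℂ) * Complex.exp (Complex.I * ((Real.pi * β / 2 * Real.sign ω : ℝ) : ℂ))

/-- The Green function of `∂_xx - (iω)^α` on `(0,1)` with a Neumann condition at `0` and a
Dirichlet condition at `1`. -/
def green (α ω x y : ℝ) : ℂ :=
  if ω = 0 then ((max x y - 1 : ℝ) : ℂ)
  else
    (Complex.exp (iPow (α / 2) ω * ((x + y : ℝ) : ℂ))
      + Complex.exp (iPow (α / 2) ω * ((|x - y| : ℝ) : ℂ))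
      - Complex.exp (iPow (α / 2) ω * ((2 - x - y : ℝ) : ℂ))
      - Complex.exp (iPow (α / 2) ω * ((2 - |x - y| : ℝ) : ℂ)))
    / (2 * iPow (α / 2) ω * (1 + Complex.exp (2 * iPow (α / 2) ω)))

/-- `I` is the Wiener (Itô) integral `∫_0^1 g(y) dW_y` of a deterministic `g ∈ L²(0,1)`: the limit
in `L²(Ω)` of the integrals `∑ cᵢ (W_{bᵢ} - W_{aᵢ})` of step functions `∑ cᵢ 1_{(aᵢ,bᵢ]}` which
converge to `g` in `L²(0,1)`. -/
def IsWienerIntegral {Ω : Type*} [MeasurableSpace Ω] (μ : Measure Ω) (W : ℝ≥0 → Ω → ℝ)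
    (g : ℝ → ℂ) (I : Ω → ℂ) : Prop :=
  MemLp g 2 (volume.restrict (Ioo (0 : ℝ) 1)) ∧ MemLp I 2 μ ∧
  ∀ ε : ℝ≥0∞, 0 < ε → ∃ (n : ℕ) (a b : Fin n → ℝ≥0) (c : Fin n → ℂ),
    (∀ i, a i ≤ b i ∧ b i ≤ 1) ∧
    eLpNorm (fun y => g y - ∑ i, (Ioc (a i : ℝ) (b i : ℝ)).indicator (fun _ => c i) y) 2
      (volume.restrict (Ioo (0 : ℝ) 1)) ≤ ε ∧
    eLpNorm (fun ω => I ω - ∑ i, c i * ((W (b i) ω - W (a i) ω : ℝ) : ℂ)) 2 μ ≤ ε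

open Classical in
/-- The `L²` Fourier transform with the normalization `f̂(ω) = ∫ e^{-iωt} f(t) dt`
(Mathlib's kernel is `e^{-2πiξt}`). -/
def fourierL2 (f : ℝ → ℂ) (ω : ℝ) : ℂ :=
  if h : MemLp f 2 (volume : Measure ℝ) then
    (FourierTransform.fourier (h.toLp f) : Lp ℂ 2 (volume : Measure ℝ)) (ω / (2 * Real.pi))
  else 0

/-- `U(x,ξ)` is the mild solution `-F̂(ξ) ∫_0^1 g_ξ(x,y) dW_y` of
`∂_xx U - (iξ)^α U = -F̂(ξ) Ẇ_x`, `∂_x U(0,ξ) = 0`, `U(1,ξ) = 0`, where `F̂` is the Fourier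
transform of the extension of `F` by zero. -/
structure IsFrequencyMildSolution {Ω : Type*} [MeasurableSpace Ω] (α : ℝ) (F : ℝ → ℂ)
    (μ : Measure Ω) (W : ℝ≥0 → Ω → ℝ) (U : ℝ → ℝ → Ω → ℂ) : Prop where
  measurable : AEStronglyMeasurable (fun p : (ℝ × ℝ) × Ω => U p.1.1 p.1.2 p.2)
    (((volume.restrict (Ioo (0 : ℝ) 1)).prod (volume : Measure ℝ)).prod μ)
  mild : ∀ x ∈ Ioo (0 : ℝ) 1, ∀ ξ : ℝ, ∃ I : Ω → ℂ,
    IsWienerIntegral μ W (fun y => green α ξ x y) I ∧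
    ∀ᵐ ω ∂μ, U x ξ ω = -fourierL2 ((Ioi (0 : ℝ)).indicator F) ξ * I ω

/-- The inverse Fourier transform `(1/2π) ∫ e^{iξt} φ(ξ) dξ` of an integrable function. -/
def invFourier (φ : ℝ → ℂ) (t : ℝ) : ℂ :=
  ((2 * Real.pi : ℝ) : ℂ)⁻¹ * ∫ ξ : ℝ, Complex.exp (Complex.I * ((ξ * t : ℝ) : ℂ)) * φ ξ

end

/-! The problem is solved path by path. Since the Green function vanishes at `y = 1` and Brownian
paths start at `0`, integration by parts turns `-∫ g dW` into the ordinary integral `∫ ∂_y g · w`,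
which is `mode w x r` with `r = (iω)^{α/2}` (`isWienerIntegral_green`). It satisfies `mode' =
modeFlux - w`, `modeFlux' = r² mode`, `modeFlux(0) = 0`, `mode(1) = 0`, which is the resolvent
equation without any derivative of `w`.

Uniform bounds. Because `α < 1`, the power `r = s^{α/2}` stays in the sector `|Im r| ≤ Re r`
whenever `Re s ≥ 0`, and there `|cosh r| ≥ e^{Re r}/3`. Hence `|mode| ≤ 3 ∫|w|` and `|modeFlux| ≤ 9
max|w|`, uniformly in `r` (`norm_mode_le`, `norm_modeFlux_le`).

Existence. As `F(0) = 0`, the transform of `F` is that of `F + F'` divided by `1 + s`. So `F̂ ·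
mode` is an L² boundary function times a symbol that is holomorphic in the right half-plane and
`O(1/|1+s|)`. It is integrable, and Cauchy's theorem moves the inversion contour: the inverse
transform vanishes for `t ≤ 0` and its Laplace transform is the expected product
(`fourierInv_axis_eq_zero`, `lap_fourierInv`). Plancherel bounds the time derivative by `3 ∫|w| · ‖F
+ F'‖` (`exists_deriv_timeSymbol`), and `E W_y² = y ≤ 1` yields the estimate in expectation. The
Caputo derivative acts on Laplace transforms as `s^{α-1}` times the transform of the first
derivative (`hlap_caputo`), so the integrated equation becomes `modeFlux(x) = ∫_0^x r² mode`, and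
injectivity of the Laplace transform carries it back to time (`pathSol_equation`).

Uniqueness. Integrating the equation twice in `x` and transforming in `t`, the difference of two
solutions satisfies the integral form of `v'' = r² v`, `v'(0) = 0`, `v(1) = 0`; as `cosh r ≠ 0`, it
is zero (`ae_eq_zero_of_kernel_equation`).

Real values. The complex conjugate of a path solution has the same Laplace transform when `F` is
real. The remaining work is joint measurability and the control of null sets that depend on `x`, `s`
or the path. -/

open MeasureTheory ProbabilityTheory Set
open scoped ENNReal NNReal

noncomputable section

/-! ### Fourier transforms on L¹ and L² of the line -/

section FourierToolbox

open Filter Topology FourierTransform SchwartzMap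

/-- A locally integrable function that is orthogonal to all Schwartz functions vanishes a.e. -/
theorem ae_eq_zero_of_integral_schwartz {h : ℝ → ℂ} (hh : LocallyIntegrable h volume)
    (H : ∀ g : 𝓢(ℝ, ℂ), ∫ x, g x * h x = 0) : ∀ᵐ x, h x = 0 := by
  apply ae_eq_zero_of_integral_contDiff_smul_eq_zero hh
  intro g g_smooth g_cpt
  have hg₁ : HasCompactSupport (Complex.ofRealCLM ∘ g) := g_cpt.comp_left rfl
  have hg₂ : ContDiff ℝ (⊤ : ℕ∞) (Complex.ofRealCLM ∘ g) := by fun_prop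
  have := H (hg₁.toSchwartzMap hg₂)
  rw [← this]
  refine integral_congr_ae (Eventually.of_forall fun x => ?_)
  simp

theorem integral_schwartz_mul_fourier {f : ℝ → ℂ} (hf : Integrable f) (g : 𝓢(ℝ, ℂ)) :
    ∫ x, g x * 𝓕 f x = ∫ x, (𝓕 g) x * f x := by
  have := VectorFourier.integral_fourierIntegral_smul_eq_flip (L := innerₗ ℝ)
    (μ := (volume : Measure ℝ)) (ν := (volume : Measure ℝ)) (f := (g : ℝ → ℂ)) (g := f)
    Real.continuous_fourierChar continuous_inner g.integrable hf
  simp only [smul_eq_mul, flip_innerₗ] at this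
  rw [SchwartzMap.fourier_coe]
  exact this.symm

/-- The L² transform agrees with that of tempered distributions, where moving the transform onto the
test function is the definition; `f` need not be integrable. -/
theorem integral_schwartz_mul_fourierLp (f : Lp ℂ 2 (volume : Measure ℝ)) (g : 𝓢(ℝ, ℂ)) :
    ∫ x, g x * (𝓕 f : Lp ℂ 2 (volume : Measure ℝ)) x = ∫ x, (𝓕 g) x * f x := by
  have := congrArg (fun T : TemperedDistribution ℝ ℂ => T g)
    (Lp.fourier_toTemperedDistribution_eq f)
  simp only [TemperedDistribution.fourier_apply, Lp.toTemperedDistribution_apply,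
    smul_eq_mul] at this
  exact this.symm

/-- Both transforms have the same pairing with every Schwartz function. This allows the L² transform
to be computed by the integral formula. -/
theorem fourier_toLp_ae_eq {f : ℝ → ℂ} (h1 : Integrable f) (h2 : MemLp f 2 volume) :
    ((𝓕 (h2.toLp f) : Lp ℂ 2 (volume : Measure ℝ)) : ℝ → ℂ) =ᵐ[volume] 𝓕 f := by
  have hc : Continuous (𝓕 f) :=
    VectorFourier.fourierIntegral_continuous Real.continuous_fourierChar
      (L := innerₗ ℝ) continuous_inner h1
  have hL : LocallyIntegrable
      ((𝓕 (h2.toLp f) : Lp ℂ 2 (volume : Measure ℝ)) : ℝ → ℂ) volume :=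
    (Lp.memLp _).locallyIntegrable (by norm_num)
  have := ae_eq_zero_of_integral_schwartz (hL.sub hc.locallyIntegrable) ?_
  · filter_upwards [this] with x hx
    simpa [sub_eq_zero] using hx
  intro g
  obtain ⟨C, hC⟩ : ∃ C, ∀ x, ‖𝓕 f x‖ ≤ C :=
    ⟨_, fun x => VectorFourier.norm_fourierIntegral_le_integral_norm _ _ _ _ _⟩
  have i1 : Integrable (fun x => g x * (𝓕 (h2.toLp f) : Lp ℂ 2 (volume : Measure ℝ)) x) :=
    MemLp.integrable_mul (g.memLp 2 volume) (Lp.memLp _)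
  have i2 : Integrable (fun x => g x * 𝓕 f x) :=
    g.integrable.mul_bdd hc.aestronglyMeasurable (Eventually.of_forall hC)
  simp only [Pi.sub_apply, mul_sub]
  rw [integral_sub i1 i2, integral_schwartz_mul_fourier h1, integral_schwartz_mul_fourierLp,
    sub_eq_zero]
  refine integral_congr_ae ?_
  filter_upwards [h2.coeFn_toLp] with x hx
  rw [hx]

/-- The Fourier transform is injective on `L¹`. -/
theorem ae_eq_zero_of_fourier_eq_zero {f : ℝ → ℂ} (h1 : Integrable f) (h0 : ∀ ξ, 𝓕 f ξ = 0) :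
    ∀ᵐ x, f x = 0 := by
  refine ae_eq_zero_of_integral_schwartz h1.locallyIntegrable fun g => ?_
  have := integral_schwartz_mul_fourier h1 (𝓕⁻ g)
  rw [fourier_fourierInv_eq] at this
  rw [← this]
  simp [h0]

theorem fourierInv_eq_integral_exp (φ : ℝ → ℂ) (t : ℝ) :
    𝓕⁻ φ t = ∫ ξ : ℝ, Complex.exp (2 * Real.pi * Complex.I * ξ * t) * φ ξ := by
  rw [Real.fourierInv_eq']
  refine integral_congr_ae (Eventually.of_forall fun ξ => ?_)
  simp only [smul_eq_mul, RCLike.inner_apply, conj_trivial]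
  congr 2
  push_cast; ring

theorem fourier_eq_integral_exp (φ : ℝ → ℂ) (ξ : ℝ) :
    𝓕 φ ξ = ∫ t : ℝ, Complex.exp (-(2 * Real.pi * Complex.I * ξ * t)) * φ t := by
  rw [Real.fourier_eq']
  refine integral_congr_ae (Eventually.of_forall fun t => ?_)
  simp only [smul_eq_mul, RCLike.inner_apply, conj_trivial]
  congr 2
  push_cast; ring

/-- The substitution `ω = 2πξ` absorbs the prefactor. In the variable `ξ` the imaginary axis is
parametrised by `2πiξ`. -/
theorem invFourier_eq_fourierInv (φ : ℝ → ℂ) (t : ℝ) :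
    invFourier φ t = 𝓕⁻ (fun ξ => φ (2 * Real.pi * ξ)) t := by
  rw [fourierInv_eq_integral_exp, invFourier]
  have h := Measure.integral_comp_mul_left
    (fun ξ : ℝ => Complex.exp (Complex.I * ((ξ * t : ℝ) : ℂ)) * φ ξ) (2 * Real.pi)
  have hp : 0 < 2 * Real.pi := by positivity
  rw [abs_of_pos (inv_pos.2 hp)] at h
  rw [← Complex.ofReal_inv, ← Complex.real_smul, ← h]
  refine integral_congr_ae (Eventually.of_forall fun ξ => ?_)
  simp only
  congr 2
  push_cast; ring

theorem continuous_fourierInv {φ : ℝ → ℂ} (h : Integrable φ) : Continuous (𝓕⁻ φ) :=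
  VectorFourier.fourierIntegral_continuous Real.continuous_fourierChar
      (L := -innerₗ ℝ) (continuous_inner (𝕜 := ℝ) (E := ℝ)).neg h

theorem norm_fourierInv_le (φ : ℝ → ℂ) (t : ℝ) : ‖𝓕⁻ φ t‖ ≤ ∫ ξ, ‖φ ξ‖ :=
  VectorFourier.norm_fourierIntegral_le_integral_norm _ _ _ _ _

/-- If `φ` and `ξ φ` are in `L¹` and `L²` respectively, then `𝓕⁻ φ` is absolutely continuous, and
its derivative is the inverse `L²` Fourier transform of `2 π i ξ φ`. -/
theorem fourierInv_sub_eq_integral {φ : ℝ → ℂ} (h1 : Integrable φ)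
    (g : Lp ℂ 2 (volume : Measure ℝ))
    (hg : ∀ᵐ ξ : ℝ, (𝓕 g : Lp ℂ 2 (volume : Measure ℝ)) ξ = 2 * Real.pi * Complex.I * ξ * φ ξ)
    {t : ℝ} (ht : 0 ≤ t) : 𝓕⁻ φ t - 𝓕⁻ φ 0 = ∫ s in (0 : ℝ)..t, g s := by
  -- Plancherel for the pair `χ = 1_(0,t]`, `g`: the integral of `g` is `⟨χ, g⟩ = ⟨χ̂, ĝ⟩`, and the
  -- conjugate of `χ̂` is `(e^{2πiξt} - 1)/(2πiξ)`, whose denominator cancels the factor in `hg`.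
  set χ : ℝ → ℂ := (Ioc 0 t).indicator fun _ => 1 with hχ
  have m2 : MemLp χ 2 volume := memLp_indicator_const 2 measurableSet_Ioc 1 (by right; simp)
  have m1 : Integrable χ := by
    rw [← memLp_one_iff_integrable]
    exact memLp_indicator_const 1 measurableSet_Ioc 1 (by right; simp)
  have key := Lp.inner_fourier_eq (m2.toLp χ) g
  rw [L2.inner_def, L2.inner_def] at key
  have e1 : ∫ a, inner ℂ ((m2.toLp χ : Lp ℂ 2 volume) a) (g a) = ∫ s in (0 : ℝ)..t, g s := by
    rw [intervalIntegral.integral_of_le ht, ← integral_indicator measurableSet_Ioc]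
    refine integral_congr_ae ?_
    filter_upwards [m2.coeFn_toLp] with x hx
    rw [hx]
    by_cases h : x ∈ Ioc 0 t <;> simp [hχ, h]
  rw [e1] at key
  rw [← key, fourierInv_eq_integral_exp, fourierInv_eq_integral_exp, ← integral_sub]
  · refine integral_congr_ae ?_
    filter_upwards [fourier_toLp_ae_eq m1 m2, hg] with ξ h1 h2
    rw [h1, h2, fourier_eq_integral_exp]
    have : ∫ τ : ℝ, Complex.exp (-(2 * Real.pi * Complex.I * ξ * τ)) * χ τ
        = ∫ τ in (0 : ℝ)..t, Complex.exp (-(2 * Real.pi * Complex.I * ξ) * τ) := by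
      rw [intervalIntegral.integral_of_le ht, ← integral_indicator measurableSet_Ioc]
      refine integral_congr_ae (Eventually.of_forall fun τ => ?_)
      by_cases h : τ ∈ Ioc 0 t <;> simp [hχ, h]
    rw [this]
    rcases eq_or_ne ξ 0 with rfl | h0
    · simp
    have hne : -(2 * Real.pi * Complex.I * ξ) ≠ 0 := by simp [Real.pi_ne_zero, h0]
    rw [integral_exp_mul_complex hne]
    simp only [RCLike.inner_apply, map_div₀, map_sub, ← Complex.exp_conj, map_mul, map_neg,
      Complex.conj_ofReal, Complex.conj_I, map_ofNat, Complex.ofReal_zero, mul_zero,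
      Complex.exp_zero, map_one]
    have hne' : -(2 * Real.pi * -Complex.I * ξ) ≠ 0 := by simp [Real.pi_ne_zero, h0]
    have h0c : (ξ : ℂ) ≠ 0 := by exact_mod_cast h0
    field_simp
  all_goals
    refine h1.bdd_mul (c := 1) (by fun_prop) (Eventually.of_forall fun ξ => ?_)
    rw [Complex.norm_exp]
    simp

end FourierToolbox

/-! ### Laplace transform: holomorphy, injectivity, contour shift -/

section LaplaceTransform

open Filter Topology FourierTransform

/-- Dominated convergence in `L²`. -/
theorem tendsto_eLpNorm_two_sub_of_dominated {X ι : Type*} [MeasurableSpace X] {μ : Measure X}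
    {l : Filter ι} [l.IsCountablyGenerated] {f : ι → X → ℂ} {g : X → ℂ} {b : X → ℝ}
    (hf : ∀ᶠ n in l, AEStronglyMeasurable (f n) μ) (hg : AEStronglyMeasurable g μ)
    (hb : MemLp b 2 μ) (hfb : ∀ᶠ n in l, ∀ᵐ x ∂μ, ‖f n x‖ ≤ b x) (hgb : ∀ᵐ x ∂μ, ‖g x‖ ≤ b x)
    (hlim : ∀ᵐ x ∂μ, Tendsto (fun n => f n x) l (𝓝 (g x))) :
    Tendsto (fun n => eLpNorm (fun x => f n x - g x) 2 μ) l (𝓝 0) := by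
  have h2 : (2 : ℝ≥0∞) ≠ 0 := by norm_num
  have h2' : (2 : ℝ≥0∞) ≠ ∞ := by norm_num
  simp only [eLpNorm_eq_lintegral_rpow_enorm_toReal h2 h2', ENNReal.toReal_ofNat]
  have key : Tendsto (fun n => ∫⁻ x, ‖f n x - g x‖ₑ ^ (2 : ℝ) ∂μ) l (𝓝 (∫⁻ _, 0 ∂μ)) := by
    refine tendsto_lintegral_filter_of_dominated_convergence'
      (fun x => ‖(2 : ℝ) * b x‖ₑ ^ (2 : ℝ)) ?_ ?_ ?_ ?_
    · filter_upwards [hf] with n hn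
      exact (hn.sub hg).enorm.pow_const _
    · filter_upwards [hfb] with n hn
      filter_upwards [hn, hgb] with x h1 h2
      gcongr
      rw [enorm_le_iff_norm_le]
      calc ‖f n x - g x‖ ≤ ‖f n x‖ + ‖g x‖ := norm_sub_le _ _
        _ ≤ 2 * b x := by linarith
        _ ≤ ‖2 * b x‖ := le_abs_self _
    · have := (hb.const_mul 2).eLpNorm_lt_top
      rw [eLpNorm_eq_lintegral_rpow_enorm_toReal h2 h2'] at this
      have h3 := ENNReal.rpow_lt_top_of_nonneg (y := 2) (by norm_num) this.ne
      rw [← ENNReal.rpow_mul] at h3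
      simpa using h3.ne
    · filter_upwards [hlim] with x hx
      have h0 : Tendsto (fun n => f n x - g x) l (𝓝 0) := by
        simpa using hx.sub_const (g x)
      have h1 := (continuous_enorm.tendsto (0 : ℂ)).comp h0
      have h3 := (ENNReal.continuous_rpow_const (y := 2)).continuousAt.tendsto.comp h1
      simpa using! h3
  have h3 := (ENNReal.continuous_rpow_const (y := 1 / 2)).continuousAt.tendsto.comp key
  simpa using! h3

theorem integral_norm_mul_le {X : Type*} [MeasurableSpace X] {μ : Measure X} {f g : X → ℂ}
    (hf : AEStronglyMeasurable f μ) (hg : AEStronglyMeasurable g μ) :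
    ∫⁻ x, ‖f x * g x‖ₑ ∂μ ≤ eLpNorm f 2 μ * eLpNorm g 2 μ := by
  rw [← eLpNorm_one_eq_lintegral_enorm]
  simpa using eLpNorm_le_eLpNorm_mul_eLpNorm'_of_norm (p := 2) (q := 2) (r := 1) hf hg
    (fun x y : ℂ => x * y) 1 (Eventually.of_forall fun x => by simp)

/-- The (two-sided) Laplace transform `∫ e^{-st} f(t) dt`. -/
def lap (f : ℝ → ℂ) (s : ℂ) : ℂ := ∫ t : ℝ, Complex.exp (-(s * t)) * f t

theorem norm_exp_neg_mul (s : ℂ) (t : ℝ) :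
    ‖Complex.exp (-(s * t))‖ = Real.exp (-(s.re * t)) := by
  rw [Complex.norm_exp]; simp

theorem lap_eq_fourier (f : ℝ → ℂ) (a ξ : ℝ) :
    lap f (a + 2 * Real.pi * Complex.I * ξ) = 𝓕 (fun t : ℝ => Complex.exp (-(a * t)) * f t) ξ := by
  rw [fourier_eq_integral_exp, lap]
  refine integral_congr_ae (Eventually.of_forall fun t => ?_)
  simp only
  rw [← mul_assoc, ← Complex.exp_add]
  congr 2; ring

theorem memLp_exp_neg {a : ℝ} (ha : 0 < a) :
    MemLp ((Ioi (0 : ℝ)).indicator fun t : ℝ => Real.exp (-(a * t))) 2 volume := by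
  rw [memLp_indicator_iff_restrict measurableSet_Ioi,
    memLp_two_iff_integrable_sq (by fun_prop)]
  have := integrableOn_exp_mul_Ioi (a := -(2 * a)) (by linarith) 0
  refine this.congr (Eventually.of_forall fun t => ?_)
  simp only
  rw [← Real.exp_nat_mul]; congr 1; push_cast; ring

theorem norm_exp_neg_mul_le {G : ℝ → ℂ} (hG0 : ∀ t ≤ 0, G t = 0) {s : ℂ} {a : ℝ}
    (h : a ≤ s.re) (t : ℝ) :
    ‖Complex.exp (-(s * t)) * G t‖ ≤ Real.exp (-(a * t)) * ‖G t‖ := by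
  rw [norm_mul, norm_exp_neg_mul]
  rcases le_or_gt t 0 with ht | ht
  · simp [hG0 t ht]
  · gcongr

theorem integrable_exp_mul_of_memLp {G : ℝ → ℂ} (hG : MemLp G 2 volume) (hG0 : ∀ t ≤ 0, G t = 0)
    {s : ℂ} (hs : 0 < s.re) : Integrable (fun t : ℝ => Complex.exp (-(s * t)) * G t) := by
  have h := MemLp.integrable_mul (memLp_exp_neg hs) hG.norm
  refine h.mono' (AEStronglyMeasurable.mul (by fun_prop) hG.1) (Eventually.of_forall fun t => ?_)
  refine (norm_exp_neg_mul_le hG0 le_rfl t).trans (le_of_eq ?_)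
  rcases le_or_gt t 0 with ht | ht
  · simp [hG0 t ht]
  · simp [ht]

theorem lap_differentiableOn {G : ℝ → ℂ} (hG0 : ∀ t ≤ 0, G t = 0)
    (hG : ∀ s : ℂ, 0 < s.re → Integrable (fun t : ℝ => Complex.exp (-(s * t)) * G t)) :
    DifferentiableOn ℂ (lap G) {s | 0 < s.re} := by
  intro s hs
  have ha : 0 < s.re := hs
  refine DifferentiableAt.differentiableWithinAt ?_
  have hmeas : AEStronglyMeasurable G volume := by
    have h1 := (hG s hs).1
    have h2 : AEStronglyMeasurable (fun t : ℝ => Complex.exp (s * t)) volume := by fun_prop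
    refine (h2.mul h1).congr (Eventually.of_forall fun t => ?_)
    simp only [Pi.mul_apply]
    rw [← mul_assoc, ← Complex.exp_add]; simp
  -- On the ball of radius `Re s / 2` the decay rate is at least `Re s / 2`. Half of it absorbs the
  -- factor `t` produced by differentiation, at the cost of `4 / Re s`; the rate `Re s / 4` remains.
  have hb := ((hG ((s.re / 4 : ℝ) : ℂ) (by simpa using ha)).norm).const_mul (4 / s.re)
  have := hasDerivAt_integral_of_dominated_loc_of_deriv_le (μ := (volume : Measure ℝ))
    (F := fun (s : ℂ) (t : ℝ) => Complex.exp (-(s * t)) * G t)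
    (F' := fun (s : ℂ) (t : ℝ) => (-t * Complex.exp (-(s * t))) * G t) (x₀ := s)
    (s := Metric.ball s (s.re / 2)) (Metric.ball_mem_nhds s (by linarith))
    (Eventually.of_forall fun z => AEStronglyMeasurable.mul (by fun_prop) hmeas) (hG s hs)
    (AEStronglyMeasurable.mul (by fun_prop) hmeas) ?_ hb ?_
  · exact this.2.differentiableAt
  · refine Eventually.of_forall fun t z hz => ?_
    rcases le_or_gt t 0 with ht | ht
    · simp [hG0 t ht]
    have hz' : s.re / 2 ≤ z.re := by
      have h1 := (Complex.abs_re_le_norm (z - s)).trans (mem_ball_iff_norm.1 hz).le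
      rw [Complex.sub_re, abs_le] at h1
      linarith [h1.1]
    rw [norm_mul, norm_mul, norm_mul, norm_exp_neg_mul, norm_exp_neg_mul, ← mul_assoc]
    gcongr ?_ * ‖G t‖
    simp only [norm_neg, Complex.norm_real, Real.norm_eq_abs, abs_of_pos ht, Complex.ofReal_re]
    have h1 : t ≤ 4 / s.re * Real.exp (s.re / 4 * t) := by
      have := Real.add_one_le_exp (s.re / 4 * t)
      calc t = 4 / s.re * (s.re / 4 * t) := by field_simp
        _ ≤ _ := by gcongr; linarith
    calc t * Real.exp (-(z.re * t)) ≤ (4 / s.re * Real.exp (s.re / 4 * t)) *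
          Real.exp (-(s.re / 2 * t)) := by gcongr
      _ = 4 / s.re * Real.exp (-(s.re / 4 * t)) := by
          rw [mul_assoc, ← Real.exp_add]; congr 2; ring
  · refine Eventually.of_forall fun t z hz => ?_
    have h1 : HasDerivAt (fun z : ℂ => -(z * t)) (-(t : ℂ)) z := by
      simpa using! ((hasDerivAt_id z).mul_const (t : ℂ)).neg
    simpa [mul_comm] using (h1.cexp).mul_const (G t)

/-- The Laplace transform is injective. -/
theorem ae_eq_zero_of_lap_eq_zero {f : ℝ → ℂ} {a : ℝ}
    (hf : Integrable (fun t : ℝ => Complex.exp (-(a * t)) * f t))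
    (h : ∀ s : ℂ, s.re = a → lap f s = 0) : ∀ᵐ t, f t = 0 := by
  have := ae_eq_zero_of_fourier_eq_zero hf fun ξ => by
    rw [← lap_eq_fourier]; exact h _ (by simp)
  filter_upwards [this] with t ht
  simpa using ht

theorem norm_lap_le {G : ℝ → ℂ} (hG0 : ∀ t ≤ 0, G t = 0) {a : ℝ}
    (hG : Integrable (fun t : ℝ => Complex.exp (-(a * t)) * G t)) {s : ℂ} (hs : a ≤ s.re) :
    ‖lap G s‖ ≤ ∫ t : ℝ, ‖Complex.exp (-(a * t)) * G t‖ := by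
  refine norm_integral_le_of_norm_le hG.norm (Eventually.of_forall fun t => ?_)
  refine (norm_exp_neg_mul_le hG0 hs t).trans (le_of_eq ?_)
  rw [norm_mul, norm_exp_neg_mul]; simp

/-- Cauchy's theorem on a vertical strip. -/
theorem integral_vertical_line_eq {f : ℂ → ℂ} {a b : ℝ} (hab : a ≤ b)
    (hf : DifferentiableOn ℂ f {s | s.re ∈ Icc a b})
    (ia : Integrable (fun y : ℝ => f (a + y * Complex.I)))
    (ib : Integrable (fun y : ℝ => f (b + y * Complex.I)))
    {C : ℝ} (hC : ∀ s : ℂ, s.re ∈ Icc a b → ‖f s‖ * |s.im| ≤ C) :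
    ∫ y : ℝ, f (a + y * Complex.I) = ∫ y : ℝ, f (b + y * Complex.I) := by
  have hrect : ∀ T : ℝ, (∫ x : ℝ in a..b, f (x + (-T : ℝ) * Complex.I))
      - (∫ x : ℝ in a..b, f (x + T * Complex.I))
      + Complex.I • (∫ y : ℝ in (-T)..T, f (b + y * Complex.I))
      - Complex.I • (∫ y : ℝ in (-T)..T, f (a + y * Complex.I)) = 0 := by
    intro T
    have := Complex.integral_boundary_rect_eq_zero_of_differentiableOn f
      (a + (-T : ℝ) * Complex.I) (b + T * Complex.I) (hf.mono ?_)
    · simpa using this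
    · intro s hs
      have := hs.1
      simpa [uIcc_of_le hab] using this
  -- The horizontal sides at height `±T` are `O(C/T)`, so only the two vertical sides survive as `T
  -- → ∞`.
  have hor : ∀ σ : ℝ, |σ| = 1 → Tendsto (fun T : ℝ => ∫ x : ℝ in a..b, f (x + (σ * T : ℝ) * Complex.I))
      atTop (𝓝 0) := by
    intro σ hσ
    refine squeeze_zero_norm' (a := fun T => C / T * |b - a|) ?_ ?_
    · filter_upwards [eventually_gt_atTop 0] with T hT
      refine intervalIntegral.norm_integral_le_of_norm_le_const fun x hx => ?_
      rw [uIoc_of_le hab] at hx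
      rw [le_div_iff₀ hT]
      have := hC (x + (σ * T : ℝ) * Complex.I) (by simpa using ⟨hx.1.le, hx.2⟩)
      simpa [abs_mul, hσ, abs_of_pos hT] using this
    · have : Tendsto (fun T : ℝ => C / T) atTop (𝓝 0) := tendsto_const_nhds.div_atTop tendsto_id
      simpa using this.mul_const |b - a|
  have va := intervalIntegral_tendsto_integral ia tendsto_neg_atTop_atBot tendsto_id
  have vb := intervalIntegral_tendsto_integral ib tendsto_neg_atTop_atBot tendsto_id
  have h1 := hor (-1) (by simp)
  have h2 := hor 1 (by simp)
  simp only [neg_mul, one_mul] at h1 h2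
  have := ((h1.sub h2).add (vb.const_smul Complex.I)).sub (va.const_smul Complex.I)
  have h0 := tendsto_nhds_unique this (tendsto_const_nhds.congr fun T => (hrect T).symm)
  simp only [sub_zero, zero_add, smul_eq_mul, ← mul_sub] at h0
  have := (mul_eq_zero.1 h0).resolve_left Complex.I_ne_zero
  exact (sub_eq_zero.1 this).symm

end LaplaceTransform

/-! ### Hardy symbols on the right half-plane and causality -/

section HardySpace

open Filter Topology FourierTransform

theorem eLpNorm_fourierLp (f : Lp ℂ 2 (volume : Measure ℝ)) :
    eLpNorm (𝓕 f : Lp ℂ 2 (volume : Measure ℝ)) 2 volume = eLpNorm f 2 volume := by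
  rw [← Lp.enorm_def, ← Lp.enorm_def, ← ofReal_norm, ← ofReal_norm, Lp.norm_fourier_eq]

theorem memLp_exp_mul {G : ℝ → ℂ} (hG : MemLp G 2 volume) (hG0 : ∀ t ≤ 0, G t = 0) {a : ℝ}
    (ha : 0 ≤ a) : MemLp (fun t : ℝ => Complex.exp (-(a * t)) * G t) 2 volume := by
  refine hG.mono (AEStronglyMeasurable.mul (by fun_prop) hG.1) (Eventually.of_forall fun t => ?_)
  have := norm_exp_neg_mul_le hG0 (s := a) (a := 0) (by simpa using ha) t
  simpa using this

/-- On `Re s = a` the Laplace transform is the Fourier transform of `e^{-at} G`, so this is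
Plancherel. Boundary values thereby reduce to dominated convergence in time. -/
theorem eLpNorm_lap_sub_le {G : ℝ → ℂ} (hG : MemLp G 2 volume) (hG0 : ∀ t ≤ 0, G t = 0) {a : ℝ}
    (ha : 0 < a) :
    eLpNorm (fun ξ : ℝ => lap G (a + 2 * Real.pi * Complex.I * ξ)
      - (𝓕 (hG.toLp G) : Lp ℂ 2 (volume : Measure ℝ)) ξ) 2 volume
    = eLpNorm (fun t : ℝ => Complex.exp (-(a * t)) * G t - G t) 2 volume := by
  have m2 := memLp_exp_mul hG hG0 ha.le
  have m1 := integrable_exp_mul_of_memLp hG hG0 (s := a) (by simpa using ha)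
  have h := eLpNorm_fourierLp (m2.toLp _ - hG.toLp G)
  rw [show 𝓕 (m2.toLp _ - hG.toLp G) = 𝓕 (m2.toLp _) - 𝓕 (hG.toLp G) from
    (Lp.fourierTransformₗᵢ ℝ ℂ).map_sub _ _] at h
  have e1 : eLpNorm (fun t : ℝ => Complex.exp (-(a * t)) * G t - G t) 2 volume
      = eLpNorm (m2.toLp _ - hG.toLp G : Lp ℂ 2 (volume : Measure ℝ)) 2 volume := by
    refine eLpNorm_congr_ae ?_
    filter_upwards [Lp.coeFn_sub (m2.toLp _) (hG.toLp G), m2.coeFn_toLp, hG.coeFn_toLp]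
      with t h1 h2 h3
    rw [h1, Pi.sub_apply, h2, h3]
  rw [e1, ← h]
  refine eLpNorm_congr_ae ?_
  filter_upwards [Lp.coeFn_sub (𝓕 (m2.toLp _)) (𝓕 (hG.toLp G)), fourier_toLp_ae_eq m1 m2]
    with ξ h1 h2
  rw [h1, Pi.sub_apply, h2, lap_eq_fourier]

theorem eLpNorm_lap_le {G : ℝ → ℂ} (hG : MemLp G 2 volume) (hG0 : ∀ t ≤ 0, G t = 0) {a : ℝ}
    (ha : 0 < a) :
    eLpNorm (fun ξ : ℝ => lap G (a + 2 * Real.pi * Complex.I * ξ)) 2 volume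
      ≤ eLpNorm G 2 volume := by
  have m2 := memLp_exp_mul hG hG0 ha.le
  have m1 := integrable_exp_mul_of_memLp hG hG0 (s := a) (by simpa using ha)
  calc eLpNorm (fun ξ : ℝ => lap G (a + 2 * Real.pi * Complex.I * ξ)) 2 volume
      = eLpNorm (𝓕 (m2.toLp _) : Lp ℂ 2 (volume : Measure ℝ)) 2 volume := by
        refine eLpNorm_congr_ae ?_
        filter_upwards [fourier_toLp_ae_eq m1 m2] with ξ h2
        rw [h2, lap_eq_fourier]
    _ = eLpNorm (fun t : ℝ => Complex.exp (-(a * t)) * G t) 2 volume := by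
        rw [eLpNorm_fourierLp]; exact eLpNorm_congr_ae m2.coeFn_toLp
    _ ≤ eLpNorm G 2 volume := by
        refine eLpNorm_mono fun t => ?_
        have := norm_exp_neg_mul_le hG0 (s := a) (a := 0) (by simpa using ha.le) t
        simpa using this

/-- `L²` boundary values of the Laplace transform. -/
theorem tendsto_eLpNorm_lap_sub {G : ℝ → ℂ} (hG : MemLp G 2 volume) (hG0 : ∀ t ≤ 0, G t = 0) :
    Tendsto (fun a : ℝ => eLpNorm (fun ξ : ℝ => lap G (a + 2 * Real.pi * Complex.I * ξ)
      - (𝓕 (hG.toLp G) : Lp ℂ 2 (volume : Measure ℝ)) ξ) 2 volume) (𝓝[>] 0) (𝓝 0) := by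
  have : Tendsto (fun a : ℝ => eLpNorm (fun t : ℝ => Complex.exp (-(a * t)) * G t - G t) 2 volume)
      (𝓝[>] 0) (𝓝 0) := by
    refine tendsto_eLpNorm_two_sub_of_dominated (b := fun t => ‖G t‖)
      (Eventually.of_forall fun a => AEStronglyMeasurable.mul (by fun_prop) hG.1) hG.1 hG.norm ?_
      (Eventually.of_forall fun t => le_rfl) (Eventually.of_forall fun t => ?_)
    · filter_upwards [self_mem_nhdsWithin] with a ha
      refine Eventually.of_forall fun t => ?_
      have := norm_exp_neg_mul_le hG0 (s := a) (a := 0) (by simpa using (mem_Ioi.1 ha).le) t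
      simpa using this
    · have hc : Continuous (fun a : ℝ => Complex.exp (-(a * t)) * G t) := by fun_prop
      have := (hc.tendsto 0).mono_left (nhdsWithin_le_nhds (s := Ioi 0))
      simpa using this
  refine this.congr' ?_
  filter_upwards [self_mem_nhdsWithin] with a ha
  exact (eLpNorm_lap_sub_le hG hG0 ha).symm

/-- Comparison with `1/(1+ξ²)`. This function is the common L² majorant of a symbol on all vertical
lines. -/
theorem memLp_inv_norm_one_add (M : ℝ) :
    MemLp (fun ξ : ℝ => M / ‖(1 : ℂ) + 2 * Real.pi * Complex.I * ξ‖) 2 volume := by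
  have hne : ∀ ξ : ℝ, ‖(1 : ℂ) + 2 * Real.pi * Complex.I * ξ‖ ≠ 0 := fun ξ h => by
    have := congrArg Complex.re (norm_eq_zero.1 h)
    simp at this
  have hc : Continuous (fun ξ : ℝ => M / ‖(1 : ℂ) + 2 * Real.pi * Complex.I * ξ‖) :=
    continuous_const.div (by fun_prop) hne
  rw [memLp_two_iff_integrable_sq hc.aestronglyMeasurable]
  refine (integrable_inv_one_add_sq.const_mul (M ^ 2)).mono' (hc.pow 2).aestronglyMeasurable
    (Eventually.of_forall fun ξ => ?_)
  rw [div_pow, norm_div, ← div_eq_mul_inv, Real.norm_of_nonneg (by positivity),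
    Real.norm_of_nonneg (by positivity)]
  gcongr
  rw [← Complex.normSq_eq_norm_sq, Complex.normSq_apply]
  simp
  have : 1 ≤ (2 * Real.pi) := by linarith [Real.pi_gt_three]
  have := sq_nonneg ξ
  have := mul_le_mul_of_nonneg_right (one_le_pow₀ ‹1 ≤ 2 * Real.pi› (n := 2)) this
  nlinarith

theorem norm_one_add_line_le {a ξ : ℝ} (ha : 0 ≤ a) :
    ‖(1 : ℂ) + 2 * Real.pi * Complex.I * ξ‖ ≤ ‖(1 : ℂ) + (a + 2 * Real.pi * Complex.I * ξ)‖ := by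
  rw [← sq_le_sq₀ (norm_nonneg _) (norm_nonneg _), ← Complex.normSq_eq_norm_sq,
    ← Complex.normSq_eq_norm_sq, Complex.normSq_apply, Complex.normSq_apply]
  simp
  nlinarith

/-- `A` is holomorphic in the right half plane, bounded by `M / |1 + s|`, and has boundary values
a.e. on the imaginary axis. -/
structure IsHardySymbol (A : ℂ → ℂ) (M : ℝ) : Prop where
  nonneg : 0 ≤ M
  differentiableOn : DifferentiableOn ℂ A {s | 0 < s.re}
  bound : ∀ s : ℂ, 0 ≤ s.re → ‖A s‖ ≤ M / ‖1 + s‖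
  boundary : ∀ᵐ ξ : ℝ, Tendsto (fun a : ℝ => A (a + 2 * Real.pi * Complex.I * ξ)) (𝓝[>] 0)
    (𝓝 (A (2 * Real.pi * Complex.I * ξ)))

namespace IsHardySymbol

variable {A : ℂ → ℂ} {M : ℝ}

theorem norm_line_le (hA : IsHardySymbol A M) {a : ℝ} (ha : 0 ≤ a) (ξ : ℝ) :
    ‖A (a + 2 * Real.pi * Complex.I * ξ)‖ ≤ M / ‖(1 : ℂ) + 2 * Real.pi * Complex.I * ξ‖ := by
  refine (hA.bound _ (by simpa using ha)).trans ?_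
  have : 0 < ‖(1 : ℂ) + 2 * Real.pi * Complex.I * ξ‖ := norm_pos_iff.2 fun h => by
    have := congrArg Complex.re h
    simp at this
  have := hA.nonneg
  gcongr
  exact norm_one_add_line_le ha

theorem norm_axis_le (hA : IsHardySymbol A M) (ξ : ℝ) :
    ‖A (2 * Real.pi * Complex.I * ξ)‖ ≤ M / ‖(1 : ℂ) + 2 * Real.pi * Complex.I * ξ‖ := by
  simpa using hA.norm_line_le le_rfl ξ

theorem continuous_line (hA : IsHardySymbol A M) {a : ℝ} (ha : 0 < a) :
    Continuous (fun ξ : ℝ => A (a + 2 * Real.pi * Complex.I * ξ)) := by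
  refine hA.differentiableOn.continuousOn.comp_continuous (by fun_prop) fun ξ => ?_
  simpa using ha

/-- The values on the axis are a.e. limits of the continuous restrictions to nearby vertical lines;
no regularity on the axis is assumed. -/
theorem aestronglyMeasurable_axis (hA : IsHardySymbol A M) :
    AEStronglyMeasurable (fun ξ : ℝ => A (2 * Real.pi * Complex.I * ξ)) volume := by
  obtain ⟨v, hv, hlim⟩ := exists_seq_tendsto (𝓝[>] (0 : ℝ)) |>.imp
    fun v hv => And.intro (hv.eventually self_mem_nhdsWithin) hv
  obtain ⟨N, hN⟩ := eventually_atTop.1 hv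
  refine aestronglyMeasurable_of_tendsto_ae (u := atTop)
    (f := fun n (ξ : ℝ) => A (v (n + N) + 2 * Real.pi * Complex.I * ξ)) (fun n => ?_) ?_
  · exact (hA.continuous_line (hN _ (by omega))).aestronglyMeasurable
  · filter_upwards [hA.boundary] with ξ hξ
    exact hξ.comp (hlim.comp (tendsto_add_atTop_nat N))

theorem memLp_line (hA : IsHardySymbol A M) {a : ℝ} (ha : 0 < a) :
    MemLp (fun ξ : ℝ => A (a + 2 * Real.pi * Complex.I * ξ)) 2 volume :=
  (memLp_inv_norm_one_add M).mono' (hA.continuous_line ha).aestronglyMeasurable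
    (Eventually.of_forall fun ξ => hA.norm_line_le ha.le ξ)

theorem memLp_axis (hA : IsHardySymbol A M) :
    MemLp (fun ξ : ℝ => A (2 * Real.pi * Complex.I * ξ)) 2 volume :=
  (memLp_inv_norm_one_add M).mono' hA.aestronglyMeasurable_axis
    (Eventually.of_forall fun ξ => hA.norm_axis_le ξ)

theorem eLpNorm_line_le (hA : IsHardySymbol A M) {a : ℝ} (ha : 0 ≤ a) :
    eLpNorm (fun ξ : ℝ => A (a + 2 * Real.pi * Complex.I * ξ)) 2 volume
      ≤ eLpNorm (fun ξ : ℝ => M / ‖(1 : ℂ) + 2 * Real.pi * Complex.I * ξ‖) 2 volume :=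
  eLpNorm_mono_real fun ξ => hA.norm_line_le ha ξ

theorem tendsto_eLpNorm_line_sub (hA : IsHardySymbol A M) :
    Tendsto (fun a : ℝ => eLpNorm (fun ξ : ℝ => A (a + 2 * Real.pi * Complex.I * ξ)
      - A (2 * Real.pi * Complex.I * ξ)) 2 volume) (𝓝[>] 0) (𝓝 0) := by
  refine tendsto_eLpNorm_two_sub_of_dominated ?_ hA.aestronglyMeasurable_axis
    (memLp_inv_norm_one_add M) ?_ (Eventually.of_forall hA.norm_axis_le) hA.boundary
  · filter_upwards [self_mem_nhdsWithin] with a ha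
    exact (hA.continuous_line ha).aestronglyMeasurable
  · filter_upwards [self_mem_nhdsWithin] with a ha
    exact Eventually.of_forall (hA.norm_line_le (mem_Ioi.1 ha).le)

variable {G : ℝ → ℂ}

theorem continuous_lap_line (hG : MemLp G 2 volume) (hG0 : ∀ t ≤ 0, G t = 0) {a : ℝ} (ha : 0 < a) :
    Continuous (fun ξ : ℝ => lap G (a + 2 * Real.pi * Complex.I * ξ)) := by
  refine (lap_differentiableOn hG0 fun s hs =>
    integrable_exp_mul_of_memLp hG hG0 hs).continuousOn.comp_continuous (by fun_prop) fun ξ => ?_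
  simpa using ha

theorem memLp_lap_line (hG : MemLp G 2 volume) (hG0 : ∀ t ≤ 0, G t = 0) {a : ℝ} (ha : 0 < a) :
    MemLp (fun ξ : ℝ => lap G (a + 2 * Real.pi * Complex.I * ξ)) 2 volume :=
  ⟨(continuous_lap_line hG hG0 ha).aestronglyMeasurable,
    (eLpNorm_lap_le hG hG0 ha).trans_lt hG.2⟩

theorem integrable_line (hA : IsHardySymbol A M) (hG : MemLp G 2 volume) (hG0 : ∀ t ≤ 0, G t = 0)
    {a : ℝ} (ha : 0 < a) : Integrable (fun ξ : ℝ => lap G (a + 2 * Real.pi * Complex.I * ξ)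
      * A (a + 2 * Real.pi * Complex.I * ξ)) :=
  MemLp.integrable_mul (memLp_lap_line hG hG0 ha) (hA.memLp_line ha)

theorem integrable_axis (hA : IsHardySymbol A M) (g : Lp ℂ 2 (volume : Measure ℝ)) :
    Integrable (fun ξ : ℝ => g ξ * A (2 * Real.pi * Complex.I * ξ)) :=
  MemLp.integrable_mul (Lp.memLp g) hA.memLp_axis

/-- The integral `e^{at} 𝓕⁻(lap G · A)(t)` along `Re s = a` does not depend on `a > 0`. -/
theorem fourierInv_line_eq (hA : IsHardySymbol A M) (hG : MemLp G 2 volume)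
    (hG0 : ∀ t ≤ 0, G t = 0) {a b : ℝ} (ha : 0 < a) (hab : a ≤ b) (t : ℝ) :
    Complex.exp (a * t) * 𝓕⁻ (fun ξ : ℝ => lap G (a + 2 * Real.pi * Complex.I * ξ)
      * A (a + 2 * Real.pi * Complex.I * ξ)) t
    = Complex.exp (b * t) * 𝓕⁻ (fun ξ : ℝ => lap G (b + 2 * Real.pi * Complex.I * ξ)
      * A (b + 2 * Real.pi * Complex.I * ξ)) t := by
  set f : ℂ → ℂ := fun s => Complex.exp (s * t) * (lap G s * A s) with hf
  have hpi : (2 * Real.pi : ℝ) ≠ 0 := by positivity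
  have hline : ∀ c : ℝ, Complex.exp (c * t) * 𝓕⁻ (fun ξ : ℝ =>
      lap G (c + 2 * Real.pi * Complex.I * ξ) * A (c + 2 * Real.pi * Complex.I * ξ)) t
      = |(2 * Real.pi)⁻¹| • ∫ y : ℝ, f (c + y * Complex.I) := by
    intro c
    rw [← Measure.integral_comp_mul_left (fun y : ℝ => f (c + y * Complex.I)) (2 * Real.pi),
      fourierInv_eq_integral_exp, ← integral_const_mul]
    refine integral_congr_ae (Eventually.of_forall fun ξ => ?_)
    simp only [hf]
    have : (c : ℂ) + ((2 * Real.pi * ξ : ℝ) : ℂ) * Complex.I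
        = c + 2 * Real.pi * Complex.I * ξ := by push_cast; ring
    rw [this, ← mul_assoc, ← Complex.exp_add]
    congr 2; ring
  have hint : ∀ c : ℝ, 0 < c → Integrable (fun y : ℝ => f (c + y * Complex.I)) := by
    intro c hc
    rw [← integrable_comp_mul_left_iff (fun y : ℝ => f (c + y * Complex.I)) hpi]
    have h1 := (hA.integrable_line hG hG0 hc).bdd_mul
      (f := fun ξ : ℝ => Complex.exp ((c + 2 * Real.pi * Complex.I * ξ) * t))
      (c := Real.exp (c * t)) (by fun_prop)
      (Eventually.of_forall fun ξ => by rw [Complex.norm_exp]; simp)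
    refine h1.congr (Eventually.of_forall fun ξ => ?_)
    simp only [hf]
    have : (c : ℂ) + ((2 * Real.pi * ξ : ℝ) : ℂ) * Complex.I
        = c + 2 * Real.pi * Complex.I * ξ := by push_cast; ring
    rw [this]
  have hlapint := fun s hs => integrable_exp_mul_of_memLp hG hG0 (s := s) hs
  rw [hline, hline, integral_vertical_line_eq (f := f) hab ?_ (hint a ha)
    (hint b (ha.trans_le hab))
    (C := Real.exp (|b| * |t|) * ((∫ t : ℝ, ‖Complex.exp (-(a * t)) * G t‖) * M)) ?_]
  · have hsub : {s : ℂ | s.re ∈ Icc a b} ⊆ {s | 0 < s.re} := fun s hs => ha.trans_le hs.1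
    have h1 : DifferentiableOn ℂ (fun s : ℂ => Complex.exp (s * t)) {s : ℂ | s.re ∈ Icc a b} := by
      fun_prop
    exact h1.mul (((lap_differentiableOn hG0 hlapint).mono hsub).mul (hA.differentiableOn.mono hsub))
  · intro s hs
    have hs0 : 0 < s.re := ha.trans_le hs.1
    have h1 : ‖Complex.exp (s * t)‖ ≤ Real.exp (|b| * |t|) := by
      rw [Complex.norm_exp]
      gcongr
      calc (s * t).re = s.re * t := by simp
        _ ≤ |s.re * t| := le_abs_self _
        _ = |s.re| * |t| := abs_mul _ _
        _ ≤ |b| * |t| := by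
          refine mul_le_mul_of_nonneg_right ?_ (abs_nonneg t)
          exact (abs_of_pos hs0).le.trans (hs.2.trans (le_abs_self b))
    have h2 := norm_lap_le hG0 (a := a) (hlapint a (by simpa using ha)) hs.1
    -- The decay of `A` pays for the factor `|Im s|` that the contour shift requires; the
    -- exponential and `lap G` are merely bounded on the strip.
    have h3 : ‖A s‖ * |s.im| ≤ M := by
      have h := hA.bound s hs0.le
      have hpos : 0 < ‖1 + s‖ := norm_pos_iff.2 fun h => by
        have := congrArg Complex.re h
        simp at this; linarith
      have him : |s.im| ≤ ‖1 + s‖ := by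
        simpa using Complex.abs_im_le_norm (1 + s)
      have hM := hA.nonneg
      calc ‖A s‖ * |s.im| ≤ (M / ‖1 + s‖) * ‖1 + s‖ := by gcongr
        _ = M := by field_simp
    calc ‖f s‖ * |s.im| = ‖Complex.exp (s * t)‖ * (‖lap G s‖ * (‖A s‖ * |s.im|)) := by
          simp only [hf, norm_mul]; ring
      _ ≤ _ := by gcongr

/-- Paley–Wiener argument: the integral along `Re s = b` is bounded uniformly in `b` by
Cauchy–Schwarz, while the prefactor `e^{bt}` tends to `0` as `b → ∞` because `t < 0`. -/
theorem fourierInv_line_eq_zero (hA : IsHardySymbol A M) (hG : MemLp G 2 volume)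
    (hG0 : ∀ t ≤ 0, G t = 0) {a : ℝ} (ha : 0 < a) {t : ℝ} (ht : t < 0) :
    𝓕⁻ (fun ξ : ℝ => lap G (a + 2 * Real.pi * Complex.I * ξ)
      * A (a + 2 * Real.pi * Complex.I * ξ)) t = 0 := by
  set Φ : ℝ → ℝ → ℂ := fun a ξ => lap G (a + 2 * Real.pi * Complex.I * ξ)
      * A (a + 2 * Real.pi * Complex.I * ξ) with hΦ
  set K := eLpNorm G 2 volume
    * eLpNorm (fun ξ : ℝ => M / ‖(1 : ℂ) + 2 * Real.pi * Complex.I * ξ‖) 2 volume with hK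
  have hKtop : K ≠ ∞ := ENNReal.mul_ne_top hG.2.ne (memLp_inv_norm_one_add M).2.ne
  have hb : ∀ b : ℝ, 0 < b → ‖𝓕⁻ (Φ b) t‖ ≤ K.toReal := by
    intro b hb
    refine (norm_fourierInv_le _ _).trans ?_
    rw [integral_norm_eq_lintegral_enorm (hA.integrable_line hG hG0 hb).1]
    refine ENNReal.toReal_mono hKtop ?_
    refine (integral_norm_mul_le (memLp_lap_line hG hG0 hb).1 (hA.memLp_line hb).1).trans ?_
    exact mul_le_mul' (eLpNorm_lap_le hG hG0 hb) (hA.eLpNorm_line_le hb.le)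
  have hlim : Tendsto (fun b : ℝ => Real.exp (b * t) * K.toReal) atTop (𝓝 0) := by
    have : Tendsto (fun b : ℝ => b * t) atTop atBot := tendsto_id.atTop_mul_const_of_neg ht
    simpa using (Real.tendsto_exp_atBot.comp this).mul_const K.toReal
  have h0 : Complex.exp (a * t) * 𝓕⁻ (Φ a) t = 0 := by
    rw [← norm_le_zero_iff]
    refine ge_of_tendsto hlim ?_
    filter_upwards [eventually_ge_atTop a] with b hab
    rw [hA.fourierInv_line_eq hG hG0 ha hab t, norm_mul, Complex.norm_exp]
    have h1 : ((b : ℂ) * t).re = b * t := by simp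
    rw [h1]
    gcongr
    exact hb b (ha.trans_le hab)
  exact (mul_eq_zero.1 h0).resolve_left (Complex.exp_ne_zero _)

/-- Both factors converge in L² as `a → 0`, so their product converges in L¹, and the inverse
transform is controlled by the L¹ norm. -/
theorem tendsto_fourierInv_line (hA : IsHardySymbol A M) (hG : MemLp G 2 volume)
    (hG0 : ∀ t ≤ 0, G t = 0) (t : ℝ) :
    Tendsto (fun a : ℝ => 𝓕⁻ (fun ξ : ℝ => lap G (a + 2 * Real.pi * Complex.I * ξ)
      * A (a + 2 * Real.pi * Complex.I * ξ)) t) (𝓝[>] 0)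
      (𝓝 (𝓕⁻ (fun ξ : ℝ => (𝓕 (hG.toLp G) : Lp ℂ 2 (volume : Measure ℝ)) ξ
        * A (2 * Real.pi * Complex.I * ξ)) t)) := by
  have hT := tendsto_eLpNorm_lap_sub hG hG0
  have hĜm : MemLp (𝓕 (hG.toLp G) : Lp ℂ 2 (volume : Measure ℝ)) 2 volume := Lp.memLp _
  have hĜi := hA.integrable_axis (𝓕 (hG.toLp G))
  generalize ((𝓕 (hG.toLp G) : Lp ℂ 2 (volume : Measure ℝ)) : ℝ → ℂ) = Ĝ at *
  set m := eLpNorm (fun ξ : ℝ => M / ‖(1 : ℂ) + 2 * Real.pi * Complex.I * ξ‖) 2 volume with hm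
  have hmtop : m ≠ ∞ := (memLp_inv_norm_one_add M).2.ne
  have hbound : Tendsto (fun a : ℝ => eLpNorm (fun ξ : ℝ =>
        lap G (a + 2 * Real.pi * Complex.I * ξ) - Ĝ ξ) 2 volume * m
      + eLpNorm Ĝ 2 volume * eLpNorm (fun ξ : ℝ => A (a + 2 * Real.pi * Complex.I * ξ)
        - A (2 * Real.pi * Complex.I * ξ)) 2 volume) (𝓝[>] 0) (𝓝 0) := by
    have h1 := ENNReal.Tendsto.mul_const hT (b := m) (Or.inr hmtop)
    have h2 := ENNReal.Tendsto.const_mul hA.tendsto_eLpNorm_line_sub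
      (a := eLpNorm Ĝ 2 volume) (Or.inr hĜm.2.ne)
    simpa using h1.add h2
  rw [tendsto_iff_edist_tendsto_0]
  refine tendsto_of_tendsto_of_tendsto_of_le_of_le' tendsto_const_nhds hbound
    (Eventually.of_forall fun _ => zero_le) ?_
  filter_upwards [self_mem_nhdsWithin] with a ha
  have ha' : 0 < a := ha
  have hexp : ∀ φ : ℝ → ℂ, Integrable φ →
      Integrable fun ξ : ℝ => Complex.exp (2 * Real.pi * Complex.I * ξ * t) * φ ξ := by
    intro φ hφ
    refine hφ.bdd_mul (c := 1) (by fun_prop) (Eventually.of_forall fun ξ => ?_)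
    rw [Complex.norm_exp]; simp
  have n1 : AEStronglyMeasurable (fun ξ : ℝ => lap G (a + 2 * Real.pi * Complex.I * ξ) - Ĝ ξ)
      volume := (memLp_lap_line hG hG0 ha').1.sub hĜm.1
  have n2 : AEStronglyMeasurable (fun ξ : ℝ => A (a + 2 * Real.pi * Complex.I * ξ)
      - A (2 * Real.pi * Complex.I * ξ)) volume := (hA.memLp_line ha').1.sub hA.memLp_axis.1
  have n3 := (hA.memLp_line ha').1
  rw [edist_eq_enorm_sub, fourierInv_eq_integral_exp, fourierInv_eq_integral_exp,
    ← integral_sub (hexp _ (hA.integrable_line hG hG0 ha')) (hexp _ hĜi)]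
  refine (enorm_integral_le_lintegral_enorm _).trans ?_
  calc _ ≤ ∫⁻ ξ : ℝ, (‖(lap G (a + 2 * Real.pi * Complex.I * ξ) - Ĝ ξ)
          * A (a + 2 * Real.pi * Complex.I * ξ)‖ₑ + ‖Ĝ ξ * (A (a + 2 * Real.pi * Complex.I * ξ)
        - A (2 * Real.pi * Complex.I * ξ))‖ₑ) := by
        refine lintegral_mono fun ξ => ?_
        rw [← mul_sub, enorm_mul]
        have : ‖Complex.exp (2 * Real.pi * Complex.I * ξ * t)‖ₑ = 1 := by
          rw [← ofReal_norm, Complex.norm_exp]; simp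
        rw [this, one_mul]
        refine le_trans (le_of_eq ?_) (enorm_add_le _ _)
        congr 1; ring
    _ = _ := lintegral_add_left' (n1.mul n3).enorm _
    _ ≤ _ := by
        gcongr
        · refine (integral_norm_mul_le n1 n3).trans ?_
          gcongr
          exact hA.eLpNorm_line_le ha'.le
        · exact integral_norm_mul_le hĜm.1 n2

theorem fourierInv_axis_eq_line (hA : IsHardySymbol A M) (hG : MemLp G 2 volume)
    (hG0 : ∀ t ≤ 0, G t = 0) {a : ℝ} (ha : 0 < a) (t : ℝ) :
    𝓕⁻ (fun ξ : ℝ => (𝓕 (hG.toLp G) : Lp ℂ 2 (volume : Measure ℝ)) ξ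
        * A (2 * Real.pi * Complex.I * ξ)) t
    = Complex.exp (a * t) * 𝓕⁻ (fun ξ : ℝ => lap G (a + 2 * Real.pi * Complex.I * ξ)
      * A (a + 2 * Real.pi * Complex.I * ξ)) t := by
  have h1 := hA.tendsto_fourierInv_line hG hG0 t
  have h2 : Tendsto (fun b : ℝ => Complex.exp (b * t)) (𝓝[>] 0) (𝓝 1) := by
    have hc : Continuous (fun b : ℝ => Complex.exp (b * t)) := by fun_prop
    simpa using (hc.tendsto 0).mono_left (nhdsWithin_le_nhds (s := Ioi 0))
  have h3 := h2.mul h1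
  rw [one_mul] at h3
  refine tendsto_nhds_unique h3 (tendsto_const_nhds.congr' ?_)
  filter_upwards [Ioo_mem_nhdsGT ha] with b hb
  exact (hA.fourierInv_line_eq hG hG0 hb.1 hb.2.le t).symm

/-- **Causality.** -/
theorem fourierInv_axis_eq_zero (hA : IsHardySymbol A M) (hG : MemLp G 2 volume)
    (hG0 : ∀ t ≤ 0, G t = 0) {t : ℝ} (ht : t ≤ 0) :
    𝓕⁻ (fun ξ : ℝ => (𝓕 (hG.toLp G) : Lp ℂ 2 (volume : Measure ℝ)) ξ
        * A (2 * Real.pi * Complex.I * ξ)) t = 0 := by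
  -- The contour argument covers `t < 0` only; continuity adds `t = 0`, which later gives the
  -- initial condition.
  have hc := continuous_fourierInv (hA.integrable_axis (𝓕 (hG.toLp G)))
  have hcl : IsClosed {t | 𝓕⁻ (fun ξ : ℝ => (𝓕 (hG.toLp G) : Lp ℂ 2 (volume : Measure ℝ)) ξ
        * A (2 * Real.pi * Complex.I * ξ)) t = 0} := isClosed_eq hc continuous_const
  have hsub : Iio (0 : ℝ) ⊆ {t | 𝓕⁻ (fun ξ : ℝ => (𝓕 (hG.toLp G) : Lp ℂ 2 (volume : Measure ℝ)) ξ
        * A (2 * Real.pi * Complex.I * ξ)) t = 0} := fun t ht => by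
    rw [mem_ofPred_eq, hA.fourierInv_axis_eq_line hG hG0 one_pos, hA.fourierInv_line_eq_zero hG hG0 one_pos ht,
      mul_zero]
  have := hcl.closure_subset_iff.2 hsub
  rw [closure_Iio] at this
  exact this ht

theorem integrable_exp_mul_fourierInv (hA : IsHardySymbol A M) (hG : MemLp G 2 volume)
    (hG0 : ∀ t ≤ 0, G t = 0) {s : ℂ} (hs : 0 < s.re) :
    Integrable (fun t : ℝ => Complex.exp (-(s * t)) * 𝓕⁻ (fun ξ : ℝ =>
      (𝓕 (hG.toLp G) : Lp ℂ 2 (volume : Measure ℝ)) ξ * A (2 * Real.pi * Complex.I * ξ)) t) := by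
  have hc := continuous_fourierInv (hA.integrable_axis (𝓕 (hG.toLp G)))
  have h1 : Integrable ((Ioi (0 : ℝ)).indicator fun t => Real.exp (-s.re * t)) :=
    (integrable_indicator_iff measurableSet_Ioi).2 (integrableOn_exp_mul_Ioi (by linarith) 0)
  refine (h1.mul_const (∫ ξ : ℝ, ‖(𝓕 (hG.toLp G) : Lp ℂ 2 (volume : Measure ℝ)) ξ
    * A (2 * Real.pi * Complex.I * ξ)‖)).mono' (by fun_prop) (Eventually.of_forall fun t => ?_)
  rcases le_or_gt t 0 with ht | ht
  · rw [hA.fourierInv_axis_eq_zero hG hG0 ht]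
    simp [ht]
  · rw [norm_mul, norm_exp_neg_mul, indicator_of_mem (mem_Ioi.2 ht), neg_mul]
    gcongr
    exact norm_fourierInv_le _ _

/-- Weighted by `e^{-t Re s}`, the causal function equals the inverse Fourier transform of the
product on the line through `s`; it is integrable, so Fourier inversion recovers the product. -/
theorem lap_fourierInv (hA : IsHardySymbol A M) (hG : MemLp G 2 volume)
    (hG0 : ∀ t ≤ 0, G t = 0) {s : ℂ} (hs : 0 < s.re) :
    lap (𝓕⁻ (fun ξ : ℝ => (𝓕 (hG.toLp G) : Lp ℂ 2 (volume : Measure ℝ)) ξ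
        * A (2 * Real.pi * Complex.I * ξ))) s = lap G s * A s := by
  obtain ⟨ξ, hξ⟩ : ∃ ξ : ℝ, s = (s.re : ℝ) + 2 * Real.pi * Complex.I * ξ := by
    refine ⟨s.im / (2 * Real.pi), ?_⟩
    have hpi : (Real.pi : ℂ) ≠ 0 := by exact_mod_cast Real.pi_ne_zero
    conv_lhs => rw [← Complex.re_add_im s]
    push_cast
    field_simp
  set Φ : ℝ → ℂ := fun ξ => lap G (s.re + 2 * Real.pi * Complex.I * ξ)
      * A (s.re + 2 * Real.pi * Complex.I * ξ) with hΦ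
  have hfun : (fun t : ℝ => Complex.exp (-(s.re * t)) * 𝓕⁻ (fun ξ : ℝ =>
      (𝓕 (hG.toLp G) : Lp ℂ 2 (volume : Measure ℝ)) ξ * A (2 * Real.pi * Complex.I * ξ)) t)
      = 𝓕⁻ Φ := by
    ext t
    rw [hA.fourierInv_axis_eq_line hG hG0 hs, ← mul_assoc, ← Complex.exp_add]
    simp [hΦ]
  have hint : Integrable (𝓕⁻ Φ) := by
    rw [← hfun]
    simpa using hA.integrable_exp_mul_fourierInv hG hG0 (s := (s.re : ℝ)) (by simpa using hs)
  have hΦc : Continuous Φ := (continuous_lap_line hG hG0 hs).mul (hA.continuous_line hs)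
  have hΦi : Integrable Φ := hA.integrable_line hG hG0 hs
  rw [hξ, lap_eq_fourier]
  rw [hfun]
  -- Fourier inversion needs `𝓕 Φ` integrable; it is the reflection of `𝓕⁻ Φ`.
  have hFi : Integrable (𝓕 Φ) := by
    have : 𝓕 Φ = fun t => 𝓕⁻ Φ (-t) := by
      ext t; rw [Real.fourierInv_eq_fourier_neg, neg_neg]
    rw [this]; exact hint.comp_neg
  rw [hΦc.fourier_fourierInv_eq hΦi hFi]

end IsHardySymbol

end HardySpace

/-! ### Resolvent solutions for one path, with bounds uniform in the sector -/

section ModeFunctions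

open Filter Topology

/-- The closed sector `|Im r| ≤ Re r`, which contains `s^{α/2}` for `Re s ≥ 0` and `α ≤ 1`. -/
def sector : Set ℂ := {r | |r.im| ≤ r.re}

/-- The sharp constant is `√2`; `3/2` avoids the root. -/
theorem norm_le_of_mem_sector {r : ℂ} (hr : r ∈ sector) : ‖r‖ ≤ 3 / 2 * r.re := by
  have h1 : |r.im| ≤ r.re := hr
  have h0 : 0 ≤ r.re := (abs_nonneg _).trans h1
  have h2 : r.im ^ 2 ≤ r.re ^ 2 := sq_le_sq' (by linarith [neg_abs_le r.im]) ((le_abs_self _).trans h1)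
  rw [← sq_le_sq₀ (norm_nonneg _) (by positivity), ← Complex.normSq_eq_norm_sq,
    Complex.normSq_apply]
  nlinarith

/-- With `r = a + ib`, `|cosh r|² = cosh² a - sin² b`. In the sector `sin² b ≤ min(1, a²)`, and
`cosh² a ≥ 1 + a²`, so `sin² b` is at most half of `cosh² a`; finally `e^a ≤ 2 cosh a`. -/
theorem norm_cosh_ge {r : ℂ} (hr : r ∈ sector) : Real.exp r.re / 3 ≤ ‖Complex.cosh r‖ := by
  have h1 : |r.im| ≤ r.re := hr
  have h0 : 0 ≤ r.re := (abs_nonneg _).trans h1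
  have h2 : r.im ^ 2 ≤ r.re ^ 2 := sq_le_sq' (by linarith [neg_abs_le r.im]) ((le_abs_self _).trans h1)
  have hn : ‖Complex.cosh r‖ ^ 2 = Real.cosh r.re ^ 2 - Real.sin r.im ^ 2 := by
    rw [← Complex.normSq_eq_norm_sq, Complex.normSq_apply]
    have hre : (Complex.cosh r).re = Real.cosh r.re * Real.cos r.im := by
      conv_lhs => rw [← Complex.re_add_im r]
      rw [Complex.cosh_add, Complex.cosh_mul_I, Complex.sinh_mul_I, ← Complex.ofReal_cosh,
        ← Complex.ofReal_cos, ← Complex.ofReal_sinh, ← Complex.ofReal_sin]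
      simp only [Complex.add_re, Complex.mul_re, Complex.mul_im,
        Complex.ofReal_re, Complex.ofReal_im, Complex.I_re, Complex.I_im]
      ring
    have him : (Complex.cosh r).im = Real.sinh r.re * Real.sin r.im := by
      conv_lhs => rw [← Complex.re_add_im r]
      rw [Complex.cosh_add, Complex.cosh_mul_I, Complex.sinh_mul_I, ← Complex.ofReal_cosh,
        ← Complex.ofReal_cos, ← Complex.ofReal_sinh, ← Complex.ofReal_sin]
      simp only [Complex.add_im, Complex.mul_re, Complex.mul_im,
        Complex.ofReal_re, Complex.ofReal_im, Complex.I_re, Complex.I_im]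
      ring
    rw [hre, him]
    have e1 := Real.cosh_sq r.re
    have e2 := Real.sin_sq_add_cos_sq r.im
    have e3 : Real.cos r.im ^ 2 = 1 - Real.sin r.im ^ 2 := by linarith
    have e4 : Real.sinh r.re ^ 2 = Real.cosh r.re ^ 2 - 1 := by linarith
    calc _ = Real.cosh r.re ^ 2 * Real.cos r.im ^ 2
        + Real.sinh r.re ^ 2 * Real.sin r.im ^ 2 := by ring
      _ = _ := by rw [e3, e4]; ring
  have hs1 : Real.sin r.im ^ 2 ≤ 1 := by nlinarith [Real.sin_sq_add_cos_sq r.im, sq_nonneg (Real.cos r.im)]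
  have hs2 : Real.sin r.im ^ 2 ≤ r.im ^ 2 := Real.sin_sq_le_sq
  have hc : 1 + r.re ^ 2 ≤ Real.cosh r.re ^ 2 := by
    have := Real.cosh_sq r.re
    have := Real.self_le_sinh_iff.2 h0
    nlinarith
  have hexp : Real.exp r.re ≤ 2 * Real.cosh r.re := by
    rw [Real.cosh_eq]; linarith [Real.exp_pos (-r.re)]
  have hcp := Real.cosh_pos r.re
  rw [← sq_le_sq₀ (by positivity) (norm_nonneg _), hn]
  have : Real.exp r.re ^ 2 ≤ 4 * Real.cosh r.re ^ 2 := by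
    nlinarith [Real.exp_pos r.re]
  rw [div_pow]
  linarith

theorem cosh_ne_zero_of_mem_sector {r : ℂ} (hr : r ∈ sector) : Complex.cosh r ≠ 0 := by
  have := norm_cosh_ge hr
  have h := Real.exp_pos r.re
  exact norm_pos_iff.1 (by linarith)

theorem norm_cosh_le {z : ℂ} (hz : 0 ≤ z.re) : ‖Complex.cosh z‖ ≤ Real.exp z.re := by
  rw [Complex.cosh, norm_div]
  have h1 : ‖Complex.exp z + Complex.exp (-z)‖ ≤ Real.exp z.re + Real.exp (-z.re) := by
    refine (norm_add_le _ _).trans ?_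
    rw [Complex.norm_exp, Complex.norm_exp, Complex.neg_re]
  have h2 : Real.exp (-z.re) ≤ Real.exp z.re := Real.exp_le_exp.2 (by linarith)
  rw [div_le_iff₀ (by simp)]
  simp only [Complex.norm_ofNat]
  linarith

theorem norm_sinh_le {z : ℂ} (hz : 0 ≤ z.re) : ‖Complex.sinh z‖ ≤ Real.exp z.re := by
  rw [Complex.sinh, norm_div]
  have h1 : ‖Complex.exp z - Complex.exp (-z)‖ ≤ Real.exp z.re + Real.exp (-z.re) := by
    refine (norm_sub_le _ _).trans ?_
    rw [Complex.norm_exp, Complex.norm_exp, Complex.neg_re]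
  have h2 : Real.exp (-z.re) ≤ Real.exp z.re := Real.exp_le_exp.2 (by linarith)
  rw [div_le_iff₀ (by simp)]
  simp only [Complex.norm_ofNat]
  linarith

/-- The growth `e^{Re r (1-x)}` of the outer factor and `e^{Re r x}` of the integrand multiply to
`e^{Re r}`, which is exactly what the lower bound on `cosh r` absorbs. -/
theorem norm_weighted_integral_le {w : ℝ → ℝ} (hw : Continuous w) {x : ℝ} (hx : x ∈ Icc (0 : ℝ) 1)
    {r : ℂ} (hr : r ∈ sector) {c : ℂ} {d : ℝ → ℂ} (hc : ‖c‖ ≤ Real.exp (r.re * (1 - x)))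
    (hd : ∀ y, 0 ≤ y → ‖d y‖ ≤ Real.exp (r.re * y)) :
    ‖c * (∫ y in (0 : ℝ)..x, d y * w y) / Complex.cosh r‖ ≤ 3 * ∫ y in (0 : ℝ)..x, |w y| := by
  have h0 : 0 ≤ r.re := (abs_nonneg _).trans hr
  have h1 : ‖∫ y in (0 : ℝ)..x, d y * w y‖ ≤ ∫ y in (0 : ℝ)..x, Real.exp (r.re * x) * |w y| := by
    refine intervalIntegral.norm_integral_le_of_norm_le hx.1 ?_
      (Continuous.intervalIntegrable (by fun_prop) _ _)
    refine Eventually.of_forall fun y hy => ?_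
    rw [norm_mul, Complex.norm_real, Real.norm_eq_abs]
    gcongr
    exact (hd y hy.1.le).trans (Real.exp_le_exp.2 (mul_le_mul_of_nonneg_left hy.2 h0))
  rw [intervalIntegral.integral_const_mul] at h1
  have hI : 0 ≤ ∫ y in (0 : ℝ)..x, |w y| :=
    intervalIntegral.integral_nonneg hx.1 fun y _ => abs_nonneg _
  have hcosh := norm_cosh_ge hr
  have hpos : 0 < ‖Complex.cosh r‖ := norm_pos_iff.2 (cosh_ne_zero_of_mem_sector hr)
  rw [norm_div, norm_mul, div_le_iff₀ hpos]
  calc ‖c‖ * ‖∫ y in (0 : ℝ)..x, d y * w y‖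
      ≤ Real.exp (r.re * (1 - x)) * (Real.exp (r.re * x) * ∫ y in (0 : ℝ)..x, |w y|) := by gcongr
    _ = 3 * (∫ y in (0 : ℝ)..x, |w y|) * (Real.exp r.re / 3) := by
        rw [← mul_assoc, ← Real.exp_add]
        have : r.re * (1 - x) + r.re * x = r.re := by ring
        rw [this]; ring
    _ ≤ _ := by gcongr

/-- Integrating `e^{Re r y}` instead of bounding it by its maximum gains a factor `1 / Re r`. That
gain compensates the factor `r` in `modeFlux`, at the price of a supremum bound on `w`. -/
theorem re_mul_norm_weighted_integral_le {w : ℝ → ℝ} {x : ℝ}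
    (hx : x ∈ Icc (0 : ℝ) 1) {r : ℂ} (hr : r ∈ sector) {c : ℂ} {d : ℝ → ℂ}
    (hc : ‖c‖ ≤ Real.exp (r.re * (1 - x))) (hd : ∀ y, 0 ≤ y → ‖d y‖ ≤ Real.exp (r.re * y))
    {M : ℝ} (hM : ∀ y ∈ Icc (0 : ℝ) 1, |w y| ≤ M) :
    r.re * ‖c * (∫ y in (0 : ℝ)..x, d y * w y) / Complex.cosh r‖ ≤ 3 * M := by
  have h0 : 0 ≤ r.re := (abs_nonneg _).trans hr
  have hM0 : 0 ≤ M := (abs_nonneg _).trans (hM 0 (by simp))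
  have hcosh := norm_cosh_ge hr
  have hpos : 0 < ‖Complex.cosh r‖ := norm_pos_iff.2 (cosh_ne_zero_of_mem_sector hr)
  rcases h0.eq_or_lt with h | hpos'
  · rw [← h]; simpa using hM0
  have h1 : ‖∫ y in (0 : ℝ)..x, d y * w y‖ ≤ ∫ y in (0 : ℝ)..x, M * Real.exp (r.re * y) := by
    refine intervalIntegral.norm_integral_le_of_norm_le hx.1 ?_
      (Continuous.intervalIntegrable (by fun_prop) _ _)
    refine Eventually.of_forall fun y hy => ?_
    rw [norm_mul, Complex.norm_real, Real.norm_eq_abs, mul_comm]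
    have := hM y ⟨hy.1.le, hy.2.trans hx.2⟩
    gcongr
    exact hd y hy.1.le
  have h2 : r.re * ∫ y in (0 : ℝ)..x, M * Real.exp (r.re * y) ≤ M * Real.exp (r.re * x) := by
    rw [intervalIntegral.integral_const_mul, intervalIntegral.integral_comp_mul_left (fun y => Real.exp y) hpos'.ne',
      integral_exp]
    simp only [mul_zero, Real.exp_zero, smul_eq_mul]
    rw [show r.re * (M * (r.re⁻¹ * (Real.exp (r.re * x) - 1))) = M * (Real.exp (r.re * x) - 1) by
      field_simp]
    nlinarith
  rw [norm_div, norm_mul, ← mul_div_assoc, div_le_iff₀ hpos]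
  calc r.re * (‖c‖ * ‖∫ y in (0 : ℝ)..x, d y * w y‖)
      = ‖c‖ * (r.re * ‖∫ y in (0 : ℝ)..x, d y * w y‖) := by ring
    _ ≤ Real.exp (r.re * (1 - x)) * (M * Real.exp (r.re * x)) := by
        exact mul_le_mul hc ((mul_le_mul_of_nonneg_left h1 h0).trans h2) (by positivity)
          (Real.exp_pos _).le
    _ = 3 * M * (Real.exp r.re / 3) := by
        rw [mul_left_comm, ← Real.exp_add]
        have : r.re * (1 - x) + r.re * x = r.re := by ring
        rw [this]; ring
    _ ≤ _ := by gcongr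

/-- `∫_0^x sinh(r y) w(y) dy` -/
def sinhInt (w : ℝ → ℝ) (x : ℝ) (r : ℂ) : ℂ := ∫ y in (0 : ℝ)..x, Complex.sinh (r * y) * w y

/-- `∫_x^1 cosh(r (1 - y)) w(y) dy`, after the substitution `y ↦ 1 - y` -/
def coshInt (w : ℝ → ℝ) (x : ℝ) (r : ℂ) : ℂ :=
  ∫ y in (0 : ℝ)..(1 - x), Complex.cosh (r * y) * w (1 - y)

/-- `∫_0^1 ∂_y g(x,y) w(y) dy` for the Green function `g` of `∂_xx - r²` on `(0,1)` with a Neumann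
condition at `0` and a Dirichlet condition at `1`. -/
def mode (w : ℝ → ℝ) (x : ℝ) (r : ℂ) : ℂ :=
  (Complex.cosh (r * x) * coshInt w x r - Complex.sinh (r * (1 - x)) * sinhInt w x r)
    / Complex.cosh r

/-- `∂_x mode + w` -/
def modeFlux (w : ℝ → ℝ) (x : ℝ) (r : ℂ) : ℂ :=
  r * (Complex.cosh (r * (1 - x)) * sinhInt w x r + Complex.sinh (r * x) * coshInt w x r)
    / Complex.cosh r

section

variable {w : ℝ → ℝ} {x : ℝ} {r : ℂ}

theorem hasDerivAt_sinhInt (hw : Continuous w) (x : ℝ) (r : ℂ) :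
    HasDerivAt (fun x => sinhInt w x r) (Complex.sinh (r * x) * w x) x :=
  (Continuous.integral_hasStrictDerivAt (f := fun y : ℝ => Complex.sinh (r * y) * (w y : ℂ))
    (by fun_prop) 0 x).hasDerivAt

theorem hasDerivAt_coshInt (hw : Continuous w) (x : ℝ) (r : ℂ) :
    HasDerivAt (fun x => coshInt w x r) (-(Complex.cosh (r * (1 - x)) * w x)) x := by
  have h := (Continuous.integral_hasStrictDerivAt
    (f := fun y : ℝ => Complex.cosh (r * y) * (w (1 - y) : ℂ)) (by fun_prop) 0 (1 - x)).hasDerivAt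
  have := h.scomp x ((hasDerivAt_id x).const_sub 1)
  simpa [Function.comp_def, coshInt] using! this

theorem hasDerivAt_ofReal_mul (r : ℂ) (x : ℝ) : HasDerivAt (fun x : ℝ => r * (x : ℂ)) r x := by
  simpa using ((hasDerivAt_id (x : ℂ)).const_mul r).comp_ofReal

theorem hasDerivAt_mul_one_sub (r : ℂ) (x : ℝ) :
    HasDerivAt (fun x : ℝ => r * (1 - (x : ℂ))) (-r) x := by
  simpa using (((hasDerivAt_id (x : ℂ)).const_sub 1).const_mul r).comp_ofReal

theorem HasDerivAt.comp_csinh {f : ℝ → ℂ} {f' : ℂ} (hf : HasDerivAt f f' x) :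
    HasDerivAt (fun x => Complex.sinh (f x)) (Complex.cosh (f x) * f') x :=
  (Complex.hasDerivAt_sinh (f x)).comp x hf

theorem HasDerivAt.comp_ccosh {f : ℝ → ℂ} {f' : ℂ} (hf : HasDerivAt f f' x) :
    HasDerivAt (fun x => Complex.cosh (f x)) (Complex.sinh (f x) * f') x :=
  (Complex.hasDerivAt_cosh (f x)).comp x hf

theorem hasDerivAt_mode (hw : Continuous w) (hr : r ∈ sector) (x : ℝ) :
    HasDerivAt (fun x => mode w x r) (modeFlux w x r - w x) x := by
  have hc := cosh_ne_zero_of_mem_sector hr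
  have h := ((((hasDerivAt_ofReal_mul r x).comp_ccosh).mul (hasDerivAt_coshInt hw x r)).sub
    (((hasDerivAt_mul_one_sub r x).comp_csinh).mul (hasDerivAt_sinhInt hw x r))).div_const
    (Complex.cosh r)
  refine h.congr_deriv ?_
  -- Differentiating the limits of the two integrals leaves `-w x` times this sum over `cosh r`; the
  -- addition theorem makes the quotient `1`.
  have e : Complex.cosh r = Complex.cosh (r * x) * Complex.cosh (r * (1 - x))
      + Complex.sinh (r * x) * Complex.sinh (r * (1 - x)) := by
    rw [← Complex.cosh_add]; congr 1; ring
  have e2 : (w x : ℂ) = w x * (Complex.cosh (r * x) * Complex.cosh (r * (1 - x))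
      + Complex.sinh (r * x) * Complex.sinh (r * (1 - x))) / Complex.cosh r := by
    rw [← e]; field_simp
  rw [modeFlux]
  conv_rhs => rw [e2]
  rw [← sub_div]
  congr 1
  ring

/-- Here the terms from the limits of integration cancel, so the flux is differentiable although `w`
is only continuous. -/
theorem hasDerivAt_modeFlux (hw : Continuous w) (x : ℝ) :
    HasDerivAt (fun x => modeFlux w x r) (r ^ 2 * mode w x r) x := by
  have h := ((((hasDerivAt_mul_one_sub r x).comp_ccosh.mul (hasDerivAt_sinhInt hw x r)).add
    ((hasDerivAt_ofReal_mul r x).comp_csinh.mul (hasDerivAt_coshInt hw x r))).const_mul r).div_const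
    (Complex.cosh r)
  refine h.congr_deriv ?_
  rw [mode, ← mul_div_assoc]
  congr 1
  ring

theorem mode_one : mode w 1 r = 0 := by simp [mode, coshInt]

theorem modeFlux_zero : modeFlux w 0 r = 0 := by simp [modeFlux, sinhInt]

theorem re_mul_ofReal_nonneg (hr : r ∈ sector) {y : ℝ} (hy : 0 ≤ y) : 0 ≤ (r * y).re := by
  have h0 : 0 ≤ r.re := (abs_nonneg _).trans hr
  simpa using mul_nonneg h0 hy

theorem norm_cosh_mul_le (hr : r ∈ sector) {y : ℝ} (hy : 0 ≤ y) :
    ‖Complex.cosh (r * y)‖ ≤ Real.exp (r.re * y) := by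
  simpa using norm_cosh_le (re_mul_ofReal_nonneg hr hy)

theorem norm_sinh_mul_le (hr : r ∈ sector) {y : ℝ} (hy : 0 ≤ y) :
    ‖Complex.sinh (r * y)‖ ≤ Real.exp (r.re * y) := by
  simpa using norm_sinh_le (re_mul_ofReal_nonneg hr hy)

/-- The two integrals run over `[0,x]` and `[x,1]`, so their bounds add up to one integral of `|w|`.
Uniformity in `r` is what makes the symbol bounded in frequency. -/
theorem norm_mode_le (hw : Continuous w) (hr : r ∈ sector) (hx : x ∈ Icc (0 : ℝ) 1) :
    ‖mode w x r‖ ≤ 3 * ∫ y in (0 : ℝ)..1, |w y| := by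
  have hx' : 1 - x ∈ Icc (0 : ℝ) 1 := ⟨by linarith [hx.2], by linarith [hx.1]⟩
  have h1 := norm_weighted_integral_le (w := fun y => w (1 - y)) (by fun_prop) hx' hr
    (c := Complex.cosh (r * x)) (d := fun y => Complex.cosh (r * y))
    (by simpa using norm_cosh_mul_le hr hx.1) (fun y hy => norm_cosh_mul_le hr hy)
  have h2 := norm_weighted_integral_le hw hx hr
    (c := Complex.sinh (r * (1 - x))) (d := fun y => Complex.sinh (r * y))
    (by simpa using norm_sinh_mul_le hr hx'.1) (fun y hy => norm_sinh_mul_le hr hy)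
  have e : ∫ y in (0 : ℝ)..(1 - x), |w (1 - y)| = ∫ y in x..1, |w y| := by
    rw [intervalIntegral.integral_comp_sub_left (fun y => |w y|)]; simp
  rw [e] at h1
  have hint : ∀ a b : ℝ, IntervalIntegrable (fun y => |w y|) volume a b := fun a b =>
    Continuous.intervalIntegrable (by fun_prop) _ _
  rw [← intervalIntegral.integral_add_adjacent_intervals (hint 0 x) (hint x 1), mode, sub_div]
  refine (norm_sub_le _ _).trans ?_
  rw [coshInt, sinhInt]
  linarith

/-- `|r| ≤ (3/2) Re r`, and each of the two terms times `Re r` is at most `3M`. -/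
theorem norm_modeFlux_le (hr : r ∈ sector) (hx : x ∈ Icc (0 : ℝ) 1) {M : ℝ}
    (hM : ∀ y ∈ Icc (0 : ℝ) 1, |w y| ≤ M) : ‖modeFlux w x r‖ ≤ 9 * M := by
  have hx' : 1 - x ∈ Icc (0 : ℝ) 1 := ⟨by linarith [hx.2], by linarith [hx.1]⟩
  have hM' : ∀ y ∈ Icc (0 : ℝ) 1, |w (1 - y)| ≤ M := fun y hy =>
    hM _ ⟨by linarith [hy.2], by linarith [hy.1]⟩
  have h1 := re_mul_norm_weighted_integral_le (w := fun y => w (1 - y)) hx' hr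
    (c := Complex.sinh (r * x)) (d := fun y => Complex.cosh (r * y))
    (by simpa using norm_sinh_mul_le hr hx.1) (fun y hy => norm_cosh_mul_le hr hy) hM'
  have h2 := re_mul_norm_weighted_integral_le hx hr
    (c := Complex.cosh (r * (1 - x))) (d := fun y => Complex.sinh (r * y))
    (by simpa using norm_cosh_mul_le hr hx'.1) (fun y hy => norm_sinh_mul_le hr hy) hM
  have h0 : 0 ≤ r.re := (abs_nonneg _).trans hr
  have e : modeFlux w x r = r * (Complex.cosh (r * (1 - x)) * sinhInt w x r / Complex.cosh r
      + Complex.sinh (r * x) * coshInt w x r / Complex.cosh r) := by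
    rw [modeFlux]; ring
  rw [e, norm_mul]
  calc _ ≤ (3 / 2 * r.re) * (‖Complex.cosh (r * (1 - x)) * sinhInt w x r / Complex.cosh r‖
      + ‖Complex.sinh (r * x) * coshInt w x r / Complex.cosh r‖) := by
        gcongr
        · exact norm_le_of_mem_sector hr
        · exact norm_add_le _ _
    _ ≤ 3 / 2 * (3 * M + 3 * M) := by
        rw [mul_assoc, mul_add]
        exact mul_le_mul_of_nonneg_left (add_le_add h2 h1) (by norm_num)
    _ = 9 * M := by ring

theorem differentiable_integral_exp_mul {f : ℝ → ℂ} (hf : Continuous f) (x : ℝ) :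
    Differentiable ℂ (fun r : ℂ => ∫ y in (0 : ℝ)..x, Complex.exp (r * y) * f y) := by
  intro r
  refine (intervalIntegral.hasDerivAt_integral_of_dominated_loc_of_deriv_le
    (F := fun (r : ℂ) (y : ℝ) => Complex.exp (r * y) * f y)
    (F' := fun (r : ℂ) (y : ℝ) => y * Complex.exp (r * y) * f y)
    (bound := fun y => |y| * Real.exp ((‖r‖ + 1) * |y|) * ‖f y‖)
    (s := Metric.ball r 1) (Metric.ball_mem_nhds r one_pos)
    (Eventually.of_forall fun z => Continuous.aestronglyMeasurable (by fun_prop))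
    (Continuous.intervalIntegrable (by fun_prop) _ _)
    (Continuous.aestronglyMeasurable (by fun_prop)) ?_
    (Continuous.intervalIntegrable (by fun_prop) _ _) ?_).2.differentiableAt
  · refine Eventually.of_forall fun y _ z hz => ?_
    rw [norm_mul, norm_mul, Complex.norm_exp, Complex.norm_real, Real.norm_eq_abs]
    gcongr
    have h1 : ‖z‖ ≤ ‖r‖ + 1 := by
      have := norm_sub_norm_le z r
      have := (mem_ball_iff_norm.1 hz).le
      linarith
    calc (z * y).re ≤ ‖z * y‖ := Complex.re_le_norm _
      _ = ‖z‖ * |y| := by simp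
      _ ≤ _ := by gcongr
  · refine Eventually.of_forall fun y _ z _ => ?_
    have h1 : HasDerivAt (fun z : ℂ => z * (y : ℂ)) (y : ℂ) z := by
      simpa using (hasDerivAt_id z).mul_const (y : ℂ)
    simpa [mul_comm] using (h1.cexp).mul_const (f y)

theorem differentiable_sinhInt (hw : Continuous w) (x : ℝ) : Differentiable ℂ (sinhInt w x) := by
  have h := differentiable_integral_exp_mul (f := fun y => (w y : ℂ)) (by fun_prop) x
  have e : sinhInt w x = fun r => ((∫ y in (0 : ℝ)..x, Complex.exp (r * y) * w y)
      - ∫ y in (0 : ℝ)..x, Complex.exp (-r * y) * w y) / 2 := by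
    ext r
    rw [sinhInt, ← intervalIntegral.integral_sub (Continuous.intervalIntegrable (by fun_prop) _ _)
      (Continuous.intervalIntegrable (by fun_prop) _ _), ← intervalIntegral.integral_div]
    refine intervalIntegral.integral_congr fun y _ => ?_
    simp only [Complex.sinh]; ring_nf
  rw [e]
  exact (h.sub (h.comp differentiable_neg)).div_const 2

theorem differentiable_coshInt (hw : Continuous w) (x : ℝ) : Differentiable ℂ (coshInt w x) := by
  have h := differentiable_integral_exp_mul (f := fun y => (w (1 - y) : ℂ)) (by fun_prop) (1 - x)
  have e : coshInt w x = fun r => ((∫ y in (0 : ℝ)..(1 - x), Complex.exp (r * y) * w (1 - y))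
      + ∫ y in (0 : ℝ)..(1 - x), Complex.exp (-r * y) * w (1 - y)) / 2 := by
    ext r
    rw [coshInt, ← intervalIntegral.integral_add (Continuous.intervalIntegrable (by fun_prop) _ _)
      (Continuous.intervalIntegrable (by fun_prop) _ _), ← intervalIntegral.integral_div]
    refine intervalIntegral.integral_congr fun y _ => ?_
    simp only [Complex.cosh]; ring_nf
  rw [e]
  exact (h.add (h.comp differentiable_neg)).div_const 2

theorem differentiableAt_mode (hw : Continuous w) (x : ℝ) (hr : r ∈ sector) :
    DifferentiableAt ℂ (mode w x) r := by
  have h1 := (differentiable_sinhInt hw x) r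
  have h2 := (differentiable_coshInt hw x) r
  have h3 := cosh_ne_zero_of_mem_sector hr
  unfold mode
  fun_prop (disch := assumption)

theorem differentiableAt_modeFlux (hw : Continuous w) (x : ℝ) (hr : r ∈ sector) :
    DifferentiableAt ℂ (modeFlux w x) r := by
  have h1 := (differentiable_sinhInt hw x) r
  have h2 := (differentiable_coshInt hw x) r
  have h3 := cosh_ne_zero_of_mem_sector hr
  unfold modeFlux
  fun_prop (disch := assumption)

end

/-- For `Re s ≥ 0` the argument of `s` is at most `π/2`, so that of the power is at most `πα/4 ≤
π/4`. -/
theorem cpow_mem_sector {α : ℝ} (hα0 : 0 < α) (hα1 : α < 1) {s : ℂ} (hs : 0 ≤ s.re) :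
    s ^ ((α / 2 : ℝ) : ℂ) ∈ sector := by
  rcases eq_or_ne s 0 with rfl | h0
  · rw [Complex.zero_cpow (by exact_mod_cast (half_pos hα0).ne')]
    simp [sector]
  have harg : |s.arg| ≤ Real.pi / 2 := Complex.abs_arg_le_pi_div_two_iff.2 hs
  set θ := s.arg * (α / 2) with hθ
  have e : s ^ ((α / 2 : ℝ) : ℂ)
      = ((Real.exp (Real.log ‖s‖ * (α / 2)) : ℝ) : ℂ) * Complex.exp (θ * Complex.I) := by
    rw [Complex.cpow_def_of_ne_zero h0, Complex.log, Complex.ofReal_exp, ← Complex.exp_add]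
    congr 1; rw [hθ]; push_cast; ring
  have hθ4 : |θ| ≤ Real.pi / 4 := by
    rw [hθ, abs_mul, abs_of_pos (half_pos hα0)]
    have := Real.pi_pos
    calc |s.arg| * (α / 2) ≤ Real.pi / 2 * (1 / 2) := by gcongr
      _ = Real.pi / 4 := by ring
  have hle := abs_le.1 hθ4
  have hpi := Real.pi_pos
  have hc : 0 ≤ Real.cos θ := Real.cos_nonneg_of_mem_Icc ⟨by linarith, by linarith⟩
  have hc2 : 0 ≤ Real.cos (2 * θ) := Real.cos_nonneg_of_mem_Icc ⟨by linarith, by linarith⟩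
  have hsc : |Real.sin θ| ≤ Real.cos θ := by
    refine abs_le_of_sq_le_sq ?_ hc
    rw [Real.cos_two_mul'] at hc2
    linarith
  rw [sector, mem_ofPred_eq, e]
  rw [Complex.re_ofReal_mul, Complex.im_ofReal_mul, Complex.exp_ofReal_mul_I_re,
    Complex.exp_ofReal_mul_I_im, abs_mul, abs_of_pos (Real.exp_pos _)]
  gcongr

/-- A bounded `b` has no decay; the divisor `1 + s` supplies it and is later compensated by
replacing `F` with `F + F'`. -/
theorem isHardySymbol_of_sector {α : ℝ} (hα0 : 0 < α) (hα1 : α < 1) {b : ℂ → ℂ} {M : ℝ}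
    (hd : ∀ r ∈ sector, DifferentiableAt ℂ b r) (hb : ∀ r ∈ sector, ‖b r‖ ≤ M) :
    IsHardySymbol (fun s => b (s ^ ((α / 2 : ℝ) : ℂ)) / (1 + s)) M where
  nonneg := (norm_nonneg _).trans (hb 0 (by simp [sector]))
  differentiableOn := by
    intro s hs
    have hs' : 0 < s.re := hs
    have hne : 1 + s ≠ 0 := fun h => by
      have := congrArg Complex.re h
      simp at this; linarith
    have h1 : DifferentiableAt ℂ (fun s : ℂ => s ^ ((α / 2 : ℝ) : ℂ)) s :=
      differentiableAt_id.cpow_const (Or.inl hs')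
    exact (((hd _ (cpow_mem_sector hα0 hα1 hs'.le)).comp s h1).div (by fun_prop)
      hne).differentiableWithinAt
  bound s hs := by
    rw [norm_div]
    gcongr
    exact hb _ (cpow_mem_sector hα0 hα1 hs)
  boundary := by
    -- The branch point `s = 0` is discarded; every other point of the axis lies in the slit plane.
    have h0 : ∀ᵐ ξ : ℝ, ξ ≠ 0 := by simp [ae_iff]
    filter_upwards [h0] with ξ hξ
    set s₀ : ℂ := 2 * Real.pi * Complex.I * ξ with hs₀
    have hs₀re : s₀.re = 0 := by simp [hs₀]
    have hs₀im : s₀.im = 2 * Real.pi * ξ := by simp [hs₀]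
    have hslit : s₀ ∈ Complex.slitPlane := by
      right; rw [hs₀im]; exact mul_ne_zero (by positivity) hξ
    have hne : 1 + s₀ ≠ 0 := fun h => by
      have := congrArg Complex.re h
      simp [hs₀re] at this
    have h1 : ContinuousAt (fun s : ℂ => s ^ ((α / 2 : ℝ) : ℂ)) s₀ :=
      (differentiableAt_id.cpow_const hslit).continuousAt
    have h2 : ContinuousAt (fun s => b (s ^ ((α / 2 : ℝ) : ℂ)) / (1 + s)) s₀ :=
      (ContinuousAt.comp (f := fun s : ℂ => s ^ ((α / 2 : ℝ) : ℂ)) (g := b)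
        (hd _ (cpow_mem_sector hα0 hα1 hs₀re.ge)).continuousAt h1).div (by fun_prop) hne
    have h3 : Tendsto (fun a : ℝ => (a : ℂ) + s₀) (𝓝[>] 0) (𝓝 s₀) := by
      have hc : Continuous (fun a : ℝ => (a : ℂ) + s₀) := by fun_prop
      simpa using (hc.tendsto 0).mono_left (nhdsWithin_le_nhds (s := Ioi 0))
    exact h2.tendsto.comp h3

end ModeFunctions

/-! ### Laplace transform on the half-line and the Caputo derivative -/

section HalfLine

open Filter Topology FourierTransform

/-- The Laplace transform `∫_0^∞ e^{-st} f(t) dt`. -/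
def hlap (f : ℝ → ℂ) (s : ℂ) : ℂ := ∫ t in Ioi (0 : ℝ), Complex.exp (-(s * t)) * f t

theorem lap_indicator (f : ℝ → ℂ) (s : ℂ) : lap ((Ioi (0 : ℝ)).indicator f) s = hlap f s := by
  rw [lap, hlap, ← integral_indicator measurableSet_Ioi]
  refine integral_congr_ae (Eventually.of_forall fun t => ?_)
  by_cases h : t ∈ Ioi (0 : ℝ) <;> simp [h]

theorem integrable_exp_mul_indicator_iff (f : ℝ → ℂ) (s : ℂ) :
    Integrable (fun t : ℝ => Complex.exp (-(s * t)) * (Ioi (0 : ℝ)).indicator f t)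
      ↔ IntegrableOn (fun t : ℝ => Complex.exp (-(s * t)) * f t) (Ioi 0) := by
  rw [← integrable_indicator_iff measurableSet_Ioi]
  refine integrable_congr (Eventually.of_forall fun t => ?_)
  by_cases h : t ∈ Ioi (0 : ℝ) <;> simp [h]

theorem indicator_Ioi_eq_zero (f : ℝ → ℂ) : ∀ t ≤ (0 : ℝ), (Ioi (0 : ℝ)).indicator f t = 0 :=
  fun t ht => indicator_of_notMem (by simpa using ht) _

theorem integrableOn_exp_mul_of_memLp {f : ℝ → ℂ} (hf : MemLp f 2 (volume.restrict (Ioi (0 : ℝ))))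
    {s : ℂ} (hs : 0 < s.re) :
    IntegrableOn (fun t : ℝ => Complex.exp (-(s * t)) * f t) (Ioi 0) :=
  (integrable_exp_mul_indicator_iff f s).1 (integrable_exp_mul_of_memLp
    ((memLp_indicator_iff_restrict measurableSet_Ioi).2 hf) (indicator_Ioi_eq_zero f) hs)

theorem ae_eq_zero_of_hlap_eq_zero {f : ℝ → ℂ} {a : ℝ}
    (hf : IntegrableOn (fun t : ℝ => Complex.exp (-(a * t)) * f t) (Ioi 0))
    (h : ∀ s : ℂ, s.re = a → hlap f s = 0) : ∀ᵐ t ∂(volume.restrict (Ioi (0 : ℝ))), f t = 0 := by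
  have := ae_eq_zero_of_lap_eq_zero (f := (Ioi (0 : ℝ)).indicator f) (a := a)
    ((integrable_exp_mul_indicator_iff f a).2 hf) fun s hs => by rw [lap_indicator]; exact h s hs
  rw [ae_restrict_iff' measurableSet_Ioi]
  filter_upwards [this] with t ht h
  rwa [indicator_of_mem h] at ht

/-- The weight `e^{-st}` factors over `τ` and `t - τ`, so a weighted causal convolution is the
convolution of the weighted, integrable functions. -/
theorem exp_mul_posConvolution (f k : ℝ → ℂ) (s : ℂ) (t : ℝ) :
    Complex.exp (-(s * t)) * ∫ τ in (0 : ℝ)..t, f τ * k (t - τ)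
    = ∫ τ in (0 : ℝ)..t, ContinuousLinearMap.mul ℝ ℂ (Complex.exp (-(s * τ)) * f τ)
      (Complex.exp (-(s * ((t - τ : ℝ) : ℂ))) * k (t - τ)) := by
  rw [← intervalIntegral.integral_const_mul]
  refine intervalIntegral.integral_congr fun τ _ => ?_
  simp only [ContinuousLinearMap.mul_apply']
  have : Complex.exp (-(s * t))
      = Complex.exp (-(s * τ)) * Complex.exp (-(s * ((t - τ : ℝ) : ℂ))) := by
    rw [← Complex.exp_add]; congr 1; push_cast; ring
  rw [this]; ring

theorem hlap_posConvolution {f k : ℝ → ℂ} {s : ℂ}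
    (hf : IntegrableOn (fun t : ℝ => Complex.exp (-(s * t)) * f t) (Ioi 0))
    (hk : IntegrableOn (fun t : ℝ => Complex.exp (-(s * t)) * k t) (Ioi 0)) :
    hlap (fun t => ∫ τ in (0 : ℝ)..t, f τ * k (t - τ)) s = hlap f s * hlap k s := by
  have := integral_posConvolution hf hk (ContinuousLinearMap.mul ℝ ℂ)
  simp only [hlap]
  rw [ContinuousLinearMap.mul_apply'] at this
  rw [← this]
  refine integral_congr_ae (Eventually.of_forall fun t => ?_)
  exact exp_mul_posConvolution f k s t

theorem integrableOn_posConvolution {f k : ℝ → ℂ} {s : ℂ}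
    (hf : IntegrableOn (fun t : ℝ => Complex.exp (-(s * t)) * f t) (Ioi 0))
    (hk : IntegrableOn (fun t : ℝ => Complex.exp (-(s * t)) * k t) (Ioi 0)) :
    IntegrableOn (fun t : ℝ => Complex.exp (-(s * t)) * ∫ τ in (0 : ℝ)..t, f τ * k (t - τ))
      (Ioi 0) := by
  have := integrable_posConvolution hf hk (ContinuousLinearMap.mul ℝ ℂ)
  refine (this.integrableOn (s := Ioi 0)).congr_fun (fun t ht => ?_) measurableSet_Ioi
  rw [posConvolution, indicator_of_mem ht]
  exact (exp_mul_posConvolution f k s t).symm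

theorem hlap_one {s : ℂ} (hs : 0 < s.re) : hlap (fun _ => 1) s = s⁻¹ := by
  have h := integral_exp_mul_complex_Ioi (a := -s) (by simpa using hs) 0
  simp only [hlap, mul_one]
  simp only [neg_mul] at h
  rw [h]; simp

theorem integrableOn_exp_neg_mul {s : ℂ} (hs : 0 < s.re) :
    IntegrableOn (fun t : ℝ => Complex.exp (-(s * t)) * 1) (Ioi 0) := by
  have h := integrableOn_exp_mul_complex_Ioi (a := -s) (by simpa using hs) 0
  simpa using h

/-- A primitive vanishing at `0` is the convolution of `f'` with the constant `1`, whose transform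
is `1/s`. No boundary term at infinity arises. -/
theorem hlap_weakDeriv {f f' : ℝ → ℂ} (h : HasWeakDerivHalfLine f f') (h0 : f 0 = 0) {s : ℂ}
    (hs : 0 < s.re) (hf' : IntegrableOn (fun t : ℝ => Complex.exp (-(s * t)) * f' t) (Ioi 0)) :
    IntegrableOn (fun t : ℝ => Complex.exp (-(s * t)) * f t) (Ioi 0) ∧
      hlap f' s = s * hlap f s := by
  have e : ∀ t ∈ Ioi (0 : ℝ), ∫ τ in (0 : ℝ)..t, f' τ * (fun _ => (1 : ℂ)) (t - τ) = f t := by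
    intro t ht
    rw [(h t (mem_Ioi.1 ht).le).2, h0]; simp
  have i := integrableOn_posConvolution hf' (integrableOn_exp_neg_mul hs)
  have l := hlap_posConvolution hf' (integrableOn_exp_neg_mul hs)
  constructor
  · exact i.congr_fun (fun t ht => by simp only [e t ht]) measurableSet_Ioi
  · have hs0 : s ≠ 0 := fun h => by simp [h] at hs
    rw [hlap_one hs] at l
    have : hlap f s = hlap f' s * s⁻¹ := by
      rw [← l, hlap, hlap]
      exact setIntegral_congr_fun measurableSet_Ioi fun t ht => by simp only [e t ht]
    rw [this]; field_simp

variable {α : ℝ}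

theorem integrableOn_exp_mul_rpow (hα1 : α < 1) {s : ℂ} (hs : 0 < s.re) :
    IntegrableOn (fun t : ℝ => Complex.exp (-(s * t)) * ((t ^ (-α) : ℝ) : ℂ)) (Ioi 0) := by
  have h := integrableOn_rpow_mul_exp_neg_mul_rpow (s := -α) (p := 1) (b := s.re)
    (by linarith) zero_lt_one hs
  refine h.mono' ?_ ?_
  · refine ContinuousOn.aestronglyMeasurable (fun t ht => ?_) measurableSet_Ioi
    have h1 : ContinuousAt (fun t : ℝ => t ^ (-α)) t :=
      Real.continuousAt_rpow_const _ _ (Or.inl (mem_Ioi.1 ht).ne')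
    have h2 : ContinuousAt (fun t : ℝ => ((t ^ (-α) : ℝ) : ℂ)) t :=
      Complex.continuous_ofReal.continuousAt.comp h1
    exact (ContinuousAt.mul (by fun_prop) h2).continuousWithinAt
  · filter_upwards [ae_restrict_mem measurableSet_Ioi] with t ht
    have ht' : 0 < t := ht
    rw [norm_mul, norm_exp_neg_mul, Complex.norm_real, Real.norm_of_nonneg (by positivity),
      mul_comm, Real.rpow_one, neg_mul]

theorem hlap_rpow_ofReal (hα1 : α < 1) {a : ℝ} (ha : 0 < a) :
    hlap (fun t : ℝ => ((t ^ (-α) : ℝ) : ℂ)) a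
      = (a : ℂ) ^ ((α - 1 : ℝ) : ℂ) * Complex.Gamma (1 - α) := by
  have h := Complex.integral_cpow_mul_exp_neg_mul_Ioi (a := ((1 - α : ℝ) : ℂ)) (r := a)
    (by simpa using hα1) ha
  have harg : (a : ℂ).arg ≠ Real.pi := by
    rw [Complex.arg_ofReal_of_nonneg ha.le]; exact Real.pi_pos.ne
  have e : (1 / (a : ℂ)) ^ ((1 - α : ℝ) : ℂ) = (a : ℂ) ^ ((α - 1 : ℝ) : ℂ) := by
    rw [one_div, Complex.inv_cpow _ _ harg, ← Complex.cpow_neg]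
    congr 1; push_cast; ring
  rw [e] at h
  rw [show (1 - α : ℂ) = ((1 - α : ℝ) : ℂ) by push_cast; ring, ← h, hlap]
  refine setIntegral_congr_fun measurableSet_Ioi fun t ht => ?_
  rw [mul_comm, Complex.ofReal_cpow (mem_Ioi.1 ht).le]
  congr 2; push_cast; ring

/-- Both sides are holomorphic for `Re s > 0` and agree on the positive reals, where the integral is
a Gamma integral; the identity theorem does the rest. -/
theorem hlap_rpow (hα1 : α < 1) {s : ℂ} (hs : 0 < s.re) :
    hlap (fun t : ℝ => ((t ^ (-α) : ℝ) : ℂ)) s = s ^ ((α - 1 : ℝ) : ℂ) * Complex.Gamma (1 - α) := by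
  have hopen : IsOpen {s : ℂ | 0 < s.re} := isOpen_lt continuous_const Complex.continuous_re
  have h1 : AnalyticOnNhd ℂ (hlap (fun t : ℝ => ((t ^ (-α) : ℝ) : ℂ))) {s : ℂ | 0 < s.re} := by
    refine DifferentiableOn.analyticOnNhd ?_ hopen
    have := lap_differentiableOn (indicator_Ioi_eq_zero (fun t : ℝ => ((t ^ (-α) : ℝ) : ℂ)))
      fun s hs => (integrable_exp_mul_indicator_iff _ s).2 (integrableOn_exp_mul_rpow hα1 hs)
    exact this.congr fun s _ => (lap_indicator _ s).symm
  have h2 : AnalyticOnNhd ℂ (fun s : ℂ => s ^ ((α - 1 : ℝ) : ℂ) * Complex.Gamma (1 - α))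
      {s : ℂ | 0 < s.re} := by
    refine DifferentiableOn.analyticOnNhd (fun s hs => ?_) hopen
    exact ((differentiableAt_id.cpow_const (Or.inl hs)).mul_const _).differentiableWithinAt
  refine h1.eqOn_of_preconnected_of_frequently_eq h2 (convex_halfSpace_re_gt 0).isPreconnected
    (z₀ := 1) (by simp) ?_ hs
  have hev : ∀ᶠ a : ℝ in 𝓝[≠] 1, hlap (fun t : ℝ => ((t ^ (-α) : ℝ) : ℂ)) a
      = (a : ℂ) ^ ((α - 1 : ℝ) : ℂ) * Complex.Gamma (1 - α) := by
    filter_upwards [mem_nhdsWithin_of_mem_nhds (Ioi_mem_nhds (zero_lt_one (α := ℝ)))] with a ha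
    exact hlap_rpow_ofReal hα1 ha
  have ht : Tendsto (fun a : ℝ => (a : ℂ)) (𝓝[≠] 1) (𝓝[≠] 1) := by
    refine tendsto_nhdsWithin_iff.2 ⟨?_, ?_⟩
    · simpa using (Complex.continuous_ofReal.tendsto 1).mono_left nhdsWithin_le_nhds
    · filter_upwards [self_mem_nhdsWithin] with a ha
      simpa using ha
  exact ht.frequently hev.frequently

theorem Gamma_one_sub_ne_zero (hα1 : α < 1) : Complex.Gamma (1 - α) ≠ 0 := by
  have : (1 - α : ℂ) = ((1 - α : ℝ) : ℂ) := by push_cast; ring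
  rw [this, Complex.Gamma_ofReal]
  exact_mod_cast (Real.Gamma_pos_of_pos (by linarith)).ne'

/-- The Laplace transform of the Caputo derivative. -/
theorem hlap_caputo (hα1 : α < 1) {f' : ℝ → ℂ} {s : ℂ} (hs : 0 < s.re)
    (hf' : IntegrableOn (fun t : ℝ => Complex.exp (-(s * t)) * f' t) (Ioi 0)) :
    IntegrableOn (fun t : ℝ => Complex.exp (-(s * t)) * caputo α f' t) (Ioi 0) ∧
      hlap (caputo α f') s = s ^ ((α - 1 : ℝ) : ℂ) * hlap f' s := by
  have hk := integrableOn_exp_mul_rpow hα1 hs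
  have i := integrableOn_posConvolution hf' hk
  have l := hlap_posConvolution hf' hk
  constructor
  · refine (i.const_mul (((Real.Gamma (1 - α) : ℝ) : ℂ)⁻¹)).congr
      (Eventually.of_forall fun t => ?_)
    simp only [caputo]; ring
  · rw [hlap_rpow hα1 hs] at l
    have hG := Gamma_one_sub_ne_zero hα1
    have e : hlap (caputo α f') s = ((Real.Gamma (1 - α) : ℝ) : ℂ)⁻¹ *
        hlap (fun t => ∫ τ in (0 : ℝ)..t, f' τ * (((t - τ) ^ (-α) : ℝ) : ℂ)) s := by
      rw [hlap, hlap, ← integral_const_mul]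
      refine integral_congr_ae (Eventually.of_forall fun t => ?_)
      simp only [caputo]; ring
    rw [e, l, ← Complex.Gamma_ofReal]
    push_cast
    field_simp

theorem norm_caputo_le (hα1 : α < 1) (f' : ℝ → ℂ) {t : ℝ} (ht : 0 ≤ t) :
    ‖caputo α f' t‖ ≤ (caputo α (fun s => (‖f' s‖ : ℂ)) t).re := by
  have hG : 0 < Real.Gamma (1 - α) := Real.Gamma_pos_of_pos (by linarith)
  rw [caputo, caputo, norm_mul, norm_inv, Complex.norm_real, Real.norm_of_nonneg hG.le,
    ← Complex.ofReal_inv, Complex.re_ofReal_mul]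
  gcongr
  have e : ∫ s in (0 : ℝ)..t, (‖f' s‖ : ℂ) * (((t - s) ^ (-α) : ℝ) : ℂ)
      = ((∫ s in (0 : ℝ)..t, ‖f' s‖ * (t - s) ^ (-α) : ℝ) : ℂ) := by
    rw [← intervalIntegral.integral_ofReal]; simp
  rw [e, Complex.ofReal_re]
  refine (intervalIntegral.norm_integral_le_integral_norm ht).trans (le_of_eq ?_)
  refine intervalIntegral.integral_congr fun s hs => ?_
  rw [uIcc_of_le ht] at hs
  simp only [norm_mul, Complex.norm_real]
  rw [Real.norm_of_nonneg (Real.rpow_nonneg (by linarith [hs.2]) _)]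

/-- The Caputo kernel is positive, so `|∂^α f|` is dominated by the Caputo expression of `|f'|`,
whose weighted integral is known exactly from the Laplace formula at the real point `a`. -/
theorem integral_exp_mul_norm_caputo_le (hα1 : α < 1) {f' : ℝ → ℂ} {a : ℝ} (ha : 0 < a)
    (hf' : IntegrableOn (fun t : ℝ => Complex.exp (-(a * t)) * f' t) (Ioi 0)) :
    ∫⁻ t in Ioi (0 : ℝ), ‖Complex.exp (-(a * t)) * caputo α f' t‖ₑ
      ≤ ENNReal.ofReal (a ^ (α - 1)) * ∫⁻ t in Ioi (0 : ℝ), ‖Complex.exp (-(a * t)) * f' t‖ₑ := by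
  have hn : IntegrableOn (fun t : ℝ => Complex.exp (-((a : ℂ) * t)) * (‖f' t‖ : ℂ)) (Ioi 0) := by
    have := hf'.norm.ofReal (𝕜 := ℂ)
    refine this.congr (Eventually.of_forall fun t => ?_)
    simp only [norm_mul, norm_exp_neg_mul]
    push_cast; simp
  obtain ⟨i, l⟩ := hlap_caputo hα1 (s := a) (by simpa using ha) hn
  have hre : ∫ t in Ioi (0 : ℝ), Real.exp (-(a * t)) * (caputo α (fun s => (‖f' s‖ : ℂ)) t).re
      = a ^ (α - 1) * ∫ t in Ioi (0 : ℝ), ‖Complex.exp (-(a * t)) * f' t‖ := by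
    have h1 := congrArg Complex.re l
    have h2 : (hlap (caputo α (fun s => (‖f' s‖ : ℂ))) a).re
        = ∫ t in Ioi (0 : ℝ), Real.exp (-(a * t)) * (caputo α (fun s => (‖f' s‖ : ℂ)) t).re := by
      have := integral_re (𝕜 := ℂ) i
      rw [hlap]
      refine Eq.trans this.symm ?_
      refine integral_congr_ae (Eventually.of_forall fun t => ?_)
      have : Complex.exp (-(a * t)) = ((Real.exp (-(a * t)) : ℝ) : ℂ) := by push_cast; rfl
      simp only [this]
      exact Complex.re_ofReal_mul _ _
    have h3 : hlap (fun s => (‖f' s‖ : ℂ)) a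
        = ((∫ t in Ioi (0 : ℝ), ‖Complex.exp (-(a * t)) * f' t‖ : ℝ) : ℂ) := by
      rw [hlap, ← integral_complex_ofReal]
      refine integral_congr_ae (Eventually.of_forall fun t => ?_)
      simp only [norm_mul, norm_exp_neg_mul]
      push_cast; simp
    rw [← h2, h1, h3, ← Complex.ofReal_cpow ha.le, ← Complex.ofReal_mul, Complex.ofReal_re]
  have ir : IntegrableOn (fun t : ℝ => Real.exp (-(a * t))
      * (caputo α (fun s => (‖f' s‖ : ℂ)) t).re) (Ioi 0) := by
    refine (Integrable.re i).congr (Eventually.of_forall fun t => ?_)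
    have : Complex.exp (-(a * t)) = ((Real.exp (-(a * t)) : ℝ) : ℂ) := by push_cast; rfl
    simp only [this]
    exact Complex.re_ofReal_mul _ _
  have hpt : ∀ t ∈ Ioi (0 : ℝ), ‖Complex.exp (-(a * t)) * caputo α f' t‖
      ≤ Real.exp (-(a * t)) * (caputo α (fun s => (‖f' s‖ : ℂ)) t).re := by
    intro t ht
    rw [norm_mul, norm_exp_neg_mul, Complex.ofReal_re]
    gcongr
    exact norm_caputo_le hα1 f' (mem_Ioi.1 ht).le
  calc _ ≤ ∫⁻ t in Ioi (0 : ℝ), ENNReal.ofReal (Real.exp (-(a * t))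
          * (caputo α (fun s => (‖f' s‖ : ℂ)) t).re) := by
        refine setLIntegral_mono_ae' measurableSet_Ioi (Eventually.of_forall fun t ht => ?_)
        rw [← ofReal_norm]
        exact ENNReal.ofReal_le_ofReal (hpt t ht)
    _ = ENNReal.ofReal (∫ t in Ioi (0 : ℝ), Real.exp (-(a * t))
          * (caputo α (fun s => (‖f' s‖ : ℂ)) t).re) := by
        rw [ofReal_integral_eq_lintegral_ofReal ir]
        filter_upwards [ae_restrict_mem measurableSet_Ioi] with t ht
        exact (norm_nonneg _).trans (hpt t ht)
    _ = _ := by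
        rw [hre, ENNReal.ofReal_mul (by positivity), ofReal_integral_norm_eq_lintegral_enorm hf']

end HalfLine

/-! ### From bounded sector symbols to causal functions of time -/

section TimeDomain

open Filter Topology FourierTransform

/-- The argument of `iω` is `±π/2`, so the prescribed branch is the principal power. At `ω = 0` both
sides are `0`, which needs `β ≠ 0`. -/
theorem iPow_eq_cpow {β : ℝ} (hβ : β ≠ 0) (ω : ℝ) : iPow β ω = (Complex.I * ω) ^ (β : ℂ) := by
  rcases lt_trichotomy ω 0 with h | rfl | h
  · have hω : (Complex.I * ω : ℂ) = ((|ω| : ℝ) : ℂ) * (-Complex.I) := by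
      rw [abs_of_neg h]; push_cast; ring
    have hpos : 0 < |ω| := abs_pos.2 h.ne
    have hne : (Complex.I * ω : ℂ) ≠ 0 := by simp [h.ne]
    rw [iPow, if_neg h.ne, Complex.cpow_def_of_ne_zero hne, hω,
      Complex.log_ofReal_mul hpos (by simp), Complex.log_neg_I, Real.rpow_def_of_pos hpos,
      Complex.ofReal_exp, ← Complex.exp_add, Real.sign_of_neg h]
    congr 1; push_cast; ring
  · simp [iPow, Complex.zero_cpow (Complex.ofReal_ne_zero.2 hβ)]
  · have hω : (Complex.I * ω : ℂ) = ((|ω| : ℝ) : ℂ) * Complex.I := by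
      rw [abs_of_pos h]; ring
    have hpos : 0 < |ω| := abs_pos.2 h.ne'
    have hne : (Complex.I * ω : ℂ) ≠ 0 := by simp [h.ne']
    rw [iPow, if_neg h.ne', Complex.cpow_def_of_ne_zero hne, hω,
      Complex.log_ofReal_mul hpos (by simp), Complex.log_I, Real.rpow_def_of_pos hpos,
      Complex.ofReal_exp, ← Complex.exp_add, Real.sign_of_pos h]
    congr 1; push_cast; ring

theorem iPow_mem_sector {α : ℝ} (hα0 : 0 < α) (hα1 : α < 1) (ω : ℝ) : iPow (α / 2) ω ∈ sector := by
  rw [iPow_eq_cpow (half_pos hα0).ne']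
  exact cpow_mem_sector hα0 hα1 (by simp)

/-- `b` is holomorphic near the closed sector and bounded by `M` there. -/
structure IsSectorSymbol (b : ℂ → ℂ) (M : ℝ) : Prop where
  differentiableAt : ∀ r ∈ sector, DifferentiableAt ℂ b r
  bound : ∀ r ∈ sector, ‖b r‖ ≤ M

/-- The frequency-domain function `F̂(ω) b((iω)^{α/2})`. -/
def freqSymbol (α : ℝ) (F : ℝ → ℂ) (b : ℂ → ℂ) (ω : ℝ) : ℂ :=
  fourierL2 ((Ioi (0 : ℝ)).indicator F) ω * b (iPow (α / 2) ω)

/-- The inverse Fourier transform of `F̂(ω) b((iω)^{α/2})`. -/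
def timeSymbol (α : ℝ) (F : ℝ → ℂ) (b : ℂ → ℂ) (t : ℝ) : ℂ := invFourier (freqSymbol α F b) t

namespace IsH1HalfLine

variable {F F' : ℝ → ℂ}

theorem memLp_indicator (hF : IsH1HalfLine F F') :
    MemLp ((Ioi (0 : ℝ)).indicator F) 2 volume :=
  (memLp_indicator_iff_restrict measurableSet_Ioi).2 hF.memLp

theorem memLp_indicator_add (hF : IsH1HalfLine F F') :
    MemLp ((Ioi (0 : ℝ)).indicator (fun t => F t + F' t)) 2 volume :=
  (memLp_indicator_iff_restrict measurableSet_Ioi).2 (hF.memLp.add hF.memLp_deriv)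

/-- The condition `F(0) = 0` removes the boundary term, so that differentiation is multiplication by
`s`. -/
theorem hlap_add (hF : IsH1HalfLine F F') (h0 : F 0 = 0) {s : ℂ} (hs : 0 < s.re) :
    lap ((Ioi (0 : ℝ)).indicator (fun t => F t + F' t)) s = (1 + s) * hlap F s := by
  have i1 := integrableOn_exp_mul_of_memLp hF.memLp hs
  have i2 := integrableOn_exp_mul_of_memLp hF.memLp_deriv hs
  have h := (hlap_weakDeriv hF.hasWeakDeriv h0 hs i2).2
  rw [lap_indicator, add_mul, one_mul, ← h]
  simp only [hlap, mul_add]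
  exact integral_add i1 i2

/-- The identity `lap (F + F') = (1 + s) lap F` holds inside the half-plane and passes to L²
boundary values, which are a.e. limits along a sequence of vertical lines. -/
theorem fourier_add (hF : IsH1HalfLine F F') (h0 : F 0 = 0) :
    ∀ᵐ ξ : ℝ, (𝓕 (hF.memLp_indicator_add.toLp _) : Lp ℂ 2 (volume : Measure ℝ)) ξ
      = (1 + 2 * Real.pi * Complex.I * ξ)
        * (𝓕 (hF.memLp_indicator.toLp _) : Lp ℂ 2 (volume : Measure ℝ)) ξ := by
  set a : ℕ → ℝ := fun n => 1 / ((n : ℝ) + 1) with ha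
  have hapos : ∀ n, 0 < a n := fun n => Nat.one_div_pos_of_nat
  have hlim : Tendsto a atTop (𝓝[>] 0) :=
    tendsto_nhdsWithin_iff.2 ⟨tendsto_one_div_add_atTop_nhds_zero_nat, Eventually.of_forall hapos⟩
  have key : ∀ {f : ℝ → ℂ} (hf : MemLp ((Ioi (0 : ℝ)).indicator f) 2 volume) (b : ℕ → ℝ),
      (∀ n, 0 < b n) → Tendsto b atTop (𝓝[>] 0) → ∃ ns : ℕ → ℕ, StrictMono ns ∧ ∀ᵐ ξ : ℝ,
        Tendsto (fun n => lap ((Ioi (0 : ℝ)).indicator f) (b (ns n) + 2 * Real.pi * Complex.I * ξ))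
          atTop (𝓝 ((𝓕 (hf.toLp _) : Lp ℂ 2 (volume : Measure ℝ)) ξ)) := by
    intro f hf b hb hlimb
    have h := (tendsto_eLpNorm_lap_sub hf (indicator_Ioi_eq_zero f)).comp hlimb
    refine (tendstoInMeasure_of_tendsto_eLpNorm (p := 2) (by norm_num) (fun n => ?_)
      (Lp.memLp _).1 h).exists_seq_tendsto_ae
    exact (IsHardySymbol.memLp_lap_line hf (indicator_Ioi_eq_zero f) (hb n)).1
  obtain ⟨ns, hns, h1⟩ := key hF.memLp_indicator a hapos hlim
  -- The second subsequence is extracted from the first, so that both transforms converge along the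
  -- same lines.
  obtain ⟨ms, hms, h2⟩ := key hF.memLp_indicator_add (a ∘ ns) (fun n => hapos _)
    (hlim.comp hns.tendsto_atTop)
  filter_upwards [h1, h2] with ξ h1 h2
  have h3 := h1.comp hms.tendsto_atTop
  have h4 : Tendsto (fun n => 1 + ((a (ns (ms n)) : ℂ) + 2 * Real.pi * Complex.I * ξ)) atTop
      (𝓝 (1 + (0 + 2 * Real.pi * Complex.I * ξ))) := by
    have : Tendsto (fun n => (a (ns (ms n)) : ℂ)) atTop (𝓝 0) := by
      have := (Complex.continuous_ofReal.tendsto 0).comp ((tendsto_nhdsWithin_iff.1 hlim).1.comp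
        (hns.tendsto_atTop.comp hms.tendsto_atTop))
      simpa using! this
    exact (this.add_const _).const_add _
  rw [zero_add] at h4
  refine tendsto_nhds_unique h2 ((h4.mul h3).congr fun n => ?_)
  simp only [Function.comp_apply]
  rw [hF.hlap_add h0 (by simpa using hapos _), lap_indicator]

theorem one_add_ne_zero (ξ : ℝ) : (1 : ℂ) + 2 * Real.pi * Complex.I * ξ ≠ 0 := fun h => by
  have := congrArg Complex.re h
  simp at this

theorem fourierL2_indicator (hF : IsH1HalfLine F F') (ξ : ℝ) :
    fourierL2 ((Ioi (0 : ℝ)).indicator F) (2 * Real.pi * ξ)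
      = (𝓕 (hF.memLp_indicator.toLp _) : Lp ℂ 2 (volume : Measure ℝ)) ξ := by
  rw [fourierL2, dif_pos hF.memLp_indicator]
  congr 1
  field_simp

end IsH1HalfLine

namespace IsSectorSymbol

variable {α : ℝ} {F F' : ℝ → ℂ} {b : ℂ → ℂ} {M : ℝ}

theorem isHardySymbol (hb : IsSectorSymbol b M) (hα0 : 0 < α) (hα1 : α < 1) :
    IsHardySymbol (fun s => b (s ^ ((α / 2 : ℝ) : ℂ)) / (1 + s)) M :=
  isHardySymbol_of_sector hα0 hα1 hb.differentiableAt hb.bound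

theorem iPow_two_pi (hα0 : 0 < α) (ξ : ℝ) :
    iPow (α / 2) (2 * Real.pi * ξ) = (2 * Real.pi * Complex.I * ξ) ^ ((α / 2 : ℝ) : ℂ) := by
  rw [iPow_eq_cpow (half_pos hα0).ne']
  congr 1; push_cast; ring

/-- This brings the data into Hardy form: an L² transform of a causal function times a symbol
decaying like `1/(1+s)`. -/
theorem freqSymbol_ae_eq (b : ℂ → ℂ) (hα0 : 0 < α) (hF : IsH1HalfLine F F') (h0 : F 0 = 0) :
    ∀ᵐ ξ : ℝ, freqSymbol α F b (2 * Real.pi * ξ)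
      = (𝓕 (hF.memLp_indicator_add.toLp _) : Lp ℂ 2 (volume : Measure ℝ)) ξ
        * (b ((2 * Real.pi * Complex.I * ξ) ^ ((α / 2 : ℝ) : ℂ))
          / (1 + 2 * Real.pi * Complex.I * ξ)) := by
  filter_upwards [hF.fourier_add h0] with ξ hξ
  have hne := IsH1HalfLine.one_add_ne_zero ξ
  rw [freqSymbol, hF.fourierL2_indicator, hξ, iPow_two_pi hα0]
  field_simp

theorem timeSymbol_eq_fourierInv (b : ℂ → ℂ) (hα0 : 0 < α) (hF : IsH1HalfLine F F') (h0 : F 0 = 0) :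
    timeSymbol α F b
      = 𝓕⁻ (fun ξ : ℝ => (𝓕 (hF.memLp_indicator_add.toLp _) : Lp ℂ 2 (volume : Measure ℝ)) ξ
        * (b ((2 * Real.pi * Complex.I * ξ) ^ ((α / 2 : ℝ) : ℂ))
          / (1 + 2 * Real.pi * Complex.I * ξ))) := by
  ext t
  rw [timeSymbol, invFourier_eq_fourierInv, fourierInv_eq_integral_exp, fourierInv_eq_integral_exp]
  refine integral_congr_ae ?_
  filter_upwards [freqSymbol_ae_eq b hα0 hF h0] with ξ hξ
  rw [hξ]

theorem integrable_freqSymbol (hb : IsSectorSymbol b M) (hα0 : 0 < α) (hα1 : α < 1)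
    (hF : IsH1HalfLine F F') (h0 : F 0 = 0) : Integrable (freqSymbol α F b) := by
  have hp : (2 * Real.pi : ℝ) ≠ 0 := by positivity
  rw [← integrable_comp_mul_left_iff _ hp]
  exact ((hb.isHardySymbol hα0 hα1).integrable_axis _).congr
    ((freqSymbol_ae_eq b hα0 hF h0).mono fun ξ h => h.symm)

theorem continuous_timeSymbol (hb : IsSectorSymbol b M) (hα0 : 0 < α) (hα1 : α < 1)
    (hF : IsH1HalfLine F F') (h0 : F 0 = 0) : Continuous (timeSymbol α F b) := by
  rw [timeSymbol_eq_fourierInv b hα0 hF h0]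
  exact continuous_fourierInv ((hb.isHardySymbol hα0 hα1).integrable_axis _)

theorem timeSymbol_eq_zero (hb : IsSectorSymbol b M) (hα0 : 0 < α) (hα1 : α < 1)
    (hF : IsH1HalfLine F F') (h0 : F 0 = 0) {t : ℝ} (ht : t ≤ 0) : timeSymbol α F b t = 0 := by
  rw [timeSymbol_eq_fourierInv b hα0 hF h0]
  exact (hb.isHardySymbol hα0 hα1).fourierInv_axis_eq_zero _ (indicator_Ioi_eq_zero _) ht

theorem indicator_timeSymbol (hb : IsSectorSymbol b M) (hα0 : 0 < α) (hα1 : α < 1)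
    (hF : IsH1HalfLine F F') (h0 : F 0 = 0) :
    (Ioi (0 : ℝ)).indicator (timeSymbol α F b) = timeSymbol α F b := by
  ext t
  rcases le_or_gt t 0 with ht | ht
  · rw [indicator_Ioi_eq_zero _ t ht, hb.timeSymbol_eq_zero hα0 hα1 hF h0 ht]
  · rw [indicator_of_mem (mem_Ioi.2 ht)]

theorem integrableOn_exp_mul_timeSymbol (hb : IsSectorSymbol b M) (hα0 : 0 < α) (hα1 : α < 1)
    (hF : IsH1HalfLine F F') (h0 : F 0 = 0) {s : ℂ} (hs : 0 < s.re) :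
    IntegrableOn (fun t : ℝ => Complex.exp (-(s * t)) * timeSymbol α F b t) (Ioi 0) := by
  rw [timeSymbol_eq_fourierInv b hα0 hF h0]
  exact ((hb.isHardySymbol hα0 hα1).integrable_exp_mul_fourierInv _
    (indicator_Ioi_eq_zero _) hs).integrableOn

theorem hlap_timeSymbol (hb : IsSectorSymbol b M) (hα0 : 0 < α) (hα1 : α < 1)
    (hF : IsH1HalfLine F F') (h0 : F 0 = 0) {s : ℂ} (hs : 0 < s.re) :
    hlap (timeSymbol α F b) s = hlap F s * b (s ^ ((α / 2 : ℝ) : ℂ)) := by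
  rw [← lap_indicator, hb.indicator_timeSymbol hα0 hα1 hF h0,
    timeSymbol_eq_fourierInv b hα0 hF h0,
    (hb.isHardySymbol hα0 hα1).lap_fourierInv hF.memLp_indicator_add (indicator_Ioi_eq_zero _) hs,
    hF.hlap_add h0 hs]
  have hne : 1 + s ≠ 0 := fun h => by
    have := congrArg Complex.re h
    simp at this; linarith
  field_simp

/-- The time derivative of `timeSymbol`. -/
theorem exists_deriv_timeSymbol (hb : IsSectorSymbol b M) (hα0 : 0 < α) (hα1 : α < 1)
    (hF : IsH1HalfLine F F') (h0 : F 0 = 0) :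
    ∃ g : ℝ → ℂ, MemLp g 2 volume ∧ (∀ t, 0 ≤ t → timeSymbol α F b t = ∫ s in (0 : ℝ)..t, g s) ∧
      eLpNorm g 2 volume ≤ ENNReal.ofReal M
        * eLpNorm (fun t => F t + F' t) 2 (volume.restrict (Ioi (0 : ℝ))) := by
  have hH := hb.isHardySymbol hα0 hα1
  set Ĝ : Lp ℂ 2 (volume : Measure ℝ) := 𝓕 (hF.memLp_indicator_add.toLp _) with hĜ
  set A : ℂ → ℂ := fun s => b (s ^ ((α / 2 : ℝ) : ℂ)) / (1 + s) with hA
  set ψ : ℝ → ℂ := fun ξ => 2 * Real.pi * Complex.I * ξ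
    * (Ĝ ξ * A (2 * Real.pi * Complex.I * ξ)) with hψ
  -- The time derivative costs `|2πiξ| ≤ |1 + 2πiξ|`, which uses up exactly the decay of the symbol.
  -- Hence `ψ` is in L² with constant `M`.
  have hle : ∀ ξ, ‖ψ ξ‖ ≤ M * ‖Ĝ ξ‖ := by
    intro ξ
    have h1 : ‖2 * Real.pi * Complex.I * ξ‖ ≤ ‖(1 : ℂ) + 2 * Real.pi * Complex.I * ξ‖ := by
      have h := Complex.abs_im_le_norm ((1 : ℂ) + 2 * Real.pi * Complex.I * ξ)
      have e : ‖2 * Real.pi * Complex.I * ξ‖ = |((1 : ℂ) + 2 * Real.pi * Complex.I * ξ).im| := by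
        simp [abs_mul]
      rw [e]; exact h
    have h2 := hH.norm_axis_le ξ
    have hpos : 0 < ‖(1 : ℂ) + 2 * Real.pi * Complex.I * ξ‖ :=
      norm_pos_iff.2 (IsH1HalfLine.one_add_ne_zero ξ)
    calc ‖ψ ξ‖ = ‖2 * Real.pi * Complex.I * ξ‖ * ‖A (2 * Real.pi * Complex.I * ξ)‖ * ‖Ĝ ξ‖ := by
          simp only [hψ, norm_mul]; ring
      _ ≤ ‖(1 : ℂ) + 2 * Real.pi * Complex.I * ξ‖
          * (M / ‖(1 : ℂ) + 2 * Real.pi * Complex.I * ξ‖) * ‖Ĝ ξ‖ := by gcongr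
      _ = M * ‖Ĝ ξ‖ := by field_simp
  have hψm : AEStronglyMeasurable ψ volume :=
    AEStronglyMeasurable.mul (by fun_prop) ((Lp.memLp Ĝ).1.mul hH.aestronglyMeasurable_axis)
  have hψ2 : MemLp ψ 2 volume := (Lp.memLp Ĝ).of_le_mul hψm (Eventually.of_forall hle)
  set g : Lp ℂ 2 (volume : Measure ℝ) := 𝓕⁻ (hψ2.toLp ψ) with hg
  have hFg : 𝓕 g = hψ2.toLp ψ := fourier_fourierInv_eq _
  refine ⟨g, Lp.memLp g, fun t ht => ?_, ?_⟩
  · have := fourierInv_sub_eq_integral (hH.integrable_axis Ĝ) g ?_ ht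
    · rw [hH.fourierInv_axis_eq_zero hF.memLp_indicator_add (indicator_Ioi_eq_zero _) le_rfl,
        sub_zero] at this
      rw [timeSymbol_eq_fourierInv b hα0 hF h0, ← this]
    · rw [hFg]
      filter_upwards [hψ2.coeFn_toLp] with ξ hξ
      rw [hξ]
  · calc eLpNorm g 2 volume = eLpNorm ψ 2 volume := by
          rw [← eLpNorm_fourierLp, hFg]; exact eLpNorm_congr_ae hψ2.coeFn_toLp
      _ ≤ ENNReal.ofReal M * eLpNorm Ĝ 2 volume :=
          eLpNorm_le_mul_eLpNorm_of_ae_le_mul (Eventually.of_forall hle) 2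
      _ = _ := by
          rw [hĜ, eLpNorm_fourierLp, eLpNorm_congr_ae hF.memLp_indicator_add.coeFn_toLp,
            eLpNorm_indicator_eq_eLpNorm_restrict measurableSet_Ioi]

end IsSectorSymbol

end TimeDomain

/-! ### The solution for a fixed continuous path and its derivatives -/

section Pathwise

open Filter Topology

theorem stronglyMeasurable_intervalIntegral {X : Type*} [MeasurableSpace X] {f : X → ℝ → ℂ}
    (hf : StronglyMeasurable (Function.uncurry f)) {a b : X → ℝ} (ha : Measurable a)
    (hb : Measurable b) : StronglyMeasurable (fun p => ∫ s in (a p)..(b p), f p s) := by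
  have key : ∀ {a b : X → ℝ}, Measurable a → Measurable b →
      StronglyMeasurable (fun p => ∫ s in Ioc (a p) (b p), f p s) := by
    intro a b ha hb
    have hS : MeasurableSet {q : X × ℝ | a q.1 < q.2 ∧ q.2 ≤ b q.1} :=
      (measurableSet_lt (ha.comp measurable_fst) measurable_snd).inter
        (measurableSet_le measurable_snd (hb.comp measurable_fst))
    have := (hf.indicator hS).integral_prod_right' (ν := (volume : Measure ℝ))
    convert this using 2 with p
    rw [← integral_indicator measurableSet_Ioc]
    rfl
  simp only [intervalIntegral]
  exact (key ha hb).sub (key hb ha)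

/-- The limit of the forward difference quotients of `f` at `t`, where it exists. -/
def fwdDeriv (f : ℝ → ℂ) (t : ℝ) : ℂ :=
  limUnder atTop fun n : ℕ => ((n : ℂ) + 1) * (f (t + 1 / ((n : ℝ) + 1)) - f t)

/-- Lebesgue differentiation. A limit of difference quotients represents the time derivative by a
formula that is jointly measurable in all variables, which an L² class chosen for each `x` would not
be. -/
theorem fwdDeriv_ae_eq {f g : ℝ → ℂ} (hg : LocallyIntegrable g volume)
    (h : ∀ t, 0 ≤ t → f t = ∫ s in (0 : ℝ)..t, g s) :
    ∀ᵐ t ∂(volume.restrict (Ioi (0 : ℝ))), fwdDeriv f t = g t := by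
  rw [ae_restrict_iff' measurableSet_Ioi]
  filter_upwards [LocallyIntegrable.ae_hasDerivAt_integral hg] with t ht ht0
  have h1 := (ht 0).tendsto_slope_zero
  have h2 : Tendsto (fun n : ℕ => 1 / ((n : ℝ) + 1)) atTop (𝓝[≠] 0) :=
    tendsto_nhdsWithin_iff.2 ⟨tendsto_one_div_add_atTop_nhds_zero_nat,
      Eventually.of_forall fun n => (Nat.one_div_pos_of_nat (α := ℝ)).ne'⟩
  refine Tendsto.limUnder_eq ((h1.comp h2).congr fun n => ?_)
  have hn : 0 < 1 / ((n : ℝ) + 1) := Nat.one_div_pos_of_nat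
  simp only [Function.comp_apply]
  rw [h t (mem_Ioi.1 ht0).le, h _ (by linarith [mem_Ioi.1 ht0]), Complex.real_smul]
  push_cast; simp

variable {α : ℝ} {F F' : ℝ → ℂ} {w : ℝ → ℝ} {x : ℝ}

/-- The solution driven by the path `w`. -/
def pathSol (α : ℝ) (F : ℝ → ℂ) (w : ℝ → ℝ) (x t : ℝ) : ℂ := timeSymbol α F (mode w x) t

/-- The spatial derivative of `pathSol`. -/
def pathSolDx (α : ℝ) (F : ℝ → ℂ) (w : ℝ → ℝ) (x t : ℝ) : ℂ :=
  timeSymbol α F (fun r => modeFlux w x r - w x) t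

/-- The time derivative of `pathSol`. -/
def pathSolDt (α : ℝ) (F : ℝ → ℂ) (w : ℝ → ℝ) (x t : ℝ) : ℂ := fwdDeriv (pathSol α F w x) t

theorem isSectorSymbol_mode (hw : Continuous w) (hx : x ∈ Icc (0 : ℝ) 1) :
    IsSectorSymbol (mode w x) (3 * ∫ y in (0 : ℝ)..1, |w y|) where
  differentiableAt _ hr := differentiableAt_mode hw x hr
  bound _ hr := norm_mode_le hw hr hx

theorem exists_bound (hw : Continuous w) : ∃ M, ∀ y ∈ Icc (0 : ℝ) 1, |w y| ≤ M :=
  isCompact_Icc.exists_bound_of_continuousOn hw.continuousOn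

theorem norm_modeFlux_sub_le {M : ℝ} (hM : ∀ y ∈ Icc (0 : ℝ) 1, |w y| ≤ M)
    (hx : x ∈ Icc (0 : ℝ) 1) {r : ℂ} (hr : r ∈ sector) : ‖modeFlux w x r - w x‖ ≤ 10 * M := by
  have h1 := norm_modeFlux_le hr hx hM
  have h2 := hM x hx
  refine (norm_sub_le _ _).trans ?_
  rw [Complex.norm_real, Real.norm_eq_abs]
  linarith

theorem isSectorSymbol_modeFlux_sub (hw : Continuous w) {M : ℝ}
    (hM : ∀ y ∈ Icc (0 : ℝ) 1, |w y| ≤ M) (hx : x ∈ Icc (0 : ℝ) 1) :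
    IsSectorSymbol (fun r => modeFlux w x r - w x) (10 * M) where
  differentiableAt _ hr := (differentiableAt_modeFlux hw x hr).sub_const _
  bound _ hr := norm_modeFlux_sub_le hM hx hr

theorem pathSol_weakDeriv (hα0 : 0 < α) (hα1 : α < 1) (hF : IsH1HalfLine F F') (h0 : F 0 = 0)
    (hw : Continuous w) (hx : x ∈ Icc (0 : ℝ) 1) :
    MemLp (pathSolDt α F w x) 2 (volume.restrict (Ioi (0 : ℝ))) ∧
    eLpNorm (pathSolDt α F w x) 2 (volume.restrict (Ioi (0 : ℝ)))
      ≤ ENNReal.ofReal (3 * ∫ y in (0 : ℝ)..1, |w y|)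
        * eLpNorm (fun t => F t + F' t) 2 (volume.restrict (Ioi (0 : ℝ))) ∧
    HasWeakDerivHalfLine (pathSol α F w x) (pathSolDt α F w x) := by
  have hb := isSectorSymbol_mode hw hx
  obtain ⟨g, g2, gi, gn⟩ := hb.exists_deriv_timeSymbol hα0 hα1 hF h0
  have hloc := g2.locallyIntegrable (by norm_num)
  have hae : ∀ᵐ t ∂(volume.restrict (Ioi (0 : ℝ))), pathSolDt α F w x t = g t :=
    fwdDeriv_ae_eq hloc gi
  have hgr : MemLp g 2 (volume.restrict (Ioi (0 : ℝ))) := g2.restrict _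
  refine ⟨(memLp_congr_ae hae).2 hgr, ?_, fun t ht => ?_⟩
  · rw [eLpNorm_congr_ae hae]
    exact (eLpNorm_mono_measure _ Measure.restrict_le_self).trans gn
  · have hae' : ∀ᵐ s, s ∈ Ioc 0 t → g s = pathSolDt α F w x s := by
      rw [ae_restrict_iff' measurableSet_Ioi] at hae
      filter_upwards [hae] with s hs h
      exact (hs h.1).symm
    have hint : IntervalIntegrable g volume 0 t :=
      (hloc.integrableOn_isCompact isCompact_uIcc).intervalIntegrable
    refine ⟨hint.congr_ae ?_, ?_⟩
    · rw [uIoc_of_le ht, Filter.EventuallyEq, ae_restrict_iff' measurableSet_Ioc]; exact hae'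
    · rw [pathSol, pathSol, gi t ht, hb.timeSymbol_eq_zero hα0 hα1 hF h0 le_rfl, zero_add]
      refine intervalIntegral.integral_congr_ae ?_
      rw [uIoc_of_le ht]; exact hae'

theorem pathSol_zero (hα0 : 0 < α) (hα1 : α < 1) (hF : IsH1HalfLine F F') (h0 : F 0 = 0)
    (hw : Continuous w) (hx : x ∈ Icc (0 : ℝ) 1) : pathSol α F w x 0 = 0 :=
  (isSectorSymbol_mode hw hx).timeSymbol_eq_zero hα0 hα1 hF h0 le_rfl

theorem pathSol_one (t : ℝ) : pathSol α F w 1 t = 0 := by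
  simp [pathSol, timeSymbol, invFourier, freqSymbol, mode_one]

theorem pathSolDx_zero (hw0 : w 0 = 0) (t : ℝ) : pathSolDx α F w 0 t = 0 := by
  simp [pathSolDx, timeSymbol, invFourier, freqSymbol, modeFlux_zero, hw0]

theorem aestronglyMeasurable_exp_mul {φ : ℝ → ℂ} (hφ : Integrable φ) (t : ℝ) :
    AEStronglyMeasurable (fun ξ : ℝ => Complex.exp (Complex.I * ((ξ * t : ℝ) : ℂ)) * φ ξ) volume :=
  AEStronglyMeasurable.mul (by fun_prop) hφ.1

theorem norm_exp_I_mul (ξ t : ℝ) (z : ℂ) :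
    ‖Complex.exp (Complex.I * ((ξ * t : ℝ) : ℂ)) * z‖ = ‖z‖ := by
  rw [norm_mul, mul_comm Complex.I, Complex.norm_exp_ofReal_mul_I, one_mul]

/-- The case of the symbol `b = 1`. The integrable function `|F̂|` then dominates every
differentiation or limit in `x` under the frequency integral. -/
theorem integrable_fourierL2 (hα0 : 0 < α) (hα1 : α < 1) (hF : IsH1HalfLine F F') (h0 : F 0 = 0) :
    Integrable (fun ξ => fourierL2 ((Ioi (0 : ℝ)).indicator F) ξ) := by
  have hb : IsSectorSymbol (fun _ => 1) 1 := ⟨fun r _ => by fun_prop, fun r _ => by simp⟩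
  exact (hb.integrable_freqSymbol hα0 hα1 hF h0).congr
    (Eventually.of_forall fun ξ => by simp [freqSymbol])

theorem continuousOn_pathSolDx (hα0 : 0 < α) (hα1 : α < 1) (hF : IsH1HalfLine F F') (h0 : F 0 = 0)
    (hw : Continuous w) (t : ℝ) : ContinuousOn (fun x => pathSolDx α F w x t) (Icc 0 1) := by
  obtain ⟨M, hM⟩ := exists_bound hw
  refine ContinuousOn.mul continuousOn_const ?_
  refine continuousOn_of_dominated (bound := fun ξ =>
    ‖fourierL2 ((Ioi (0 : ℝ)).indicator F) ξ‖ * (10 * M)) (fun x hx => ?_) (fun x hx => ?_)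
    ((integrable_fourierL2 hα0 hα1 hF h0).norm.mul_const _) (Eventually.of_forall fun ξ => ?_)
  · exact aestronglyMeasurable_exp_mul
      ((isSectorSymbol_modeFlux_sub hw hM hx).integrable_freqSymbol hα0 hα1 hF h0) t
  · refine Eventually.of_forall fun ξ => ?_
    rw [norm_exp_I_mul, freqSymbol, norm_mul]
    gcongr
    exact norm_modeFlux_sub_le hM hx (iPow_mem_sector hα0 hα1 ξ)
  · refine Continuous.continuousOn ?_
    have h1 : Continuous (fun x => modeFlux w x (iPow (α / 2) ξ)) :=
      continuous_iff_continuousAt.2 fun x => (hasDerivAt_modeFlux hw x).continuousAt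
    unfold freqSymbol
    fun_prop

theorem continuousOn_pathSol (hα0 : 0 < α) (hα1 : α < 1) (hF : IsH1HalfLine F F') (h0 : F 0 = 0)
    (hw : Continuous w) (t : ℝ) : ContinuousOn (fun x => pathSol α F w x t) (Icc 0 1) := by
  refine ContinuousOn.mul continuousOn_const ?_
  refine continuousOn_of_dominated (bound := fun ξ =>
    ‖fourierL2 ((Ioi (0 : ℝ)).indicator F) ξ‖ * (3 * ∫ y in (0 : ℝ)..1, |w y|))
    (fun x hx => ?_) (fun x hx => ?_)
    ((integrable_fourierL2 hα0 hα1 hF h0).norm.mul_const _) (Eventually.of_forall fun ξ => ?_)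
  · exact aestronglyMeasurable_exp_mul
      ((isSectorSymbol_mode hw hx).integrable_freqSymbol hα0 hα1 hF h0) t
  · refine Eventually.of_forall fun ξ => ?_
    rw [norm_exp_I_mul, freqSymbol, norm_mul]
    gcongr
    exact norm_mode_le hw (iPow_mem_sector hα0 hα1 ξ) hx
  · refine Continuous.continuousOn ?_
    have h1 : Continuous (fun x => mode w x (iPow (α / 2) ξ)) :=
      continuous_iff_continuousAt.2 fun x =>
        (hasDerivAt_mode hw (iPow_mem_sector hα0 hα1 ξ) x).continuousAt
    unfold freqSymbol
    fun_prop

theorem hasDerivAt_pathSol (hα0 : 0 < α) (hα1 : α < 1) (hF : IsH1HalfLine F F') (h0 : F 0 = 0)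
    (hw : Continuous w) (t : ℝ) (hx : x ∈ Ioo (0 : ℝ) 1) :
    HasDerivAt (fun x => pathSol α F w x t) (pathSolDx α F w x t) x := by
  obtain ⟨M, hM⟩ := exists_bound hw
  refine HasDerivAt.const_mul _ ?_
  refine (hasDerivAt_integral_of_dominated_loc_of_deriv_le
    (F := fun x ξ => Complex.exp (Complex.I * ((ξ * t : ℝ) : ℂ)) * freqSymbol α F (mode w x) ξ)
    (F' := fun x ξ => Complex.exp (Complex.I * ((ξ * t : ℝ) : ℂ))
      * freqSymbol α F (fun r => modeFlux w x r - w x) ξ) (s := Ioo 0 1) (bound := fun ξ =>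
    ‖fourierL2 ((Ioi (0 : ℝ)).indicator F) ξ‖ * (10 * M)) (isOpen_Ioo.mem_nhds hx) ?_ ?_ ?_ ?_
    ((integrable_fourierL2 hα0 hα1 hF h0).norm.mul_const _) ?_).2
  · filter_upwards [isOpen_Ioo.mem_nhds hx] with z hz
    exact aestronglyMeasurable_exp_mul ((isSectorSymbol_mode hw
      (Ioo_subset_Icc_self hz)).integrable_freqSymbol hα0 hα1 hF h0) t
  · have := (isSectorSymbol_mode hw (Ioo_subset_Icc_self hx)).integrable_freqSymbol hα0 hα1 hF h0
    exact this.norm.mono' (aestronglyMeasurable_exp_mul this t)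
      (Eventually.of_forall fun ξ => (norm_exp_I_mul ξ t _).le)
  · exact aestronglyMeasurable_exp_mul ((isSectorSymbol_modeFlux_sub hw hM
      (Ioo_subset_Icc_self hx)).integrable_freqSymbol hα0 hα1 hF h0) t
  · refine Eventually.of_forall fun ξ z hz => ?_
    rw [norm_exp_I_mul, freqSymbol, norm_mul]
    gcongr
    exact norm_modeFlux_sub_le hM (Ioo_subset_Icc_self hz) (iPow_mem_sector hα0 hα1 ξ)
  · refine Eventually.of_forall fun ξ z _ => ?_
    exact ((hasDerivAt_mode hw (iPow_mem_sector hα0 hα1 ξ) z).const_mul _).const_mul _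

/-- At an endpoint the one-sided derivative is the limit of the interior derivatives. -/
theorem hasDerivWithinAt_Icc_of_continuousOn {f f' : ℝ → ℂ} (hf : ContinuousOn f (Icc 0 1))
    (hf' : ContinuousOn f' (Icc 0 1)) (h : ∀ x ∈ Ioo (0 : ℝ) 1, HasDerivAt f (f' x) x)
    (hx : x ∈ Icc (0 : ℝ) 1) : HasDerivWithinAt f (f' x) (Icc 0 1) x := by
  have hdiff : DifferentiableOn ℝ f (Ioo 0 1) := fun y hy =>
    (h y hy).differentiableAt.differentiableWithinAt
  rcases eq_or_lt_of_le hx.1 with rfl | h1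
  · refine (hasDerivWithinAt_Ici_of_tendsto_deriv hdiff
      ((hf 0 hx).mono Ioo_subset_Icc_self) (Ioo_mem_nhdsGT one_pos) ?_).mono Icc_subset_Ici_self
    have := (hf' 0 hx).mono Ioo_subset_Icc_self
    rw [ContinuousWithinAt, nhdsWithin_Ioo_eq_nhdsGT one_pos] at this
    refine this.congr' ?_
    filter_upwards [Ioo_mem_nhdsGT one_pos] with y hy
    exact (h y hy).deriv.symm
  rcases eq_or_lt_of_le hx.2 with rfl | h2
  · refine (hasDerivWithinAt_Iic_of_tendsto_deriv hdiff
      ((hf 1 hx).mono Ioo_subset_Icc_self) (Ioo_mem_nhdsLT one_pos) ?_).mono Icc_subset_Iic_self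
    have := (hf' 1 hx).mono Ioo_subset_Icc_self
    rw [ContinuousWithinAt, nhdsWithin_Ioo_eq_nhdsLT one_pos] at this
    refine this.congr' ?_
    filter_upwards [Ioo_mem_nhdsLT one_pos] with y hy
    exact (h y hy).deriv.symm
  · exact (h x ⟨h1, h2⟩).hasDerivWithinAt

theorem hasDerivWithinAt_pathSol (hα0 : 0 < α) (hα1 : α < 1) (hF : IsH1HalfLine F F')
    (h0 : F 0 = 0) (hw : Continuous w) (t : ℝ) (hx : x ∈ Icc (0 : ℝ) 1) :
    HasDerivWithinAt (fun x => pathSol α F w x t) (pathSolDx α F w x t) (Icc 0 1) x :=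
  hasDerivWithinAt_Icc_of_continuousOn (continuousOn_pathSol hα0 hα1 hF h0 hw t)
    (continuousOn_pathSolDx hα0 hα1 hF h0 hw t)
    (fun _ hz => hasDerivAt_pathSol hα0 hα1 hF h0 hw t hz) hx

end Pathwise

/-! ### Joint measurability in space, time and chance -/

section Measurability

open Filter Topology

variable {Ω : Type*} [MeasurableSpace Ω] {α : ℝ} {F F' : ℝ → ℂ}

theorem measurable_iPow {β : ℝ} (hβ : β ≠ 0) : Measurable (iPow β) := by
  have : iPow β = fun ω : ℝ => (Complex.I * ω) ^ (β : ℂ) := funext (iPow_eq_cpow hβ)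
  rw [this]
  fun_prop

theorem stronglyMeasurable_fourierL2 (f : ℝ → ℂ) : StronglyMeasurable (fourierL2 f) := by
  unfold fourierL2
  by_cases h : MemLp f 2 (volume : Measure ℝ)
  · simp only [h, dif_pos]
    exact (Lp.stronglyMeasurable _).comp_measurable (by fun_prop)
  · simp only [h, dif_neg, not_false_eq_true]
    exact stronglyMeasurable_const

theorem stronglyMeasurable_timeSymbol {b : ℝ → Ω → ℂ → ℂ}
    (hb : StronglyMeasurable fun q : (ℝ × Ω) × ℝ => b q.1.1 q.1.2 (iPow (α / 2) q.2)) :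
    StronglyMeasurable fun p : (ℝ × ℝ) × Ω => timeSymbol α F (b p.1.1 p.2) p.1.2 := by
  unfold timeSymbol invFourier freqSymbol
  refine stronglyMeasurable_const.mul ?_
  refine StronglyMeasurable.integral_prod_right' (ν := (volume : Measure ℝ))
    (f := fun q : ((ℝ × ℝ) × Ω) × ℝ => Complex.exp (Complex.I * ((q.2 * q.1.1.2 : ℝ) : ℂ)) *
      (fourierL2 ((Ioi (0 : ℝ)).indicator F) q.2 * b q.1.1.1 q.1.2 (iPow (α / 2) q.2))) ?_
  refine StronglyMeasurable.mul (Measurable.stronglyMeasurable (by fun_prop)) ?_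
  refine ((stronglyMeasurable_fourierL2 _).comp_measurable measurable_snd).mul ?_
  exact hb.comp_measurable (g := fun q : ((ℝ × ℝ) × Ω) × ℝ => ((q.1.1.1, q.1.2), q.2))
    (by fun_prop)

variable {w : Ω → ℝ → ℝ}

theorem stronglyMeasurable_sinhInt (hw : Measurable (Function.uncurry w)) (hα0 : 0 < α) :
    StronglyMeasurable fun q : (ℝ × Ω) × ℝ => sinhInt (w q.1.2) q.1.1 (iPow (α / 2) q.2) := by
  have hi := measurable_iPow (half_pos hα0).ne'
  refine stronglyMeasurable_intervalIntegral (Measurable.stronglyMeasurable ?_) (by fun_prop)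
    (by fun_prop)
  have hw' : Measurable fun p : ((ℝ × Ω) × ℝ) × ℝ => w p.1.1.2 p.2 :=
    hw.comp (f := fun p : ((ℝ × Ω) × ℝ) × ℝ => (p.1.1.2, p.2)) (by fun_prop)
  unfold Function.uncurry
  fun_prop

theorem stronglyMeasurable_coshInt (hw : Measurable (Function.uncurry w)) (hα0 : 0 < α) :
    StronglyMeasurable fun q : (ℝ × Ω) × ℝ => coshInt (w q.1.2) q.1.1 (iPow (α / 2) q.2) := by
  have hi := measurable_iPow (half_pos hα0).ne'
  refine stronglyMeasurable_intervalIntegral (Measurable.stronglyMeasurable ?_) (by fun_prop)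
    (by fun_prop)
  have hw' : Measurable fun p : ((ℝ × Ω) × ℝ) × ℝ => w p.1.1.2 (1 - p.2) :=
    hw.comp (f := fun p : ((ℝ × Ω) × ℝ) × ℝ => (p.1.1.2, 1 - p.2)) (by fun_prop)
  unfold Function.uncurry
  fun_prop

theorem stronglyMeasurable_mode (hw : Measurable (Function.uncurry w)) (hα0 : 0 < α) :
    StronglyMeasurable fun q : (ℝ × Ω) × ℝ => mode (w q.1.2) q.1.1 (iPow (α / 2) q.2) := by
  have hi := measurable_iPow (half_pos hα0).ne'
  have h1 := (stronglyMeasurable_sinhInt hw hα0).measurable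
  have h2 := (stronglyMeasurable_coshInt hw hα0).measurable
  refine Measurable.stronglyMeasurable ?_
  unfold mode
  fun_prop

theorem stronglyMeasurable_modeFlux_sub (hw : Measurable (Function.uncurry w)) (hα0 : 0 < α) :
    StronglyMeasurable fun q : (ℝ × Ω) × ℝ =>
      modeFlux (w q.1.2) q.1.1 (iPow (α / 2) q.2) - w q.1.2 q.1.1 := by
  have hi := measurable_iPow (half_pos hα0).ne'
  have h1 := (stronglyMeasurable_sinhInt hw hα0).measurable
  have h2 := (stronglyMeasurable_coshInt hw hα0).measurable
  have h3 : Measurable fun q : (ℝ × Ω) × ℝ => w q.1.2 q.1.1 :=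
    hw.comp (f := fun p : (ℝ × Ω) × ℝ => (p.1.2, p.1.1)) (by fun_prop)
  refine Measurable.stronglyMeasurable ?_
  unfold modeFlux
  fun_prop

theorem stronglyMeasurable_pathSol (hw : Measurable (Function.uncurry w)) (hα0 : 0 < α) :
    StronglyMeasurable fun p : (ℝ × ℝ) × Ω => pathSol α F (w p.2) p.1.1 p.1.2 :=
  stronglyMeasurable_timeSymbol (b := fun x ω => mode (w ω) x) (stronglyMeasurable_mode hw hα0)

theorem stronglyMeasurable_pathSolDx (hw : Measurable (Function.uncurry w)) (hα0 : 0 < α) :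
    StronglyMeasurable fun p : (ℝ × ℝ) × Ω => pathSolDx α F (w p.2) p.1.1 p.1.2 :=
  stronglyMeasurable_timeSymbol (b := fun x ω r => modeFlux (w ω) x r - w ω x)
    (stronglyMeasurable_modeFlux_sub hw hα0)

theorem stronglyMeasurable_pathSolDt (hw : Measurable (Function.uncurry w)) (hα0 : 0 < α) :
    StronglyMeasurable fun p : (ℝ × ℝ) × Ω => pathSolDt α F (w p.2) p.1.1 p.1.2 := by
  have h := stronglyMeasurable_pathSol (F := F) hw hα0
  unfold pathSolDt fwdDeriv
  refine StronglyMeasurable.limUnder fun n => ?_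
  refine stronglyMeasurable_const.mul (StronglyMeasurable.sub ?_ h)
  exact h.comp_measurable (g := fun p : (ℝ × ℝ) × Ω => ((p.1.1, p.1.2 + 1 / ((n : ℝ) + 1)), p.2))
    (by fun_prop)

theorem stronglyMeasurable_caputo {X : Type*} [MeasurableSpace X] {f : X → ℝ → ℂ}
    (hf : StronglyMeasurable (Function.uncurry f)) :
    StronglyMeasurable fun p : X × ℝ => caputo α (f p.1) p.2 := by
  unfold caputo
  refine stronglyMeasurable_const.mul ?_
  refine stronglyMeasurable_intervalIntegral (X := X × ℝ)
    (f := fun p s => f p.1 s * (((p.2 - s) ^ (-α) : ℝ) : ℂ)) ?_ (by fun_prop) (by fun_prop)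
  refine StronglyMeasurable.mul ?_ (Measurable.stronglyMeasurable (by fun_prop))
  exact hf.comp_measurable (g := fun p : (X × ℝ) × ℝ => (p.1.1, p.2)) (by fun_prop)

theorem stronglyMeasurable_caputo_pathSolDt (hw : Measurable (Function.uncurry w)) (hα0 : 0 < α) :
    StronglyMeasurable fun p : (ℝ × ℝ) × Ω =>
      caputo α (fun s => pathSolDt α F (w p.2) p.1.1 s) p.1.2 := by
  have h := stronglyMeasurable_pathSolDt (F := F) hw hα0
  have := stronglyMeasurable_caputo (α := α) (X := ℝ × Ω)
    (f := fun p s => pathSolDt α F (w p.2) p.1 s)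
    (h.comp_measurable (g := fun p : (ℝ × Ω) × ℝ => ((p.1.1, p.2), p.1.2)) (by fun_prop))
  exact this.comp_measurable (g := fun p : (ℝ × ℝ) × Ω => ((p.1.1, p.2), p.1.2)) (by fun_prop)

end Measurability

/-! ### The integrated fractional equation for one path -/

section PathwiseEquation

open Filter Topology

variable {α : ℝ} {F F' : ℝ → ℂ} {w : ℝ → ℝ} {x : ℝ}

theorem stronglyMeasurable_caputo_pathSolDt_path (hw : Continuous w) (hα0 : 0 < α) :
    StronglyMeasurable fun p : ℝ × ℝ => caputo α (fun s => pathSolDt α F w p.1 s) p.2 := by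
  -- A deterministic path is a random path over a one-point space.
  have := stronglyMeasurable_caputo_pathSolDt (Ω := Unit) (F := F) (w := fun _ => w)
    (hw.measurable.comp measurable_snd) hα0
  exact this.comp_measurable (g := fun p : ℝ × ℝ => (p, ())) (by fun_prop)

theorem memLp_exp_neg_restrict {a : ℝ} (ha : 0 < a) :
    MemLp (fun t : ℝ => Complex.exp (-(a * t))) 2 (volume.restrict (Ioi (0 : ℝ))) := by
  have h := (memLp_indicator_iff_restrict measurableSet_Ioi).1 (memLp_exp_neg ha)
  refine h.mono (by fun_prop) (Eventually.of_forall fun t => ?_)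
  rw [norm_exp_neg_mul]
  simp

/-- A family `c(y, ·)` of Caputo derivatives is integrable against `e^{-at} dy dt`, if the
derivatives are bounded in `L²(0,∞)`. -/
theorem integrable_exp_mul_caputo (hα1 : α < 1) {f : ℝ → ℝ → ℂ}
    {ν : Measure ℝ} [IsFiniteMeasure ν]
    (hm : AEStronglyMeasurable (fun p : ℝ × ℝ => caputo α (f p.1) p.2)
      (ν.prod (volume.restrict (Ioi (0 : ℝ)))))
    (hf : ∀ᵐ y ∂ν, MemLp (f y) 2 (volume.restrict (Ioi (0 : ℝ))))
    (hK : ∫⁻ y, eLpNorm (f y) 2 (volume.restrict (Ioi (0 : ℝ))) ∂ν ≠ ∞) {a : ℝ} (ha : 0 < a) :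
    Integrable (fun p : ℝ × ℝ => Complex.exp (-(a * p.2)) * caputo α (f p.1) p.2)
      (ν.prod (volume.restrict (Ioi (0 : ℝ)))) := by
  have hm' : AEStronglyMeasurable (fun p : ℝ × ℝ => Complex.exp (-(a * p.2)) * caputo α (f p.1) p.2)
      (ν.prod (volume.restrict (Ioi (0 : ℝ)))) := AEStronglyMeasurable.mul (by fun_prop) hm
  refine ⟨hm', ?_⟩
  rw [HasFiniteIntegral, lintegral_prod _ hm'.enorm]
  set K := ENNReal.ofReal (a ^ (α - 1)) * eLpNorm (fun t : ℝ => Complex.exp (-(a * t))) 2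
    (volume.restrict (Ioi (0 : ℝ))) with hKdef
  have hKtop : K ≠ ∞ := ENNReal.mul_ne_top ENNReal.ofReal_ne_top (memLp_exp_neg_restrict ha).2.ne
  calc _ ≤ ∫⁻ y, K * eLpNorm (f y) 2 (volume.restrict (Ioi (0 : ℝ))) ∂ν := by
        refine lintegral_mono_ae ?_
        filter_upwards [hf] with y hy
        refine (integral_exp_mul_norm_caputo_le hα1 ha
          (integrableOn_exp_mul_of_memLp hy (by simpa using ha))).trans ?_
        rw [hKdef, mul_assoc]
        gcongr
        exact integral_norm_mul_le (memLp_exp_neg_restrict ha).1 hy.1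
    _ = K * ∫⁻ y, eLpNorm (f y) 2 (volume.restrict (Ioi (0 : ℝ))) ∂ν := lintegral_const_mul' _ _ hKtop
    _ < ∞ := ENNReal.mul_lt_top hKtop.lt_top hK.lt_top

theorem integrable_caputo_pathSolDt (hα0 : 0 < α) (hα1 : α < 1) (hF : IsH1HalfLine F F')
    (h0 : F 0 = 0) (hw : Continuous w) {a : ℝ} (ha : 0 < a) :
    Integrable (fun p : ℝ × ℝ => Complex.exp (-(a * p.2))
        * caputo α (fun s => pathSolDt α F w p.1 s) p.2)
      ((volume.restrict (Ioo (0 : ℝ) 1)).prod (volume.restrict (Ioi (0 : ℝ)))) := by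
  refine integrable_exp_mul_caputo hα1
    (stronglyMeasurable_caputo_pathSolDt_path hw hα0).aestronglyMeasurable ?_ ?_ ha
  · filter_upwards [ae_restrict_mem measurableSet_Ioo] with y hy
    exact (pathSol_weakDeriv hα0 hα1 hF h0 hw (Ioo_subset_Icc_self hy)).1
  · have hG := (hF.memLp.add hF.memLp_deriv).2.ne
    refine ne_top_of_le_ne_top (b := ∫⁻ _ in Ioo (0 : ℝ) 1,
      ENNReal.ofReal (3 * ∫ y in (0 : ℝ)..1, |w y|)
        * eLpNorm (fun t => F t + F' t) 2 (volume.restrict (Ioi (0 : ℝ)))) ?_ ?_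
    · rw [lintegral_const]
      exact ENNReal.mul_ne_top (ENNReal.mul_ne_top ENNReal.ofReal_ne_top hG) (by simp)
    · refine lintegral_mono_ae ?_
      filter_upwards [ae_restrict_mem measurableSet_Ioo] with y hy
      exact (pathSol_weakDeriv hα0 hα1 hF h0 hw (Ioo_subset_Icc_self hy)).2.1

/-- `s^{α-1}` comes from the Caputo kernel and `s` from the time derivative; together they give the
`r²` of the resolvent equation. -/
theorem cpow_half_sq {s : ℂ} (hs : s ≠ 0) :
    (s ^ ((α / 2 : ℝ) : ℂ)) ^ 2 = s ^ ((α - 1 : ℝ) : ℂ) * s := by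
  have h : s ^ ((α - 1 : ℝ) : ℂ) * s = s ^ ((α - 1 : ℝ) : ℂ) * s ^ (1 : ℂ) := by
    rw [Complex.cpow_one]
  rw [h, sq, ← Complex.cpow_add _ _ hs, ← Complex.cpow_add _ _ hs]
  congr 1
  push_cast; ring

/-- Changing `Im s` only multiplies the integrand by a unimodular function. -/
theorem exp_mul_integrable_of_re_eq {X : Type*} [MeasurableSpace X] {μ : Measure X} {τ : X → ℝ}
    {f : X → ℂ} {a : ℝ} {s : ℂ} (hs : s.re = a) (hτ : Measurable τ)
    (h : Integrable (fun p => Complex.exp (-(a * τ p)) * f p) μ) :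
    Integrable (fun p => Complex.exp (-(s * τ p)) * f p) μ := by
  have := h.bdd_mul (f := fun p => Complex.exp (-((s.im * τ p : ℝ) * Complex.I))) (c := 1)
    (Measurable.aestronglyMeasurable (by fun_prop)) (Eventually.of_forall fun p => by
      rw [← neg_mul, ← Complex.ofReal_neg, Complex.norm_exp_ofReal_mul_I])
  refine this.congr (Eventually.of_forall fun p => ?_)
  simp only
  rw [← mul_assoc, ← Complex.exp_add]
  congr 2
  conv_rhs => rw [← Complex.re_add_im s, hs]
  push_cast; ring

theorem hlap_pathSol (hα0 : 0 < α) (hα1 : α < 1) (hF : IsH1HalfLine F F')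
    (h0 : F 0 = 0) (hw : Continuous w) (hx : x ∈ Icc (0 : ℝ) 1) {s : ℂ} (hs : 0 < s.re) :
    hlap (pathSol α F w x) s = hlap F s * mode w x (s ^ ((α / 2 : ℝ) : ℂ)) :=
  (isSectorSymbol_mode hw hx).hlap_timeSymbol hα0 hα1 hF h0 hs

theorem hlap_caputo_pathSolDt (hα0 : 0 < α) (hα1 : α < 1) (hF : IsH1HalfLine F F')
    (h0 : F 0 = 0) (hw : Continuous w) (hx : x ∈ Icc (0 : ℝ) 1) {s : ℂ} (hs : 0 < s.re) :
    hlap (fun t => caputo α (fun s => pathSolDt α F w x s) t) s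
      = hlap F s * ((s ^ ((α / 2 : ℝ) : ℂ)) ^ 2 * mode w x (s ^ ((α / 2 : ℝ) : ℂ))) := by
  obtain ⟨h2, -, hwd⟩ := pathSol_weakDeriv hα0 hα1 hF h0 hw hx
  have hi := integrableOn_exp_mul_of_memLp h2 hs
  have hs0 : s ≠ 0 := fun h => by simp [h] at hs
  rw [(hlap_caputo hα1 hs hi).2, (hlap_weakDeriv hwd (pathSol_zero hα0 hα1 hF h0 hw hx) hs hi).2,
    hlap_pathSol hα0 hα1 hF h0 hw hx hs, cpow_half_sq hs0]
  ring

/-- The integrated equation. -/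
theorem pathSol_equation (hα0 : 0 < α) (hα1 : α < 1) (hF : IsH1HalfLine F F')
    (h0 : F 0 = 0) (hw : Continuous w) (hx : x ∈ Icc (0 : ℝ) 1) :
    ∀ᵐ t ∂(volume.restrict (Ioi (0 : ℝ))), pathSolDx α F w x t
      = (∫ y in (0 : ℝ)..x, caputo α (fun s => pathSolDt α F w y s) t) - F t * w x := by
  obtain ⟨M, hM⟩ := exists_bound hw
  set c : ℝ → ℝ → ℂ := fun y t => caputo α (fun s => pathSolDt α F w y s) t with hc
  -- This justifies Fubini between `y` and `t` on the line `Re s = 1`, the only line that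
  -- injectivity needs.
  have hprod : Integrable (fun p : ℝ × ℝ => Complex.exp (-(((1 : ℝ) : ℂ) * p.2)) * c p.1 p.2)
      ((volume.restrict (Ioc (0 : ℝ) x)).prod (volume.restrict (Ioi (0 : ℝ)))) := by
    refine (integrable_caputo_pathSolDt hα0 hα1 hF h0 hw one_pos).mono_measure ?_
    rw [← restrict_Ioo_eq_restrict_Ioc]
    exact Measure.prod_mono (Measure.restrict_mono (Ioo_subset_Ioo le_rfl hx.2) le_rfl) le_rfl
  have hprod' := fun (s : ℂ) (hs : s.re = 1) =>
    exp_mul_integrable_of_re_eq (τ := Prod.snd) hs measurable_snd hprod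
  have hDx := isSectorSymbol_modeFlux_sub hw hM hx
  have i1 : ∀ s : ℂ, s.re = 1 → IntegrableOn
      (fun t : ℝ => Complex.exp (-(s * t)) * pathSolDx α F w x t) (Ioi 0) := fun s hs =>
    hDx.integrableOn_exp_mul_timeSymbol hα0 hα1 hF h0 (by simp [hs])
  have i2 : ∀ s : ℂ, s.re = 1 → IntegrableOn
      (fun t : ℝ => Complex.exp (-(s * t)) * (F t * w x)) (Ioi 0) := fun s hs => by
    have := (integrableOn_exp_mul_of_memLp hF.memLp (s := s) (by simp [hs])).mul_const (w x : ℂ)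
    exact this.congr (Eventually.of_forall fun t => by simp only; ring)
  have i3 : ∀ s : ℂ, s.re = 1 → IntegrableOn
      (fun t : ℝ => Complex.exp (-(s * t)) * ∫ y in (0 : ℝ)..x, c y t) (Ioi 0) := fun s hs => by
    have := (hprod' s hs).integral_prod_right
    refine this.congr (Eventually.of_forall fun t => ?_)
    simp only
    rw [intervalIntegral.integral_of_le hx.1, integral_const_mul]
  -- The defect of the equation has zero Laplace transform on one vertical line, hence vanishes for
  -- almost every `t`.
  have key : ∀ᵐ t ∂(volume.restrict (Ioi (0 : ℝ))),
      pathSolDx α F w x t + F t * w x - ∫ y in (0 : ℝ)..x, c y t = 0 := by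
    refine ae_eq_zero_of_hlap_eq_zero (a := 1) ?_ fun s hs => ?_
    · have := ((i1 1 (by simp)).add (i2 1 (by simp))).sub (i3 1 (by simp))
      refine this.congr (Eventually.of_forall fun t => ?_)
      simp only [Pi.sub_apply, Pi.add_apply, Complex.ofReal_one]; ring
    · have hs0 : 0 < s.re := by simp [hs]
      set r := s ^ ((α / 2 : ℝ) : ℂ) with hr
      have hrs : r ∈ sector := cpow_mem_sector hα0 hα1 hs0.le
      have e1 : hlap (fun t => pathSolDx α F w x t + F t * w x - ∫ y in (0 : ℝ)..x, c y t) s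
          = (hlap (pathSolDx α F w x) s + hlap F s * w x)
            - hlap (fun t => ∫ y in (0 : ℝ)..x, c y t) s := by
        have e0 : hlap F s * w x = hlap (fun t => F t * w x) s := by
          simp only [hlap]
          rw [← integral_mul_const]
          exact integral_congr_ae (Eventually.of_forall fun t => by simp only; ring)
        rw [e0]
        simp only [hlap, mul_sub, mul_add]
        exact (integral_sub ((i1 s hs).add (i2 s hs)) (i3 s hs)).trans
          (congrArg₂ _ (integral_add (i1 s hs) (i2 s hs)) rfl)
      have e2 : hlap (fun t => ∫ y in (0 : ℝ)..x, c y t) s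
          = ∫ y in (0 : ℝ)..x, hlap F s * (r ^ 2 * mode w y r) := by
        have hsw := integral_integral_swap
          (f := fun y t : ℝ => Complex.exp (-(s * t)) * c y t) (hprod' s hs)
        rw [intervalIntegral.integral_of_le hx.1]
        calc hlap (fun t => ∫ y in (0 : ℝ)..x, c y t) s
            = ∫ t in Ioi (0 : ℝ), ∫ y in Ioc (0 : ℝ) x, Complex.exp (-(s * t)) * c y t := by
              rw [hlap]
              refine integral_congr_ae (Eventually.of_forall fun t => ?_)
              simp only
              rw [intervalIntegral.integral_of_le hx.1, integral_const_mul]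
          _ = ∫ y in Ioc (0 : ℝ) x, ∫ t in Ioi (0 : ℝ), Complex.exp (-(s * t)) * c y t := hsw.symm
          _ = _ := by
              refine setIntegral_congr_fun measurableSet_Ioc fun y hy => ?_
              exact hlap_caputo_pathSolDt hα0 hα1 hF h0 hw ⟨hy.1.le, hy.2.trans hx.2⟩ hs0
      -- On the transform side the equation is the fundamental theorem of calculus for `modeFlux`,
      -- which vanishes at `0`.
      have e3 : ∫ y in (0 : ℝ)..x, r ^ 2 * mode w y r = modeFlux w x r := by
        rw [intervalIntegral.integral_eq_sub_of_hasDerivAt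
          (fun y _ => hasDerivAt_modeFlux (r := r) hw y) (Continuous.intervalIntegrable
            (continuous_const.mul (continuous_iff_continuousAt.2 fun y =>
              (hasDerivAt_mode hw hrs y).continuousAt)) _ _), modeFlux_zero, sub_zero]
      rw [e1, e2, intervalIntegral.integral_const_mul, e3]
      have e4 : hlap (pathSolDx α F w x) s = hlap F s * (modeFlux w x r - w x) :=
        hDx.hlap_timeSymbol hα0 hα1 hF h0 hs0
      rw [e4]; ring
  filter_upwards [key] with t ht
  linear_combination ht

end PathwiseEquation

/-! ### Measurable continuous modification and variances -/

section BrownianPath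

open Filter Topology

variable {Ω : Type*} [MeasurableSpace Ω] {μ : Measure Ω} {W : ℝ≥0 → Ω → ℝ}

/-- A Brownian motion has a jointly measurable modification all of whose paths are continuous and
start at zero; it is extended to the negative half-line by zero. -/
theorem exists_measurable_modification (hW : IsBrownianReal W μ) :
    ∃ w : Ω → ℝ → ℝ, Measurable (Function.uncurry w) ∧ (∀ ω, Continuous (w ω)) ∧
      (∀ ω, w ω 0 = 0) ∧ ∀ᵐ ω ∂μ, ∀ y : ℝ, w ω y = W y.toNNReal ω := by
  classical
  set d := TopologicalSpace.denseSeq ℝ≥0 with hd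
  -- Three defects are put into one null set: discontinuity, a wrong starting point, and
  -- disagreement with a measurable version at some point of a dense sequence. Paths there are
  -- replaced by `0`; elsewhere continuity transfers measurability from the dense sequence to all
  -- points.
  have hE : ∀ᵐ ω ∂μ, Continuous (W · ω) ∧ W 0 ω = 0 ∧
      ∀ n, W (d n) ω = (hW.aemeasurable (d n)).mk _ ω := by
    filter_upwards [hW.cont, hW.eval_zero_ae_eq_zero,
      ae_all_iff.2 fun n => (hW.aemeasurable (d n)).ae_eq_mk] with ω h1 h2 h3
    exact ⟨h1, h2, h3⟩
  obtain ⟨N, hN, hNm, hN0⟩ := exists_measurable_superset_of_null (ae_iff.1 hE)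
  have hgood : ∀ ω ∉ N, Continuous (W · ω) ∧ W 0 ω = 0 ∧
      ∀ n, W (d n) ω = (hW.aemeasurable (d n)).mk _ ω := fun ω hω => by
    by_contra h
    exact hω (hN h)
  let v : ℝ≥0 → Ω → ℝ := fun y => Nᶜ.indicator (W y)
  have hvc : ∀ ω, Continuous fun y => v y ω := fun ω => by
    by_cases hω : ω ∈ N
    · have : (fun y => v y ω) = fun _ => 0 := funext fun y => indicator_of_notMem (by simpa) _
      rw [this]; exact continuous_const
    · have : (fun y => v y ω) = (W · ω) := funext fun y => indicator_of_mem (by simpa) _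
      rw [this]; exact (hgood ω hω).1
  have hvd : ∀ n, Measurable (v (d n)) := fun n => by
    have : v (d n) = Nᶜ.indicator ((hW.aemeasurable (d n)).mk _) := by
      ext ω
      by_cases hω : ω ∈ N
      · simp [v, hω]
      · simp [v, hω, (hgood ω hω).2.2 n]
    rw [this]
    exact (hW.aemeasurable (d n)).measurable_mk.indicator hNm.compl
  have hvm : ∀ y, Measurable (v y) := fun y => by
    obtain ⟨x, hx, hxy⟩ := mem_closure_iff_seq_limit.1
      ((TopologicalSpace.denseRange_denseSeq ℝ≥0) y)
    refine measurable_of_tendsto_metrizable (f := fun n => v (x n)) (fun n => ?_)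
      (tendsto_pi_nhds.2 fun ω => ((hvc ω).tendsto y).comp hxy)
    obtain ⟨k, hk⟩ := hx n
    rw [← hk]
    exact hvd k
  have hvu := measurable_uncurry_of_continuous_of_measurable hvc hvm
  refine ⟨fun ω y => v y.toNNReal ω, ?_, fun ω => (hvc ω).comp continuous_real_toNNReal,
    fun ω => ?_, ?_⟩
  · exact hvu.comp (f := fun p : Ω × ℝ => (p.2.toNNReal, p.1)) (by fun_prop)
  · by_cases hω : ω ∈ N
    · simp [v, hω]
    · simp [v, hω, (hgood ω hω).2.1]
  · have : ∀ᵐ ω ∂μ, ω ∉ N := measure_eq_zero_iff_ae_notMem.1 hN0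
    filter_upwards [this] with ω hω y
    simp [v, hω]

theorem lintegral_enorm_sq_of_hasLaw_gaussianReal {X : Ω → ℝ} {σ : ℝ≥0}
    (hX : HasLaw X (gaussianReal 0 σ) μ) : ∫⁻ ω, ‖X ω‖ₑ ^ 2 ∂μ = σ := by
  have h1 : ∫⁻ ω, ‖X ω‖ₑ ^ 2 ∂μ = ∫⁻ x, ‖x‖ₑ ^ 2 ∂(gaussianReal 0 σ) := by
    rw [← hX.map_eq, lintegral_map' (by fun_prop) hX.aemeasurable]
  have h2 : MemLp (id : ℝ → ℝ) 2 (gaussianReal 0 σ) := memLp_id_gaussianReal 2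
  have h3 : ∫ x, x ^ 2 ∂(gaussianReal 0 σ) = σ := by
    have := variance_id_gaussianReal (μ := 0) (v := σ)
    rw [variance_of_integral_eq_zero (by fun_prop) (by simp)] at this
    simpa using this
  rw [h1]
  have h4 := ofReal_integral_eq_lintegral_ofReal h2.integrable_sq
    (Eventually.of_forall fun x => sq_nonneg _)
  simp only [id] at h4
  rw [h3] at h4
  rw [ENNReal.ofReal_coe_nnreal] at h4
  rw [h4]
  refine lintegral_congr fun x => ?_
  rw [← ofReal_norm, ← ENNReal.ofReal_pow (norm_nonneg _), Real.norm_eq_abs, sq_abs]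

theorem lintegral_enorm_brownian_sq (hW : IsBrownianReal W μ) (t : ℝ≥0) :
    ∫⁻ ω, ‖W t ω‖ₑ ^ 2 ∂μ = t :=
  lintegral_enorm_sq_of_hasLaw_gaussianReal (hW.hasLaw_eval t)

theorem lintegral_enorm_brownian_sub_sq (hW : IsBrownianReal W μ) (s t : ℝ≥0) :
    ∫⁻ ω, ‖W s ω - W t ω‖ₑ ^ 2 ∂μ = nndist s t :=
  lintegral_enorm_sq_of_hasLaw_gaussianReal (hW.hasLaw_sub s t)

end BrownianPath

/-! ### Second moments of integrals over the unit interval -/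

section SecondMoments

variable {X : Type*} [MeasurableSpace X] {μ : Measure X}

theorem eLpNorm_two_sq {E : Type*} [NormedAddCommGroup E] (f : X → E) :
    eLpNorm f 2 μ ^ 2 = ∫⁻ x, ‖f x‖ₑ ^ 2 ∂μ := by
  have := eLpNorm_nnreal_pow_eq_lintegral (f := f) (μ := μ) (p := 2) two_ne_zero
  simpa using this

theorem sq_lintegral_le [IsProbabilityMeasure μ] {f : X → ℝ≥0∞} (hf : AEMeasurable f μ) :
    (∫⁻ x, f x ∂μ) ^ 2 ≤ ∫⁻ x, f x ^ 2 ∂μ := by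
  have h := ENNReal.lintegral_mul_le_Lp_mul_Lq μ Real.HolderConjugate.two_two hf
    (aemeasurable_const (b := (1 : ℝ≥0∞)))
  simp only [Pi.mul_apply, mul_one, lintegral_const, measure_univ,
    ENNReal.rpow_two, one_pow, ENNReal.one_rpow] at h
  calc _ ≤ ((∫⁻ x, f x ^ 2 ∂μ) ^ (1 / (2 : ℝ))) ^ 2 := by gcongr
    _ = _ := by rw [← ENNReal.rpow_natCast, ← ENNReal.rpow_mul]; norm_num

instance isProbabilityMeasure_restrict_Ioc_zero_one :
    IsProbabilityMeasure (volume.restrict (Ioc (0 : ℝ) 1)) := ⟨by simp⟩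

/-- Cauchy–Schwarz on the probability space `(0,1]` moves the square inside the integral, and
Tonelli then allows the second moment to be taken for each `y` separately. -/
theorem eLpNorm_integral_mul_le [SFinite μ] {f : X → ℝ → ℝ}
    (hf : Measurable (Function.uncurry f)) {K : ℝ → ℂ} (hK : Measurable K) {M : ℝ}
    (hM : ∀ y ∈ Ioc (0 : ℝ) 1, ‖K y‖ ≤ M) {B : ℝ≥0∞}
    (hB : ∀ y ∈ Ioc (0 : ℝ) 1, ∫⁻ ω, ‖f ω y‖ₑ ^ 2 ∂μ ≤ B ^ 2) :
    eLpNorm (fun ω => ∫ y in (0 : ℝ)..1, K y * f ω y) 2 μ ≤ ENNReal.ofReal M * B := by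
  refine (ENNReal.pow_le_pow_left_iff two_ne_zero).1 ?_
  have hm : Measurable (Function.uncurry fun (ω : X) (y : ℝ) => K y * (f ω y : ℂ)) := by
    unfold Function.uncurry
    have : Measurable fun p : X × ℝ => f p.1 p.2 := hf
    fun_prop
  rw [eLpNorm_two_sq]
  calc ∫⁻ ω, ‖∫ y in (0 : ℝ)..1, K y * (f ω y : ℂ)‖ₑ ^ 2 ∂μ
      ≤ ∫⁻ ω, (∫⁻ y in Ioc (0 : ℝ) 1, ‖K y * (f ω y : ℂ)‖ₑ ^ 2) ∂μ := by
        refine lintegral_mono fun ω => ?_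
        simp only
        rw [intervalIntegral.integral_of_le zero_le_one]
        refine (pow_le_pow_left' (enorm_integral_le_lintegral_enorm _) 2).trans ?_
        exact sq_lintegral_le (hm.of_uncurry_left.enorm.aemeasurable)
    _ = ∫⁻ y in Ioc (0 : ℝ) 1, ∫⁻ ω, ‖K y * f ω y‖ₑ ^ 2 ∂μ :=
        lintegral_lintegral_swap (f := fun ω y => ‖K y * f ω y‖ₑ ^ 2)
          (hm.enorm.pow_const 2).aemeasurable
    _ ≤ ∫⁻ _ in Ioc (0 : ℝ) 1, (ENNReal.ofReal M * B) ^ 2 := by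
        refine setLIntegral_mono measurable_const fun y hy => ?_
        simp only [enorm_mul, mul_pow]
        rw [lintegral_const_mul' _ _ (by simp)]
        refine mul_le_mul' (pow_le_pow_left' ?_ 2) ?_
        · rw [← ofReal_norm]; exact ENNReal.ofReal_le_ofReal (hM y hy)
        · refine le_of_eq_of_le (lintegral_congr fun ω => ?_) (hB y hy)
          rw [← ofReal_norm, ← ofReal_norm, Complex.norm_real]
    _ = _ := by simp

end SecondMoments

/-! ### Wiener integrals by integration by parts -/

section WienerIntegral

open Filter Topology

variable {Ω : Type*} [MeasurableSpace Ω] {μ : Measure Ω} {W : ℝ≥0 → Ω → ℝ}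

/-- The left endpoint of the interval `[i/n, (i+1)/n)` that contains `y` -/
def gridFloor (n : ℕ) (y : ℝ) : ℝ := ⌊n * y⌋₊ / n

theorem measurable_gridFloor (n : ℕ) : Measurable (gridFloor n) := by
  unfold gridFloor
  fun_prop

/-- Freezing `w` at left grid points turns the integral into a finite sum, ready for Abel summation.
-/
theorem integral_mul_gridFloor {K : ℝ → ℂ} (hK : IntervalIntegrable K volume 0 1) (w : ℝ → ℝ)
    {n : ℕ} (hn : 0 < n) :
    IntervalIntegrable (fun y => K y * w (gridFloor n y)) volume 0 1 ∧
    ∫ y in (0 : ℝ)..1, K y * w (gridFloor n y)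
      = ∑ i ∈ Finset.range n, (∫ y in (i / n : ℝ)..((i + 1 : ℕ) / n : ℝ), K y) * w (i / n) := by
  have hn' : (0 : ℝ) < n := by exact_mod_cast hn
  have hmono : ∀ i : ℕ, (i / n : ℝ) ≤ ((i + 1 : ℕ) / n : ℝ) := fun i => by
    gcongr; exact Nat.le_succ i
  have hle1 : ∀ i ≤ n, (i / n : ℝ) ≤ 1 := fun i hi => by
    rw [div_le_one hn']; exact_mod_cast hi
  have heq : ∀ i : ℕ, ∀ y ∈ Ioo (i / n : ℝ) ((i + 1 : ℕ) / n), gridFloor n y = i / n :=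
    fun i y hy => by
      have h1 := (div_lt_iff₀' hn').1 hy.1
      have h2 := (lt_div_iff₀' hn').1 hy.2
      have : ⌊n * y⌋₊ = i := (Nat.floor_eq_iff (by
        exact (Nat.cast_nonneg i).trans h1.le)).2 ⟨h1.le, by push_cast at h2; exact h2⟩
      rw [gridFloor, this]
  have hKi : ∀ i < n, IntervalIntegrable K volume (i / n) ((i + 1 : ℕ) / n) := fun i hi => by
    refine hK.mono_set ?_
    rw [uIcc_of_le (hmono i), uIcc_of_le zero_le_one]
    exact Icc_subset_Icc (by positivity) (hle1 _ hi)
  have hci : ∀ i : ℕ, (fun y => K y * w (i / n)) =ᵐ[volume.restrict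
      (uIoc (i / n : ℝ) ((i + 1 : ℕ) / n))] fun y => K y * w (gridFloor n y) := fun i => by
    rw [uIoc_of_le (hmono i), ← restrict_Ioo_eq_restrict_Ioc]
    filter_upwards [ae_restrict_mem measurableSet_Ioo] with y hy
    rw [heq i y hy]
  have hii : ∀ i < n, IntervalIntegrable (fun y => K y * w (gridFloor n y)) volume (i / n)
      ((i + 1 : ℕ) / n) := fun i hi => ((hKi i hi).mul_const _).congr_ae (hci i)
  have h0 : ((0 : ℕ) / n : ℝ) = 0 := by simp
  have h1 : (n / n : ℝ) = 1 := div_self hn'.ne'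
  constructor
  · have := IntervalIntegrable.trans_iterate (a := fun i : ℕ => (i / n : ℝ)) hii
    simpa only [h0, h1] using this
  · have := intervalIntegral.sum_integral_adjacent_intervals (a := fun i : ℕ => (i / n : ℝ)) hii
    simp only [h0, h1] at this
    rw [← this]
    refine Finset.sum_congr rfl fun i hi => ?_
    rw [← intervalIntegral.integral_mul_const]
    exact (intervalIntegral.integral_congr_ae_restrict (hci i)).symm

theorem summation_by_parts (G v : ℕ → ℂ) (n : ℕ) :
    ∑ i ∈ Finset.range n, (G (i + 1) - G i) * v i
      = G n * v n - G 0 * v 0 - ∑ i ∈ Finset.range n, G (i + 1) * (v (i + 1) - v i) := by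
  rw [← Finset.sum_range_sub (fun i => G i * v i), ← Finset.sum_sub_distrib]
  exact Finset.sum_congr rfl fun i _ => by ring

/-- The cells `(i/n, (i+1)/n]` are closed on the right, so the index of the cell of `y` is `⌈ny⌉ -
1`. -/
theorem sum_indicator_grid (c : ℕ → ℂ) {n : ℕ} (hn : 0 < n) {y : ℝ} (hy : y ∈ Ioo (0 : ℝ) 1) :
    ∃ i < n, y ∈ Ioc (i / n : ℝ) ((i + 1 : ℕ) / n) ∧
      ∑ j : Fin n, (Ioc (j / n : ℝ) ((j + 1 : ℕ) / n)).indicator (fun _ => c j) y = c i := by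
  have hn' : (0 : ℝ) < n := by exact_mod_cast hn
  have hpos : 0 < ⌈n * y⌉₊ := Nat.ceil_pos.2 (mul_pos hn' hy.1)
  have hmem : ∀ i : ℕ, y ∈ Ioc (i / n : ℝ) ((i + 1 : ℕ) / n) ↔ ⌈n * y⌉₊ = i + 1 := fun i => by
    rw [Nat.ceil_eq_iff (Nat.succ_ne_zero i), mem_Ioc, div_lt_iff₀' hn', le_div_iff₀' hn']
    simp
  obtain ⟨i, hi⟩ : ∃ i, ⌈n * y⌉₊ = i + 1 := ⟨_, (Nat.succ_pred_eq_of_pos hpos).symm⟩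
  have hin : i < n := by
    have : ⌈n * y⌉₊ ≤ n := Nat.ceil_le.2 (by nlinarith [hy.2])
    omega
  refine ⟨i, hin, (hmem i).2 hi, ?_⟩
  rw [Finset.sum_eq_single (⟨i, hin⟩ : Fin n)]
  · exact indicator_of_mem ((hmem i).2 hi) _
  · intro j _ hj
    refine indicator_of_notMem (fun h => hj ?_) _
    have := (hmem j).1 h
    exact Fin.ext (by simp only; omega)
  · simp

/-- Integration by parts: the Wiener integral of a Lipschitz function `G` with `G(1) = 0` and
derivative `K` is `-∫ K W`. -/
theorem isWienerIntegral_of_primitive [IsProbabilityMeasure μ] (hW : IsBrownianReal W μ)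
    {w : Ω → ℝ → ℝ} (hw : Measurable (Function.uncurry w)) (hwc : ∀ ω, Continuous (w ω))
    (hw0 : ∀ ω, w ω 0 = 0) (hwW : ∀ᵐ ω ∂μ, ∀ y : ℝ, w ω y = W y.toNNReal ω)
    {K G : ℝ → ℂ} (hK : Measurable K) {M : ℝ} (hM : ∀ y ∈ Icc (0 : ℝ) 1, ‖K y‖ ≤ M)
    (hG : ∀ a ∈ Icc (0 : ℝ) 1, ∀ b ∈ Icc (0 : ℝ) 1, G b - G a = ∫ y in a..b, K y)
    (hG1 : G 1 = 0) (hGm : Measurable G) :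
    IsWienerIntegral μ W G fun ω => -∫ y in (0 : ℝ)..1, K y * w ω y := by
  have hM0 : 0 ≤ M := (norm_nonneg _).trans (hM 0 (by simp))
  have hM' : ∀ y ∈ Ioc (0 : ℝ) 1, ‖K y‖ ≤ M := fun y hy => hM y (Ioc_subset_Icc_self hy)
  have hKi : IntervalIntegrable K volume 0 1 := by
    rw [intervalIntegrable_iff_integrableOn_Ioc_of_le zero_le_one]
    exact Measure.integrableOn_of_bounded (M := M) (by simp) hK.aestronglyMeasurable
      (by filter_upwards [ae_restrict_mem measurableSet_Ioc] with y hy using hM' y hy)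
  have hLip : ∀ a ∈ Icc (0 : ℝ) 1, ∀ b ∈ Icc (0 : ℝ) 1, ‖G b - G a‖ ≤ M * |b - a| := by
    intro a ha b hb
    rw [hG a ha b hb]
    refine intervalIntegral.norm_integral_le_of_norm_le_const fun y hy => hM y ?_
    exact uIcc_subset_Icc ha hb (uIoc_subset_uIcc hy)
  have hwsq : ∀ s t : ℝ, ∫⁻ ω, ‖w ω s - w ω t‖ₑ ^ 2 ∂μ = nndist s.toNNReal t.toNNReal :=
    fun s t => by
      rw [← lintegral_enorm_brownian_sub_sq hW]
      refine lintegral_congr_ae ?_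
      filter_upwards [hwW] with ω h
      rw [h, h]
  have hnn : ∀ s t : ℝ, (nndist s.toNNReal t.toNNReal : ℝ≥0∞) ≤ ENNReal.ofReal |s - t| :=
    fun s t => by
      rw [← ENNReal.ofReal_coe_nnreal, coe_nndist, NNReal.dist_eq]
      refine ENNReal.ofReal_le_ofReal ?_
      rw [Real.coe_toNNReal', Real.coe_toNNReal']
      exact abs_max_sub_max_le_abs s t 0
  have hwm : Measurable fun p : Ω × ℝ => w p.1 p.2 := hw
  have hIm : StronglyMeasurable fun ω => ∫ y in (0 : ℝ)..1, K y * w ω y := by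
    refine stronglyMeasurable_intervalIntegral (Measurable.stronglyMeasurable ?_) (by fun_prop)
      (by fun_prop)
    unfold Function.uncurry
    fun_prop
  refine ⟨?_, ?_, fun ε hε => ?_⟩
  · refine MemLp.of_bound hGm.aestronglyMeasurable M ?_
    filter_upwards [ae_restrict_mem measurableSet_Ioo] with y hy
    have := hLip 1 (by simp) y (Ioo_subset_Icc_self hy)
    rw [hG1, sub_zero] at this
    refine this.trans (mul_le_of_le_one_right hM0 ?_)
    rw [abs_le]; constructor <;> linarith [hy.1, hy.2]
  · refine MemLp.neg ⟨hIm.aestronglyMeasurable, ?_⟩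
    refine (eLpNorm_integral_mul_le hw hK hM' (B := 1) fun y hy => ?_).trans_lt
      (by simp)
    have := (hwsq y 0).le.trans (hnn y 0)
    simp only [hw0, sub_zero] at this
    refine this.trans ?_
    rw [abs_of_pos hy.1, one_pow]
    exact ENNReal.ofReal_le_one.2 hy.2
  -- On a grid of mesh `1/n`, the step functions are within `M/n` of `G`, and their integrals within
  -- `M √(1/n)` of the limit; `n = m + 1` makes both at most `ε`.
  · have hlim1 : Tendsto (fun n : ℕ => ENNReal.ofReal (M * (1 / ((n : ℝ) + 1)))) atTop (𝓝 0) := by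
      rw [← ENNReal.ofReal_zero]
      refine ENNReal.tendsto_ofReal ?_
      simpa using tendsto_one_div_add_atTop_nhds_zero_nat.const_mul M
    have hlim2 : Tendsto (fun n : ℕ => ENNReal.ofReal (M * √(1 / ((n : ℝ) + 1)))) atTop (𝓝 0) := by
      rw [← ENNReal.ofReal_zero]
      refine ENNReal.tendsto_ofReal ?_
      have := (Real.continuous_sqrt.tendsto 0).comp
        (tendsto_one_div_add_atTop_nhds_zero_nat (𝕜 := ℝ))
      rw [Real.sqrt_zero] at this
      simpa using this.const_mul M
    obtain ⟨m, hm1, hm2⟩ := ((ENNReal.tendsto_nhds_zero.1 hlim1 ε hε).and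
      (ENNReal.tendsto_nhds_zero.1 hlim2 ε hε)).exists
    set n := m + 1 with hn
    have hn0 : 0 < n := m.succ_pos
    have hn' : (0 : ℝ) < n := by exact_mod_cast hn0
    have hmn : (m : ℝ) + 1 = n := by rw [hn]; push_cast; rfl
    rw [hmn] at hm1 hm2
    have hgrid : ∀ i ≤ n, (i / n : ℝ) ∈ Icc (0 : ℝ) 1 := fun i hi =>
      ⟨by positivity, by rw [div_le_one hn']; exact_mod_cast hi⟩
    -- Taking the value of `G` at the right endpoint makes Abel summation produce `w` at the left
    -- endpoint, as in `gridFloor`.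
    refine ⟨n, fun i => (i / n : ℝ≥0), fun i => ((i + 1 : ℕ) / n : ℝ≥0),
      fun i => G ((i + 1 : ℕ) / n), fun i => ⟨?_, ?_⟩, ?_, ?_⟩
    · simp only
      gcongr; exact Nat.le_succ _
    · rw [div_le_one (by exact_mod_cast hn0)]
      exact_mod_cast i.2
    · refine (eLpNorm_le_of_ae_bound (C := M * (1 / n)) ?_).trans ?_
      · filter_upwards [ae_restrict_mem measurableSet_Ioo] with y hy
        obtain ⟨i, hi, hyi, hsum⟩ := sum_indicator_grid
          (fun i : ℕ => G ((i + 1 : ℕ) / n)) hn0 hy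
        have hc : ∀ i : Fin n, (((i / n : ℝ≥0) : ℝ)) = (i / n : ℝ) := fun i => by simp
        have hc' : ∀ i : Fin n, ((((i + 1 : ℕ) / n : ℝ≥0) : ℝ)) = ((i + 1 : ℕ) / n : ℝ) :=
          fun i => by simp
        simp only [hc, hc']
        rw [hsum]
        refine (hLip _ (hgrid _ hi) y (Ioo_subset_Icc_self hy)).trans
          (mul_le_mul_of_nonneg_left ?_ hM0)
        rw [abs_sub_comm, abs_of_nonneg (sub_nonneg.2 hyi.2)]
        have : ((i + 1 : ℕ) / n : ℝ) = i / n + 1 / n := by push_cast; ring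
        linarith [hyi.1]
      · simpa using hm1
    -- By Abel summation the step integral is `-∑ (G_{i+1} - G_i) w(i/n)`: the boundary terms vanish
    -- because `G(1) = 0` and `w(0) = 0`. This sum is `-∫ K · w(gridFloor)`.
    · have key : ∀ᵐ ω ∂μ, (-∫ y in (0 : ℝ)..1, K y * w ω y)
          - ∑ i : Fin n, G ((i + 1 : ℕ) / n) * ((W ((i + 1 : ℕ) / n : ℝ≥0) ω
            - W (i / n : ℝ≥0) ω : ℝ) : ℂ)
          = -∫ y in (0 : ℝ)..1, K y * ((w ω y - w ω (gridFloor n y) : ℝ) : ℂ) := by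
        filter_upwards [hwW] with ω hω
        have hWw : ∀ t : ℝ≥0, W t ω = w ω t := fun t => by rw [hω, Real.toNNReal_coe]
        obtain ⟨hi1, hi2⟩ := integral_mul_gridFloor hKi (w ω) hn0
        have hsub : ∫ y in (0 : ℝ)..1, K y * ((w ω y - w ω (gridFloor n y) : ℝ) : ℂ)
            = (∫ y in (0 : ℝ)..1, K y * w ω y) - ∫ y in (0 : ℝ)..1, K y * w ω (gridFloor n y) := by
          rw [← intervalIntegral.integral_sub _ hi1]
          · simp only [Complex.ofReal_sub, mul_sub]
          · exact hKi.mul_continuousOn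
              (Complex.continuous_ofReal.comp (hwc ω)).continuousOn
        rw [hsub, hi2]
        have hsum : ∑ i ∈ Finset.range n, (∫ y in (i / n : ℝ)..((i + 1 : ℕ) / n : ℝ), K y)
              * w ω (i / n)
            = ∑ i ∈ Finset.range n, (G ((i + 1 : ℕ) / n) - G ((i : ℕ) / n)) * w ω (i / n) := by
          refine Finset.sum_congr rfl fun i hi => ?_
          have hi' := Finset.mem_range.1 hi
          rw [hG _ (hgrid i hi'.le) _ (hgrid (i + 1) hi')]
        rw [hsum, summation_by_parts (fun i : ℕ => G ((i : ℕ) / n)) (fun i : ℕ => (w ω (i / n) : ℂ)),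
          Finset.sum_range]
        simp only [hWw]
        have hn1 : (n / n : ℝ) = 1 := div_self hn'.ne'
        have hsum2 : ∀ i : Fin n, G ((i + 1 : ℕ) / n) * ((w ω (((i + 1 : ℕ) / n : ℝ≥0) : ℝ)
            - w ω ((i / n : ℝ≥0) : ℝ) : ℝ) : ℂ)
            = G ((i + 1 : ℕ) / n) * ((w ω ((i + 1 : ℕ) / n) : ℂ) - w ω (i / n)) := fun i => by
          simp
        rw [Finset.sum_congr rfl fun i _ => hsum2 i]
        simp only [hn1, hG1, Nat.cast_zero, zero_div, hw0]
        push_cast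
        ring
      rw [eLpNorm_congr_ae key]
      rw [← Pi.neg_def, eLpNorm_neg]
      refine (eLpNorm_integral_mul_le (f := fun ω y => w ω y - w ω (gridFloor n y)) ?_ hK hM'
        (B := ENNReal.ofReal √(1 / n)) fun y hy => ?_).trans ?_
      · have := measurable_gridFloor n
        unfold Function.uncurry
        have h2 : Measurable fun p : Ω × ℝ => w p.1 (gridFloor n p.2) :=
          hwm.comp (f := fun p : Ω × ℝ => (p.1, gridFloor n p.2)) (by fun_prop)
        fun_prop
      -- Within a grid cell the Brownian increment has variance at most `1/n`.
      · refine ((hwsq _ _).le.trans (hnn _ _)).trans ?_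
        rw [← ENNReal.ofReal_pow (Real.sqrt_nonneg _), Real.sq_sqrt (by positivity)]
        refine ENNReal.ofReal_le_ofReal ?_
        have h1 := Nat.floor_le (mul_nonneg hn'.le hy.1.le)
        have h2 := Nat.lt_floor_add_one (n * y)
        rw [gridFloor, abs_of_nonneg]
        · rw [sub_le_iff_le_add, ← add_div, le_div_iff₀ hn']; linarith
        · rw [sub_nonneg, div_le_iff₀ hn']; linarith
      · rw [← ENNReal.ofReal_mul hM0]; exact hm2

end WienerIntegral

/-! ### The Green function and its Wiener integral -/

section Green

open Filter Topology

variable {α : ℝ}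

/-- With `m = min x y` and `M = max x y`, the four exponentials factor into the Neumann solution at
`0` times the Dirichlet solution at `1`, using `1 + e^{2r} = 2 e^r cosh r`. -/
theorem green_closed_form {r : ℂ} (hr0 : r ≠ 0) (hc : Complex.cosh r ≠ 0) (m M : ℂ) :
    (Complex.exp (r * (m + M)) + Complex.exp (r * (M - m)) - Complex.exp (r * (2 - m - M))
      - Complex.exp (r * (2 - (M - m)))) / (2 * r * (1 + Complex.exp (2 * r)))
      = -(Complex.cosh (r * m) * Complex.sinh (r * (1 - M)) / (r * Complex.cosh r)) := by
  have hE := Complex.exp_ne_zero r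
  have hA := Complex.exp_ne_zero (r * m)
  have hB := Complex.exp_ne_zero (r * M)
  have e1 : Complex.exp (r * (m + M)) = Complex.exp (r * m) * Complex.exp (r * M) := by
    rw [← Complex.exp_add]; ring_nf
  have e2 : Complex.exp (r * (M - m)) = Complex.exp (r * M) / Complex.exp (r * m) := by
    rw [← Complex.exp_sub]; ring_nf
  have e3 : Complex.exp (r * (2 - m - M))
      = Complex.exp r * Complex.exp r / (Complex.exp (r * m) * Complex.exp (r * M)) := by
    rw [← Complex.exp_add, ← Complex.exp_add, ← Complex.exp_sub]; ring_nf
  have e4 : Complex.exp (r * (2 - (M - m)))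
      = Complex.exp r * Complex.exp r * Complex.exp (r * m) / Complex.exp (r * M) := by
    rw [← Complex.exp_add, ← Complex.exp_add, ← Complex.exp_sub]; ring_nf
  have e5 : Complex.exp (2 * r) = Complex.exp r * Complex.exp r := by
    rw [← Complex.exp_add]; ring_nf
  have e6 : Complex.exp (r * (1 - M)) = Complex.exp r / Complex.exp (r * M) := by
    rw [← Complex.exp_sub]; ring_nf
  have hc' : 1 + Complex.exp r * Complex.exp r ≠ 0 := by
    intro h
    apply hc
    rw [Complex.cosh, Complex.exp_neg]
    field_simp
    linear_combination h
  rw [e1, e2, e3, e4, e5]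
  simp only [Complex.cosh, Complex.sinh, Complex.exp_neg, e6]
  field_simp
  ring

/-- `∂_y` of the Green function of `∂_xx - r²` -/
def greenDy (x : ℝ) (r : ℂ) (y : ℝ) : ℂ :=
  if y < x then -(Complex.sinh (r * (1 - x)) * Complex.sinh (r * y) / Complex.cosh r)
  else Complex.cosh (r * x) * Complex.cosh (r * (1 - y)) / Complex.cosh r

theorem measurable_greenDy (x : ℝ) (r : ℂ) : Measurable (greenDy x r) := by
  refine Measurable.ite measurableSet_Iio ?_ ?_
  · exact Continuous.measurable (by fun_prop)
  · exact Continuous.measurable (by fun_prop)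

theorem exists_bound_greenDy (x : ℝ) (r : ℂ) : ∃ M, ∀ y ∈ Icc (0 : ℝ) 1, ‖greenDy x r y‖ ≤ M := by
  obtain ⟨M₁, h₁⟩ := (isCompact_Icc (a := (0 : ℝ)) (b := 1)).exists_bound_of_continuousOn
    (f := fun y : ℝ => -(Complex.sinh (r * (1 - x)) * Complex.sinh (r * y) / Complex.cosh r))
    (by fun_prop)
  obtain ⟨M₂, h₂⟩ := (isCompact_Icc (a := (0 : ℝ)) (b := 1)).exists_bound_of_continuousOn
    (f := fun y : ℝ => Complex.cosh (r * x) * Complex.cosh (r * (1 - y)) / Complex.cosh r)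
    (by fun_prop)
  refine ⟨max M₁ M₂, fun y hy => ?_⟩
  unfold greenDy
  split_ifs
  · exact (h₁ y hy).trans (le_max_left _ _)
  · exact (h₂ y hy).trans (le_max_right _ _)

theorem iPow_zero_right (β : ℝ) : iPow β 0 = 0 := by simp [iPow]

theorem iPow_ne_zero {β ω : ℝ} (hω : ω ≠ 0) : iPow β ω ≠ 0 := by
  rw [iPow, if_neg hω]
  refine mul_ne_zero ?_ (Complex.exp_ne_zero _)
  exact_mod_cast (Real.rpow_pos_of_pos (abs_pos.2 hω) _).ne'

theorem green_eq (hα0 : 0 < α) (hα1 : α < 1) {ω : ℝ} (hω : ω ≠ 0) (x y : ℝ) :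
    green α ω x y = -(Complex.cosh (iPow (α / 2) ω * (min x y : ℝ))
      * Complex.sinh (iPow (α / 2) ω * (1 - (max x y : ℝ)))
        / (iPow (α / 2) ω * Complex.cosh (iPow (α / 2) ω))) := by
  rw [← green_closed_form (iPow_ne_zero hω)
    (cosh_ne_zero_of_mem_sector (iPow_mem_sector hα0 hα1 ω)), green, if_neg hω]
  have h1 : x + y = min x y + max x y := (min_add_max x y).symm
  have h2 : |x - y| = max x y - min x y := (max_sub_min_eq_abs' x y).symm
  have h3 : 2 - x - y = 2 - min x y - max x y := by linarith
  rw [h1, h2, h3]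
  push_cast
  ring_nf

theorem continuous_green (hα0 : 0 < α) (hα1 : α < 1) (ω x : ℝ) :
    Continuous fun y => green α ω x y := by
  by_cases hω : ω = 0
  · simp only [green, hω, if_true]; fun_prop
  · simp only [green_eq hα0 hα1 hω]; fun_prop

theorem green_one (hα0 : 0 < α) (hα1 : α < 1) (ω : ℝ) {x : ℝ} (hx : x ≤ 1) :
    green α ω x 1 = 0 := by
  by_cases hω : ω = 0
  · simp [green, hω, hx]
  · simp [green_eq hα0 hα1 hω, hx]

/-- At zero frequency `r = 0` and `greenDy` takes the values `0` and `1`, the slopes of `max x y -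
1`, so one formula serves all frequencies. The corner `y = x` is the only exception. -/
theorem hasDerivAt_green (hα0 : 0 < α) (hα1 : α < 1) (ω : ℝ) {x y : ℝ} (hy : y ≠ x) :
    HasDerivAt (fun y => green α ω x y) (greenDy x (iPow (α / 2) ω) y) y := by
  by_cases hω : ω = 0
  · rcases hy.lt_or_gt with h | h
    · have : (fun y => green α ω x y) =ᶠ[𝓝 y] fun _ => ((x - 1 : ℝ) : ℂ) := by
        filter_upwards [Iio_mem_nhds h] with z hz
        simp [green, hω, max_eq_left (mem_Iio.1 hz).le]
      refine ((hasDerivAt_const y _).congr_of_eventuallyEq this).congr_deriv ?_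
      simp [greenDy, h, hω, iPow_zero_right]
    · have : (fun y => green α ω x y) =ᶠ[𝓝 y] fun y => ((y - 1 : ℝ) : ℂ) := by
        filter_upwards [Ioi_mem_nhds h] with z hz
        simp [green, hω, max_eq_right (mem_Ioi.1 hz).le]
      refine (((hasDerivAt_id y).sub_const 1).ofReal_comp.congr_of_eventuallyEq this).congr_deriv ?_
      simp [greenDy, h.not_gt, hω, iPow_zero_right]
  · set r := iPow (α / 2) ω with hr
    have hr0 : r ≠ 0 := iPow_ne_zero hω
    have hc : Complex.cosh r ≠ 0 := cosh_ne_zero_of_mem_sector (iPow_mem_sector hα0 hα1 ω)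
    rcases hy.lt_or_gt with h | h
    · have : (fun y => green α ω x y) =ᶠ[𝓝 y] fun y =>
          -(Complex.cosh (r * y) * Complex.sinh (r * (1 - x)) / (r * Complex.cosh r)) := by
        filter_upwards [Iio_mem_nhds h] with z hz
        rw [green_eq hα0 hα1 hω, max_eq_left (le_of_lt hz), min_eq_right (le_of_lt hz)]
      refine (((((hasDerivAt_ofReal_mul r y).comp_ccosh).mul_const _).div_const _).neg
        |>.congr_of_eventuallyEq this).congr_deriv ?_
      rw [greenDy, if_pos h]
      field_simp
    · have : (fun y => green α ω x y) =ᶠ[𝓝 y] fun y : ℝ =>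
          -(Complex.cosh (r * x) * Complex.sinh (r * (1 - y)) / (r * Complex.cosh r)) := by
        filter_upwards [Ioi_mem_nhds h] with z hz
        rw [green_eq hα0 hα1 hω, max_eq_right (le_of_lt hz), min_eq_left (le_of_lt hz)]
      refine (((((hasDerivAt_mul_one_sub r y).comp_csinh).const_mul _).div_const _).neg
        |>.congr_of_eventuallyEq this).congr_deriv ?_
      rw [greenDy, if_neg h.not_gt]
      field_simp

theorem intervalIntegrable_greenDy (x : ℝ) (r : ℂ) {a b : ℝ} (ha : a ∈ Icc (0 : ℝ) 1)
    (hb : b ∈ Icc (0 : ℝ) 1) : IntervalIntegrable (greenDy x r) volume a b := by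
  obtain ⟨M, hM⟩ := exists_bound_greenDy x r
  rw [intervalIntegrable_iff]
  refine Measure.integrableOn_of_bounded (M := M) (by simp)
    (measurable_greenDy x r).aestronglyMeasurable ?_
  filter_upwards [ae_restrict_mem measurableSet_uIoc] with y hy
  exact hM y (uIcc_subset_Icc ha hb (uIoc_subset_uIcc hy))

/-- The fundamental theorem of calculus tolerates the single corner, since the Green function is
continuous there. -/
theorem green_sub (hα0 : 0 < α) (hα1 : α < 1) (ω x : ℝ) {a b : ℝ} (ha : a ∈ Icc (0 : ℝ) 1)
    (hb : b ∈ Icc (0 : ℝ) 1) :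
    green α ω x b - green α ω x a = ∫ y in a..b, greenDy x (iPow (α / 2) ω) y :=
  (MeasureTheory.integral_eq_of_hasDerivAt_off_countable (fun y => green α ω x y) _
    (countable_singleton x) (continuous_green hα0 hα1 ω x).continuousOn
    (fun _ hy => hasDerivAt_green hα0 hα1 ω hy.2) (intervalIntegrable_greenDy x _ ha hb)).symm

/-- Splitting at `y = x` and reflecting the right part gives the two integrals in `mode`. This is
the link between the Wiener integral and the pathwise solution. -/
theorem integral_greenDy_mul {w : ℝ → ℝ} (hw : Continuous w) {x : ℝ} (hx : x ∈ Icc (0 : ℝ) 1)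
    (r : ℂ) : ∫ y in (0 : ℝ)..1, greenDy x r y * w y = mode w x r := by
  have hi : ∀ {a b : ℝ}, a ∈ Icc (0 : ℝ) 1 → b ∈ Icc (0 : ℝ) 1 →
      IntervalIntegrable (fun y => greenDy x r y * w y) volume a b := fun ha hb =>
    (intervalIntegrable_greenDy x r ha hb).mul_continuousOn
      (Complex.continuous_ofReal.comp hw).continuousOn
  rw [← intervalIntegral.integral_add_adjacent_intervals (hi (by simp) hx) (hi hx (by simp))]
  have h1 : ∫ y in (0 : ℝ)..x, greenDy x r y * w y
      = ∫ y in (0 : ℝ)..x, -(Complex.sinh (r * (1 - x)) / Complex.cosh r)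
        * (Complex.sinh (r * y) * w y) := by
    refine intervalIntegral.integral_congr_ae_restrict ?_
    rw [uIoc_of_le hx.1, ← restrict_Ioo_eq_restrict_Ioc]
    filter_upwards [ae_restrict_mem measurableSet_Ioo] with y hy
    rw [greenDy, if_pos hy.2]; ring
  have h2 : ∫ y in x..1, greenDy x r y * w y
      = ∫ y in x..1, Complex.cosh (r * x) / Complex.cosh r
        * (Complex.cosh (r * (1 - y : ℝ)) * w (1 - (1 - y))) := by
    refine intervalIntegral.integral_congr_ae_restrict ?_
    rw [uIoc_of_le hx.2]
    filter_upwards [ae_restrict_mem measurableSet_Ioc] with y hy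
    rw [greenDy, if_neg hy.1.not_gt, sub_sub_cancel]
    push_cast; ring
  rw [h1, h2, intervalIntegral.integral_const_mul, intervalIntegral.integral_const_mul,
    intervalIntegral.integral_comp_sub_left
      (fun y => Complex.cosh (r * (y : ℝ)) * (w (1 - y) : ℂ)), sub_self, mode, sinhInt, coshInt]
  ring

/-- The Wiener integral of the Green function -/
theorem isWienerIntegral_green {Ω : Type*} [MeasurableSpace Ω] {μ : Measure Ω}
    {W : ℝ≥0 → Ω → ℝ} [IsProbabilityMeasure μ] (hW : IsBrownianReal W μ)
    {w : Ω → ℝ → ℝ} (hw : Measurable (Function.uncurry w)) (hwc : ∀ ω, Continuous (w ω))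
    (hw0 : ∀ ω, w ω 0 = 0) (hwW : ∀ᵐ ω ∂μ, ∀ y : ℝ, w ω y = W y.toNNReal ω)
    (hα0 : 0 < α) (hα1 : α < 1) {x : ℝ} (hx : x ∈ Icc (0 : ℝ) 1) (ξ : ℝ) :
    IsWienerIntegral μ W (fun y => green α ξ x y) fun ω => -mode (w ω) x (iPow (α / 2) ξ) := by
  obtain ⟨M, hM⟩ := exists_bound_greenDy x (iPow (α / 2) ξ)
  have := isWienerIntegral_of_primitive hW hw hwc hw0 hwW (measurable_greenDy x _) hM
    (G := fun y => green α ξ x y) (fun a ha b hb => green_sub hα0 hα1 ξ x ha hb)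
    (green_one hα0 hα1 ξ hx.2) (continuous_green hα0 hα1 ξ x).measurable
  simpa only [integral_greenDy_mul (hwc _) hx] using this

end Green

/-! ### Existence, the energy estimate and the frequency-domain solution -/

section TimeSolution

open Filter Topology

/-- `w` is a jointly measurable modification of `W` (extended to negative arguments), with
continuous paths starting at zero. -/
structure IsPathModification {Ω : Type*} [MeasurableSpace Ω] (μ : Measure Ω) (W : ℝ≥0 → Ω → ℝ)
    (w : Ω → ℝ → ℝ) : Prop where
  measurable : Measurable (Function.uncurry w)
  continuous : ∀ ω, Continuous (w ω)
  zero : ∀ ω, w ω 0 = 0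
  ae_eq : ∀ᵐ ω ∂μ, ∀ y : ℝ, w ω y = W y.toNNReal ω

variable {Ω : Type*} [MeasurableSpace Ω] {μ : Measure Ω} [IsProbabilityMeasure μ]
  {W : ℝ≥0 → Ω → ℝ} {w : Ω → ℝ → ℝ} {α : ℝ} {F F' : ℝ → ℂ}

theorem ofReal_integral_norm_sq {X : Type*} [MeasurableSpace X] {ν : Measure X} {f : X → ℂ}
    (hf : MemLp f 2 ν) : ENNReal.ofReal (∫ x, ‖f x‖ ^ 2 ∂ν) = ∫⁻ x, ‖f x‖ₑ ^ 2 ∂ν := by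
  rw [ofReal_integral_eq_lintegral_ofReal (hf.integrable_norm_pow two_ne_zero)
    (Eventually.of_forall fun x => sq_nonneg _)]
  refine lintegral_congr fun x => ?_
  rw [ENNReal.ofReal_pow (norm_nonneg _), ofReal_norm]

theorem h1NormSq_nonneg : 0 ≤ h1NormSq F F' :=
  add_nonneg (integral_nonneg fun _ => sq_nonneg _) (integral_nonneg fun _ => sq_nonneg _)

theorem IsH1HalfLine.eLpNorm_add_sq_le (hF : IsH1HalfLine F F') :
    eLpNorm (fun t => F t + F' t) 2 (volume.restrict (Ioi (0 : ℝ))) ^ 2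
      ≤ ENNReal.ofReal (2 * h1NormSq F F') := by
  have hs : MemLp (fun t => F t + F' t) 2 (volume.restrict (Ioi (0 : ℝ))) :=
    hF.memLp.add hF.memLp_deriv
  have i1 := hF.memLp.integrable_norm_pow two_ne_zero
  have i2 := hF.memLp_deriv.integrable_norm_pow two_ne_zero
  rw [eLpNorm_two_sq, ← ofReal_integral_norm_sq hs]
  refine ENNReal.ofReal_le_ofReal ?_
  rw [h1NormSq, ← integral_add i1 i2, ← integral_const_mul]
  refine integral_mono (hs.integrable_norm_pow two_ne_zero) ((i1.add i2).const_mul 2) fun t => ?_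
  have := norm_add_le (F t) (F' t)
  simp only
  nlinarith [norm_nonneg (F t + F' t), sq_nonneg (‖F t‖ - ‖F' t‖), norm_nonneg (F t),
    norm_nonneg (F' t)]

theorem lintegral_sq_integral_abs_le (hW : IsBrownianReal W μ) (hw : IsPathModification μ W w) :
    ∫⁻ ω, ENNReal.ofReal (∫ y in (0 : ℝ)..1, |w ω y|) ^ 2 ∂μ ≤ 1 := by
  have hm := hw.measurable
  calc ∫⁻ ω, ENNReal.ofReal (∫ y in (0 : ℝ)..1, |w ω y|) ^ 2 ∂μ
      ≤ ∫⁻ ω, (∫⁻ y in Ioc (0 : ℝ) 1, ‖w ω y‖ₑ ^ 2) ∂μ := by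
        refine lintegral_mono fun ω => ?_
        rw [intervalIntegral.integral_of_le zero_le_one]
        refine le_trans (pow_le_pow_left' ?_ 2)
          (sq_lintegral_le (hw.continuous ω).measurable.enorm.aemeasurable)
        refine (Real.ofReal_le_enorm _).trans
          ((enorm_integral_le_lintegral_enorm _).trans_eq ?_)
        exact lintegral_congr fun y => by rw [← ofReal_norm, ← ofReal_norm, norm_abs_eq_norm]
    _ = ∫⁻ y in Ioc (0 : ℝ) 1, ∫⁻ ω, ‖w ω y‖ₑ ^ 2 ∂μ :=
        lintegral_lintegral_swap (f := fun ω y => ‖w ω y‖ₑ ^ 2) (hm.enorm.pow_const 2).aemeasurable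
    _ ≤ ∫⁻ _ in Ioc (0 : ℝ) 1, 1 := by
        refine setLIntegral_mono measurable_const fun y hy => ?_
        have : ∫⁻ ω, ‖w ω y‖ₑ ^ 2 ∂μ = y.toNNReal := by
          rw [← lintegral_enorm_brownian_sq hW]
          refine lintegral_congr_ae ?_
          filter_upwards [hw.ae_eq] with ω h
          rw [h]
        rw [this]
        exact_mod_cast Real.toNNReal_le_one.2 hy.2
    _ = 1 := by simp

/-- `18 = 3² · 2`: the constant `3` is that of the symbol bound, and `2` comes from `|F + F'|² ≤
2(|F|² + |F'|²)`. The random factor `(∫|w|)²` has mean at most `1`. -/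
theorem lintegral_pathSolDt_le (hW : IsBrownianReal W μ) (hw : IsPathModification μ W w)
    (hα0 : 0 < α) (hα1 : α < 1) (hF : IsH1HalfLine F F') (h0 : F 0 = 0) :
    ∫⁻ ω, (∫⁻ x in Ioo (0 : ℝ) 1, ∫⁻ t in Ioi (0 : ℝ), ‖pathSolDt α F (w ω) x t‖ₑ ^ 2) ∂μ
      ≤ ENNReal.ofReal (18 * h1NormSq F F') := by
  calc ∫⁻ ω, (∫⁻ x in Ioo (0 : ℝ) 1, ∫⁻ t in Ioi (0 : ℝ), ‖pathSolDt α F (w ω) x t‖ₑ ^ 2) ∂μ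
      ≤ ∫⁻ ω, ENNReal.ofReal (18 * h1NormSq F F')
          * ENNReal.ofReal (∫ y in (0 : ℝ)..1, |w ω y|) ^ 2 ∂μ := by
        refine lintegral_mono fun ω => ?_
        refine (setLIntegral_mono measurable_const fun x hx => ?_).trans_eq
          (b := ∫⁻ _ in Ioo (0 : ℝ) 1, ENNReal.ofReal (18 * h1NormSq F F')
            * ENNReal.ofReal (∫ y in (0 : ℝ)..1, |w ω y|) ^ 2) (by simp)
        rw [← eLpNorm_two_sq]
        refine (pow_le_pow_left' (pathSol_weakDeriv hα0 hα1 hF h0 (hw.continuous ω)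
          (Ioo_subset_Icc_self hx)).2.1 2).trans ?_
        rw [mul_pow, ENNReal.ofReal_mul (by norm_num), mul_pow,
          show (18 : ℝ) * h1NormSq F F' = 3 ^ 2 * (2 * h1NormSq F F') by ring,
          ENNReal.ofReal_mul (by positivity), ← ENNReal.ofReal_pow (by norm_num)]
        calc _ ≤ ENNReal.ofReal (3 ^ 2) * ENNReal.ofReal (∫ y in (0 : ℝ)..1, |w ω y|) ^ 2
              * ENNReal.ofReal (2 * h1NormSq F F') := by
              gcongr; exact hF.eLpNorm_add_sq_le
          _ = _ := by ring
    _ = ENNReal.ofReal (18 * h1NormSq F F')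
          * ∫⁻ ω, ENNReal.ofReal (∫ y in (0 : ℝ)..1, |w ω y|) ^ 2 ∂μ :=
        lintegral_const_mul' _ _ ENNReal.ofReal_ne_top
    _ ≤ ENNReal.ofReal (18 * h1NormSq F F') * 1 := by
        gcongr; exact lintegral_sq_integral_abs_le hW hw
    _ = _ := mul_one _

theorem memLp_pathSolDt (hW : IsBrownianReal W μ) (hw : IsPathModification μ W w)
    (hα0 : 0 < α) (hα1 : α < 1) (hF : IsH1HalfLine F F') (h0 : F 0 = 0) :
    MemLp (fun p : (ℝ × ℝ) × Ω => pathSolDt α F (w p.2) p.1.1 p.1.2) 2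
      (((volume.restrict (Ioo (0 : ℝ) 1)).prod (volume.restrict (Ioi (0 : ℝ)))).prod μ) := by
  have hm := stronglyMeasurable_pathSolDt (F := F) hw.measurable hα0
  refine ⟨hm.aestronglyMeasurable, ?_⟩
  have h2 : eLpNorm (fun p : (ℝ × ℝ) × Ω => pathSolDt α F (w p.2) p.1.1 p.1.2) 2
      (((volume.restrict (Ioo (0 : ℝ) 1)).prod (volume.restrict (Ioi (0 : ℝ)))).prod μ) ^ 2
      < ∞ := by
    rw [eLpNorm_two_sq, lintegral_prod_symm _ (hm.enorm.pow_const 2).aemeasurable]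
    refine lt_of_eq_of_lt (lintegral_congr fun ω => ?_)
      ((lintegral_pathSolDt_le hW hw hα0 hα1 hF h0).trans_lt ENNReal.ofReal_lt_top)
    refine lintegral_prod _ (Measurable.aemeasurable ?_)
    exact (hm.comp_measurable (g := fun q : ℝ × ℝ => (q, ω)) (by fun_prop)).enorm.pow_const 2
  exact (ENNReal.pow_lt_top_iff.1 h2).resolve_right two_ne_zero

theorem integral_pathSolDt_le (hW : IsBrownianReal W μ) (hw : IsPathModification μ W w)
    (hα0 : 0 < α) (hα1 : α < 1) (hF : IsH1HalfLine F F') (h0 : F 0 = 0) :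
    ∫ ω, (∫ t in Ioi (0 : ℝ), ∫ x in Ioo (0 : ℝ) 1, ‖pathSolDt α F (w ω) x t‖ ^ 2) ∂μ
      ≤ 18 * h1NormSq F F' := by
  have hm := stronglyMeasurable_pathSolDt (F := F) hw.measurable hα0
  -- Each Bochner integral is dominated by a Lebesgue integral of norms, so the estimate needs no
  -- integrability of the inner integrals.
  have hle : ‖∫ ω, (∫ t in Ioi (0 : ℝ), ∫ x in Ioo (0 : ℝ) 1,
      ‖pathSolDt α F (w ω) x t‖ ^ 2) ∂μ‖ₑ ≤ ENNReal.ofReal (18 * h1NormSq F F') := by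
    refine le_trans ?_ (lintegral_pathSolDt_le hW hw hα0 hα1 hF h0)
    refine (enorm_integral_le_lintegral_enorm _).trans (lintegral_mono fun ω => ?_)
    refine (enorm_integral_le_lintegral_enorm _).trans
      ((lintegral_mono fun t => (enorm_integral_le_lintegral_enorm _)).trans_eq ?_)
    refine (lintegral_lintegral_swap (Measurable.aemeasurable ?_)).trans ?_
    · exact ((hm.comp_measurable (g := fun q : ℝ × ℝ => ((q.2, q.1), ω))
        (by fun_prop)).norm.measurable.pow_const 2).enorm
    · simp
  have hnn : 0 ≤ 18 * h1NormSq F F' := mul_nonneg (by norm_num) h1NormSq_nonneg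
  rw [← ofReal_norm, ENNReal.ofReal_le_ofReal_iff hnn] at hle
  exact (le_abs_self _).trans hle

theorem ae_prod_of_forall_ae {X Y : Type*} [MeasurableSpace X] [MeasurableSpace Y]
    {μ : Measure X} {ν : Measure Y} [SFinite μ] [SFinite ν] {p : X × Y → Prop}
    (hp : MeasurableSet {q | p q})
    (h : ∀ᵐ y ∂ν, ∀ᵐ x ∂μ, p (x, y)) : ∀ᵐ q ∂(μ.prod ν), p q := by
  rw [ae_iff, show {q | ¬ p q} = {q | p q}ᶜ from rfl, Measure.prod_apply_symm hp.compl,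
    lintegral_eq_zero_iff' (measurable_measure_prodMk_right hp.compl).aemeasurable]
  filter_upwards [h] with y hy
  exact ae_iff.1 hy

/-- Clamping the rationals to `[0,1]` gives a countable set of test points that includes the
endpoints. -/
theorem eq_of_continuousOn_of_rat {f g : ℝ → ℂ} (hf : ContinuousOn f (Icc 0 1))
    (hg : ContinuousOn g (Icc 0 1))
    (h : ∀ q : ℚ, f (max 0 (min 1 (q : ℝ))) = g (max 0 (min 1 (q : ℝ)))) :
    EqOn f g (Icc 0 1) := by
  have hc : Continuous fun x : ℝ => max 0 (min 1 x) := by fun_prop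
  have hmem : ∀ x : ℝ, max 0 (min 1 x) ∈ Icc (0 : ℝ) 1 := fun x =>
    ⟨le_max_left _ _, max_le zero_le_one (min_le_left _ _)⟩
  have := Rat.denseRange_cast.equalizer (hf.comp_continuous hc hmem)
    (hg.comp_continuous hc hmem) (funext h)
  intro x hx
  simpa [hx.1, hx.2] using congrFun this x

theorem ae_integrableOn_caputo_pathSolDt (hα0 : 0 < α) (hα1 : α < 1) (hF : IsH1HalfLine F F')
    (h0 : F 0 = 0) {w : ℝ → ℝ} (hw : Continuous w) :
    ∀ᵐ t ∂(volume.restrict (Ioi (0 : ℝ))),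
      IntegrableOn (fun y => caputo α (fun s => pathSolDt α F w y s) t) (Ioo (0 : ℝ) 1) := by
  filter_upwards [(integrable_caputo_pathSolDt hα0 hα1 hF h0 hw one_pos).prod_left_ae] with t ht
  refine (ht.const_mul (Complex.exp (-(((1 : ℝ) : ℂ) * t)))⁻¹).congr (Eventually.of_forall fun y => ?_)
  simp only
  rw [inv_mul_cancel_left₀ (Complex.exp_ne_zero _)]

/-- For each `x` the equation holds off a null set depending on `x`. Countably many `x` give one
null set, and continuity in `x` of both sides extends the identity to all of `[0,1]`. -/
theorem ae_pathSol_equation (hw : IsPathModification μ W w) (hα0 : 0 < α) (hα1 : α < 1)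
    (hF : IsH1HalfLine F F') (h0 : F 0 = 0) :
    ∀ᵐ q ∂((volume.restrict (Ioi (0 : ℝ))).prod μ),
      IntegrableOn (fun y => caputo α (fun s => pathSolDt α F (w q.2) y s) q.1) (Ioo (0 : ℝ) 1) ∧
      ∀ x ∈ Icc (0 : ℝ) 1, pathSolDx α F (w q.2) x q.1
        = (∫ y in (0 : ℝ)..x, caputo α (fun s => pathSolDt α F (w q.2) y s) q.1)
          - F q.1 * w q.2 x := by
  have hcm := stronglyMeasurable_caputo_pathSolDt (F := F) hw.measurable hα0
  have hDm := stronglyMeasurable_pathSolDx (F := F) hw.measurable hα0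
  have hwm : Measurable fun p : Ω × ℝ => w p.1 p.2 := hw.measurable
  have h1 : ∀ᵐ q ∂((volume.restrict (Ioi (0 : ℝ))).prod μ),
      IntegrableOn (fun y => caputo α (fun s => pathSolDt α F (w q.2) y s) q.1)
        (Ioo (0 : ℝ) 1) := by
    have hcu : StronglyMeasurable (Function.uncurry fun (q : ℝ × Ω) (y : ℝ) =>
        caputo α (fun s => pathSolDt α F (w q.2) y s) q.1) :=
      hcm.comp_measurable (g := fun p : (ℝ × Ω) × ℝ => ((p.2, p.1.1), p.1.2)) (by fun_prop)
    have hms : MeasurableSet {q : ℝ × Ω | IntegrableOn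
        (fun y => caputo α (fun s => pathSolDt α F (w q.2) y s) q.1) (Ioo (0 : ℝ) 1)} :=
      measurableSet_integrable hcu
    have hpt : ∀ ω, ∀ᵐ t ∂(volume.restrict (Ioi (0 : ℝ))), IntegrableOn
        (fun y => caputo α (fun s => pathSolDt α F (w ω) y s) t) (Ioo (0 : ℝ) 1) := fun ω =>
      ae_integrableOn_caputo_pathSolDt hα0 hα1 hF h0 (hw.continuous ω)
    exact ae_prod_of_forall_ae hms (Eventually.of_forall hpt)
  -- `F` is only a.e. measurable on the half-line, while the Fubini step needs a measurable set; a
  -- measurable version stands in for `F`.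
  have hFm := hF.memLp.1.stronglyMeasurable_mk
  have hFeq := hF.memLp.1.ae_eq_mk
  have h2 : ∀ x ∈ Icc (0 : ℝ) 1, ∀ᵐ q ∂((volume.restrict (Ioi (0 : ℝ))).prod μ),
      pathSolDx α F (w q.2) x q.1
        = (∫ y in (0 : ℝ)..x, caputo α (fun s => pathSolDt α F (w q.2) y s) q.1)
          - hF.memLp.1.mk F q.1 * w q.2 x := by
    intro x hx
    refine ae_prod_of_forall_ae (p := fun q : ℝ × Ω => pathSolDx α F (w q.2) x q.1
        = (∫ y in (0 : ℝ)..x, caputo α (fun s => pathSolDt α F (w q.2) y s) q.1)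
          - hF.memLp.1.mk F q.1 * w q.2 x) (measurableSet_eq_fun ?_ ?_) (Eventually.of_forall fun ω => ?_)
    · exact (hDm.comp_measurable (g := fun q : ℝ × Ω => ((x, q.1), q.2)) (by fun_prop)).measurable
    · refine Measurable.sub ?_ ?_
      · exact (stronglyMeasurable_intervalIntegral (f := fun (q : ℝ × Ω) y =>
          caputo α (fun s => pathSolDt α F (w q.2) y s) q.1) (hcm.comp_measurable
          (g := fun p : (ℝ × Ω) × ℝ => ((p.2, p.1.1), p.1.2)) (by fun_prop))
          measurable_const measurable_const).measurable
      · have hw1 : Measurable fun q : ℝ × Ω => w q.2 x :=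
          hwm.comp (f := fun q : ℝ × Ω => (q.2, x)) (by fun_prop)
        exact (hFm.measurable.comp measurable_fst).mul (Complex.measurable_ofReal.comp hw1)
    · filter_upwards [pathSol_equation hα0 hα1 hF h0 (hw.continuous ω) hx, hFeq] with t ht hft
      rw [ht, hft]
  have h3 : ∀ᵐ q ∂((volume.restrict (Ioi (0 : ℝ))).prod μ), F q.1 = hF.memLp.1.mk F q.1 :=
    Measure.quasiMeasurePreserving_fst.ae hFeq
  have hmem : ∀ x : ℝ, max 0 (min 1 x) ∈ Icc (0 : ℝ) 1 := fun x =>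
    ⟨le_max_left _ _, max_le zero_le_one (min_le_left _ _)⟩
  filter_upwards [h1, h3, ae_all_iff.2 fun q : ℚ => h2 _ (hmem q)] with q hq1 hq3 hq2
  refine ⟨hq1, fun x hx => ?_⟩
  refine eq_of_continuousOn_of_rat
    (f := fun x => pathSolDx α F (w q.2) x q.1)
    (g := fun x => (∫ y in (0 : ℝ)..x, caputo α (fun s => pathSolDt α F (w q.2) y s) q.1)
          - F q.1 * w q.2 x)
    (continuousOn_pathSolDx hα0 hα1 hF h0 (hw.continuous _) _) ?_ (fun x => ?_) hx
  · refine ContinuousOn.sub ?_ (continuousOn_const.mul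
      (Complex.continuous_ofReal.comp (hw.continuous _)).continuousOn)
    have := intervalIntegral.continuousOn_primitive_interval (a := 0) (b := 1) (μ := volume)
      (f := fun y => caputo α (fun s => pathSolDt α F (w q.2) y s) q.1)
      (by rwa [uIcc_of_le zero_le_one, integrableOn_Icc_iff_integrableOn_Ioo])
    rwa [uIcc_of_le zero_le_one] at this
  · rw [hq2, hq3]

/-- Existence -/
theorem isTimeSolution_pathSol (hW : IsBrownianReal W μ) (hw : IsPathModification μ W w)
    (hα0 : 0 < α) (hα1 : α < 1) (hF : IsH1HalfLine F F') (h0 : F 0 = 0) :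
    IsTimeSolution α F μ W (fun x t ω => pathSol α F (w ω) x t)
      (fun x t ω => pathSolDt α F (w ω) x t) where
  memLp_ut := memLp_pathSolDt hW hw hα0 hα1 hF h0
  time_deriv := by
    filter_upwards [Measure.quasiMeasurePreserving_fst.ae (ae_restrict_mem measurableSet_Ioo)]
      with p hp
    exact (pathSol_weakDeriv hα0 hα1 hF h0 (hw.continuous p.2) (Ioo_subset_Icc_self hp)).2.2
  initial := by
    filter_upwards [Measure.quasiMeasurePreserving_fst.ae (ae_restrict_mem measurableSet_Ioo)]
      with p hp
    exact pathSol_zero hα0 hα1 hF h0 (hw.continuous p.2) (Ioo_subset_Icc_self hp)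
  equation := by
    filter_upwards [ae_pathSol_equation hw hα0 hα1 hF h0,
      Measure.quasiMeasurePreserving_snd.ae hw.ae_eq] with q hq hqW
    refine ⟨hq.1, fun x => pathSol α F (w q.2) x q.1, fun x => pathSolDx α F (w q.2) x q.1,
      Eventually.of_forall fun _ => rfl,
      continuousOn_pathSolDx hα0 hα1 hF h0 (hw.continuous _) _,
      fun x hx => hasDerivWithinAt_pathSol hα0 hα1 hF h0 (hw.continuous _) _ hx,
      pathSolDx_zero (hw.zero _) _, pathSol_one _, fun x hx => ?_⟩
    simp only
    rw [pathSolDx_zero (hw.zero _), sub_zero, hq.2 x hx, hqW]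

/-- The frequency domain solution -/
theorem isFrequencyMildSolution_freqSymbol (hW : IsBrownianReal W μ)
    (hw : IsPathModification μ W w) (hα0 : 0 < α) (hα1 : α < 1) :
    IsFrequencyMildSolution α F μ W fun x ξ ω => freqSymbol α F (mode (w ω) x) ξ where
  measurable := by
    refine StronglyMeasurable.aestronglyMeasurable ?_
    unfold freqSymbol
    refine ((stronglyMeasurable_fourierL2 _).comp_measurable (by fun_prop)).mul ?_
    exact (stronglyMeasurable_mode hw.measurable hα0).comp_measurable
      (g := fun p : (ℝ × ℝ) × Ω => ((p.1.1, p.2), p.1.2)) (by fun_prop)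
  mild x hx ξ := by
    refine ⟨_, isWienerIntegral_green hW hw.measurable hw.continuous hw.zero hw.ae_eq hα0 hα1
      (Ioo_subset_Icc_self hx) ξ, Eventually.of_forall fun ω => ?_⟩
    rw [freqSymbol]; ring

theorem invFourier_freqSymbol_mode (hα0 : 0 < α) (hα1 : α < 1) (hF : IsH1HalfLine F F')
    (h0 : F 0 = 0) {w : ℝ → ℝ} (hw : Continuous w) {x : ℝ} (hx : x ∈ Icc (0 : ℝ) 1) (t : ℝ) :
    invFourier (fun ξ => freqSymbol α F (mode w x) ξ) t
      = if 0 ≤ t then pathSol α F w x t else 0 := by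
  split_ifs with ht
  · rfl
  · exact (isSectorSymbol_mode hw hx).timeSymbol_eq_zero hα0 hα1 hF h0 (not_le.1 ht).le

end TimeSolution

/-! ### Uniqueness for the resolvent problem -/

section SteadyUniqueness

open Filter Topology

/-- Fubini: for fixed `y`, the `z` in `(x,1]` with `z ≥ y` form an interval of length `1 - max x y`.
The kernel is the Green function of `-d²/dx²` with the same boundary conditions. -/
theorem integral_integral_eq_kernel {c : ℝ → ℂ} (hc : IntegrableOn c (Ioo (0 : ℝ) 1)) {x : ℝ}
    (hx : x ∈ Icc (0 : ℝ) 1) :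
    ∫ z in x..1, ∫ y in (0 : ℝ)..z, c y = ∫ y in (0 : ℝ)..1, ((1 - max x y : ℝ) : ℂ) * c y := by
  have hc' : IntegrableOn c (Ioc (0 : ℝ) 1) := by rwa [integrableOn_Ioc_iff_integrableOn_Ioo]
  have hs : MeasurableSet {p : ℝ × ℝ | p.2 ≤ p.1} := measurableSet_le measurable_snd measurable_fst
  have hint : Integrable (fun p : ℝ × ℝ => (Iic p.1).indicator c p.2)
      ((volume.restrict (Ioc x 1)).prod (volume.restrict (Ioc (0 : ℝ) 1))) := by
    have := (hc'.comp_snd (volume.restrict (Ioc x 1))).indicator hs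
    refine this.congr (Eventually.of_forall fun p => ?_)
    simp [indicator_apply]
  rw [intervalIntegral.integral_of_le hx.2, intervalIntegral.integral_of_le zero_le_one]
  calc ∫ z in Ioc x 1, ∫ y in (0 : ℝ)..z, c y
      = ∫ z in Ioc x 1, ∫ y in Ioc (0 : ℝ) 1, (Iic z).indicator c y := by
        refine setIntegral_congr_fun measurableSet_Ioc fun z hz => ?_
        rw [intervalIntegral.integral_of_le (hx.1.trans hz.1.le),
          setIntegral_indicator measurableSet_Iic]
        congr 2
        ext y
        simp only [mem_Ioc, mem_inter_iff, mem_Iic]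
        exact ⟨fun h => ⟨⟨h.1, h.2.trans hz.2⟩, h.2⟩, fun h => ⟨h.1.1, h.2⟩⟩
    _ = ∫ y in Ioc (0 : ℝ) 1, ∫ z in Ioc x 1, (Iic z).indicator c y := integral_integral_swap hint
    _ = _ := by
        refine setIntegral_congr_fun measurableSet_Ioc fun y hy => ?_
        have h1 : (fun z => (Iic z).indicator c y) = (Ici y).indicator fun _ => c y := by
          ext z; simp [indicator_apply]
        simp only [h1]
        rw [setIntegral_indicator measurableSet_Ici, setIntegral_const]
        rcases le_or_gt y x with h | h
        · have : Ioc x 1 ∩ Ici y = Ioc x 1 :=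
            inter_eq_left.2 fun z hz => h.trans hz.1.le
          rw [this, max_eq_left h, Measure.real, Real.volume_Ioc,
            ENNReal.toReal_ofReal (by linarith [hx.2]), Complex.real_smul]
        · have : Ioc x 1 ∩ Ici y = Icc y 1 := by
            ext z
            simp only [mem_Ioc, mem_inter_iff, mem_Ici, mem_Icc]
            exact ⟨fun h => ⟨h.2, h.1.2⟩, fun h' => ⟨⟨h.trans_le h'.1, h'.2⟩, h'.1⟩⟩
          rw [this, max_eq_right h.le, Measure.real, Real.volume_Icc,
            ENNReal.toReal_ofReal (by linarith [hy.2]), Complex.real_smul]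

theorem smul_mem_sector {r : ℂ} (hr : r ∈ sector) {x : ℝ} (hx : 0 ≤ x) : r * x ∈ sector := by
  have : |r.im| ≤ r.re := hr
  change |(r * x).im| ≤ (r * x).re
  simp only [Complex.mul_im, Complex.mul_re, Complex.ofReal_re, Complex.ofReal_im, mul_zero,
    zero_add, sub_zero, abs_mul, abs_of_nonneg hx]
  gcongr

/-- The integrated form of `v'' = r² v`, `v'(0) = 0`, `v(1) = 0` has only the zero solution. -/
theorem ae_eq_zero_of_kernel_equation {D : ℝ → ℂ} (hD : IntegrableOn D (Ioo (0 : ℝ) 1)) {r : ℂ}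
    (hr : r ∈ sector) (h : ∀ᵐ x ∂(volume.restrict (Ioo (0 : ℝ) 1)),
      D x = -∫ y in (0 : ℝ)..1, ((1 - max x y : ℝ) : ℂ) * (r ^ 2 * D y)) :
    ∀ᵐ x ∂(volume.restrict (Ioo (0 : ℝ) 1)), D x = 0 := by
  set E : ℝ → ℂ := (Ioo (0 : ℝ) 1).indicator D with hE
  have hEi : Integrable E := (integrable_indicator_iff measurableSet_Ioo).2 hD
  set P : ℝ → ℂ := fun z => ∫ y in (0 : ℝ)..z, E y with hP
  have hPc : Continuous P := intervalIntegral.continuous_primitive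
    (fun _ _ => hEi.intervalIntegrable) 0
  -- `v` is the differentiable representative of `D`, with `v' = r² P`, where `P` is the primitive
  -- of `D` from `0`.
  set v : ℝ → ℂ := fun x => r ^ 2 * ∫ z in (1 : ℝ)..x, P z with hv
  have hvd : ∀ x, HasDerivAt v (r ^ 2 * P x) x := fun x =>
    (hPc.integral_hasStrictDerivAt 1 x).hasDerivAt.const_mul _
  have hvc : Continuous v := continuous_iff_continuousAt.2 fun x => (hvd x).continuousAt
  have hDv : ∀ᵐ x ∂(volume.restrict (Ioo (0 : ℝ) 1)), D x = v x := by
    filter_upwards [h, ae_restrict_mem measurableSet_Ioo] with x hx hmem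
    rw [hx, hv]
    simp only
    rw [intervalIntegral.integral_symm x 1, mul_neg]
    rw [integral_integral_eq_kernel hEi.integrableOn (Ioo_subset_Icc_self hmem),
      ← intervalIntegral.integral_const_mul]
    congr 1
    refine intervalIntegral.integral_congr_ae_restrict ?_
    rw [uIoc_of_le zero_le_one, ← restrict_Ioo_eq_restrict_Ioc]
    filter_upwards [ae_restrict_mem measurableSet_Ioo] with y hy
    rw [hE, indicator_of_mem hy]; ring
  set Q : ℝ → ℂ := fun z => ∫ y in (0 : ℝ)..z, v y with hQ
  have hQd : ∀ x, HasDerivAt Q (v x) x := fun x => (hvc.integral_hasStrictDerivAt 0 x).hasDerivAt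
  have hPQ : ∀ x ∈ Icc (0 : ℝ) 1, P x = Q x := fun x hx => by
    refine intervalIntegral.integral_congr_ae_restrict ?_
    rw [uIoc_of_le hx.1, ← restrict_Ioo_eq_restrict_Ioc]
    have := ae_mono (Measure.restrict_mono (Ioo_subset_Ioo_right hx.2) le_rfl) hDv
    filter_upwards [this, ae_restrict_mem measurableSet_Ioo] with y hy hm
    rw [hE, indicator_of_mem (show y ∈ Ioo (0 : ℝ) 1 from ⟨hm.1, hm.2.trans_le hx.2⟩), hy]
  have hconst : ∀ {f : ℝ → ℂ}, (∀ x ∈ Icc (0 : ℝ) 1, HasDerivAt f 0 x) →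
      ∀ x ∈ Icc (0 : ℝ) 1, f x = f 0 := fun {f} hf =>
    constant_of_has_deriv_right_zero
      (fun x hx => (hf x hx).continuousAt.continuousWithinAt)
      (fun x hx => (hf x (Ico_subset_Icc_self hx)).hasDerivWithinAt)
  -- This is, up to the factor `cosh²`, the derivative of `v / cosh(rx)`; it is constant by the
  -- equation and zero at `x = 0`.
  have hA : ∀ x ∈ Icc (0 : ℝ) 1,
      r ^ 2 * Q x * Complex.cosh (r * x) - r * v x * Complex.sinh (r * x) = 0 := fun x hx => by
    rw [hconst (f := fun x : ℝ =>
      r ^ 2 * Q x * Complex.cosh (r * x) - r * v x * Complex.sinh (r * x)) (fun x hx => ?_) x hx]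
    · simp [hQ]
    · have hc := (hasDerivAt_ofReal_mul r x).comp_ccosh
      have hs := (hasDerivAt_ofReal_mul r x).comp_csinh
      refine ((((hQd x).const_mul _).mul hc).sub (((hvd x).const_mul r).mul hs)).congr_deriv ?_
      rw [hPQ x hx]; ring
  have hcosh : ∀ x ∈ Icc (0 : ℝ) 1, Complex.cosh (r * x) ≠ 0 := fun x hx =>
    cosh_ne_zero_of_mem_sector (smul_mem_sector hr hx.1)
  -- So `v` is a multiple of `cosh(rx)`, which has no zero on `[0,1]`, and `v(1) = 0` makes the
  -- multiple zero. The case `r = 0` is included.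
  have hB : ∀ x ∈ Icc (0 : ℝ) 1, v x / Complex.cosh (r * x) = v 0 := fun x hx => by
    rw [hconst (f := fun x : ℝ => v x / Complex.cosh (r * x)) (fun x hx => ?_) x hx]
    · simp
    · have hc := (hasDerivAt_ofReal_mul r x).comp_ccosh
      refine ((hvd x).div hc (hcosh x hx)).congr_deriv ?_
      rw [hPQ x hx, div_eq_zero_iff]
      left
      linear_combination hA x hx
  have hv1 : v 1 = 0 := by simp [hv]
  have hv0 : v 0 = 0 := by rw [← hB 1 (by simp), hv1, zero_div]
  filter_upwards [hDv, ae_restrict_mem measurableSet_Ioo] with x hx hm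
  have := hB x (Ioo_subset_Icc_self hm)
  rw [hv0, div_eq_zero_iff] at this
  rw [hx]
  exact this.resolve_right (hcosh x (Ioo_subset_Icc_self hm))

end SteadyUniqueness

/-! ### Uniqueness for a fixed path by Laplace transform -/

section PathUniqueness

open Filter Topology

variable {α : ℝ} {F F' : ℝ → ℂ} {w : ℝ → ℝ}

/-- Integrating the norm of `G` in either order exchanges the quantifiers with only a.e.
measurability of `G`. -/
theorem ae_ae_swap_eq_zero {X Y : Type*} [MeasurableSpace X] [MeasurableSpace Y]
    {μ : Measure X} {ν : Measure Y} [SFinite μ] [SFinite ν] {G : X × Y → ℂ}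
    (hG : AEStronglyMeasurable G (μ.prod ν)) (h : ∀ᵐ y ∂ν, ∀ᵐ x ∂μ, G (x, y) = 0) :
    ∀ᵐ x ∂μ, ∀ᵐ y ∂ν, G (x, y) = 0 := by
  have h0 : ∫⁻ p, ‖G p‖ₑ ∂(μ.prod ν) = 0 := by
    rw [lintegral_prod_symm _ hG.enorm]
    rw [lintegral_eq_zero_of_ae_eq_zero]
    filter_upwards [h] with y hy
    refine lintegral_eq_zero_of_ae_eq_zero ?_
    filter_upwards [hy] with x hx
    simp [hx]
  rw [lintegral_eq_zero_iff' hG.enorm] at h0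
  refine Measure.ae_ae_of_ae_prod (p := fun p => G p = 0) ?_
  filter_upwards [h0] with p hp
  simpa using hp

/-- A path of a solution of the time-fractional problem; the equation is in integrated form. -/
structure IsPathSolution (α : ℝ) (F : ℝ → ℂ) (w : ℝ → ℝ) (u g : ℝ → ℝ → ℂ) : Prop where
  stronglyMeasurable : StronglyMeasurable (Function.uncurry g)
  lintegral_ne_top :
    ∫⁻ x in Ioo (0 : ℝ) 1, ∫⁻ t in Ioi (0 : ℝ), ‖g x t‖ₑ ^ 2 ≠ ∞
  weakDeriv : ∀ᵐ x ∂(volume.restrict (Ioo (0 : ℝ) 1)), HasWeakDerivHalfLine (u x) (g x)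
  initial : ∀ᵐ x ∂(volume.restrict (Ioo (0 : ℝ) 1)), u x 0 = 0
  equation : ∀ᵐ t ∂(volume.restrict (Ioi (0 : ℝ))), ∀ᵐ x ∂(volume.restrict (Ioo (0 : ℝ) 1)),
    u x t = F t * (∫ z in x..1, (w z : ℂ))
      - ∫ y in (0 : ℝ)..1, ((1 - max x y : ℝ) : ℂ) * caputo α (g y) t

namespace IsPathSolution

variable {u g u₁ g₁ u₂ g₂ : ℝ → ℝ → ℂ}

theorem ae_memLp (h : IsPathSolution α F w u g) :
    ∀ᵐ x ∂(volume.restrict (Ioo (0 : ℝ) 1)), MemLp (g x) 2 (volume.restrict (Ioi (0 : ℝ))) := by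
  have hm : Measurable fun x => ∫⁻ t in Ioi (0 : ℝ), ‖g x t‖ₑ ^ 2 :=
    Measurable.lintegral_prod_right' (f := fun p : ℝ × ℝ => ‖g p.1 p.2‖ₑ ^ 2)
      (h.stronglyMeasurable.enorm.pow_const 2)
  filter_upwards [ae_lt_top hm h.lintegral_ne_top] with x hx
  refine ⟨(h.stronglyMeasurable.comp_measurable (g := fun t : ℝ => (x, t))
    (by fun_prop)).aestronglyMeasurable, ?_⟩
  rw [← eLpNorm_two_sq] at hx
  exact (ENNReal.pow_lt_top_iff.1 hx).resolve_right two_ne_zero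

theorem lintegral_eLpNorm_ne_top (h : IsPathSolution α F w u g) :
    ∫⁻ x in Ioo (0 : ℝ) 1, eLpNorm (g x) 2 (volume.restrict (Ioi (0 : ℝ))) ≠ ∞ := by
  have hle : ∀ a : ℝ≥0∞, a ≤ 1 + a ^ 2 := fun a => by
    rcases le_total a 1 with ha | ha
    · exact ha.trans le_self_add
    · exact (le_self_pow ha two_ne_zero).trans le_add_self
  refine ne_top_of_le_ne_top ?_ (lintegral_mono fun x => hle _)
  rw [lintegral_add_left measurable_const]
  refine ENNReal.add_ne_top.2 ⟨by simp, ?_⟩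
  simp only [eLpNorm_two_sq]
  exact h.lintegral_ne_top

theorem integrable_exp_mul_caputo (h : IsPathSolution α F w u g) (hα1 : α < 1) {a : ℝ}
    (ha : 0 < a) {s : ℂ} (hs : s.re = a) :
    Integrable (fun p : ℝ × ℝ => Complex.exp (-(s * p.2)) * caputo α (g p.1) p.2)
      ((volume.restrict (Ioo (0 : ℝ) 1)).prod (volume.restrict (Ioi (0 : ℝ)))) :=
  exp_mul_integrable_of_re_eq (τ := Prod.snd) hs measurable_snd
    (_root_.integrable_exp_mul_caputo hα1
      (stronglyMeasurable_caputo h.stronglyMeasurable).aestronglyMeasurable h.ae_memLp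
      h.lintegral_eLpNorm_ne_top ha)

theorem hlap_caputo (h : IsPathSolution α F w u g) (hα1 : α < 1) {s : ℂ} (hs : 0 < s.re) :
    ∀ᵐ x ∂(volume.restrict (Ioo (0 : ℝ) 1)),
      hlap (caputo α (g x)) s = (s ^ ((α / 2 : ℝ) : ℂ)) ^ 2 * hlap (u x) s := by
  have hs0 : s ≠ 0 := fun h => by simp [h] at hs
  filter_upwards [h.ae_memLp, h.weakDeriv, h.initial] with x hx hd hi
  have := integrableOn_exp_mul_of_memLp hx hs
  rw [(_root_.hlap_caputo hα1 hs this).2, (hlap_weakDeriv hd hi hs this).2, cpow_half_sq hs0]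
  ring

/-- The equation is given for almost every `t`, but the transform in time needs it for almost every
`x`. As `u` is not assumed jointly measurable, it is replaced by the primitive of `g` before the
quantifiers are exchanged. -/
theorem ae_ae_equation (h : IsPathSolution α F w u g) (hF : IsH1HalfLine F F') (hw : Continuous w) :
    ∀ᵐ x ∂(volume.restrict (Ioo (0 : ℝ) 1)), ∀ᵐ t ∂(volume.restrict (Ioi (0 : ℝ))),
    u x t = F t * (∫ z in x..1, (w z : ℂ))
      - ∫ y in (0 : ℝ)..1, ((1 - max x y : ℝ) : ℂ) * caputo α (g y) t := by
  have hu : ∀ᵐ x ∂(volume.restrict (Ioo (0 : ℝ) 1)), ∀ t : ℝ, 0 ≤ t →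
      u x t = ∫ s in (0 : ℝ)..t, g x s := by
    filter_upwards [h.weakDeriv, h.initial] with x hd hi t ht
    rw [(hd t ht).2, hi, zero_add]
  have key := ae_ae_swap_eq_zero (μ := volume.restrict (Ioo (0 : ℝ) 1))
    (ν := volume.restrict (Ioi (0 : ℝ)))
    (G := fun p : ℝ × ℝ => (∫ s in (0 : ℝ)..p.2, g p.1 s)
      - (F p.2 * (∫ z in p.1..1, (w z : ℂ))
        - ∫ y in (0 : ℝ)..1, ((1 - max p.1 y : ℝ) : ℂ) * caputo α (g y) p.2)) ?_ ?_
  · filter_upwards [key, hu] with x hx hux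
    filter_upwards [hx, ae_restrict_mem measurableSet_Ioi] with t ht ht0
    rw [hux t (mem_Ioi.1 ht0).le]
    exact sub_eq_zero.1 ht
  · refine AEStronglyMeasurable.sub ?_ (AEStronglyMeasurable.sub ?_ ?_)
    · refine (stronglyMeasurable_intervalIntegral (f := fun (p : ℝ × ℝ) s => g p.1 s) ?_
        (by fun_prop) (by fun_prop)).aestronglyMeasurable
      exact h.stronglyMeasurable.comp_measurable (g := fun q : (ℝ × ℝ) × ℝ => (q.1.1, q.2))
        (by fun_prop)
    · refine hF.memLp.1.comp_snd.mul (StronglyMeasurable.aestronglyMeasurable ?_)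
      exact stronglyMeasurable_intervalIntegral (f := fun (_ : ℝ × ℝ) z => (w z : ℂ))
        (Measurable.stronglyMeasurable (by unfold Function.uncurry; fun_prop))
        (by fun_prop) (by fun_prop)
    · refine (stronglyMeasurable_intervalIntegral (f := fun (p : ℝ × ℝ) y =>
        ((1 - max p.1 y : ℝ) : ℂ) * caputo α (g y) p.2) ?_
        (by fun_prop) (by fun_prop)).aestronglyMeasurable
      refine StronglyMeasurable.mul (Measurable.stronglyMeasurable (by fun_prop)) ?_
      exact (stronglyMeasurable_caputo h.stronglyMeasurable).comp_measurable
        (g := fun q : (ℝ × ℝ) × ℝ => (q.2, q.1.2)) (by fun_prop)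
  · filter_upwards [h.equation, ae_restrict_mem measurableSet_Ioi] with t ht ht0
    filter_upwards [ht, hu] with x hx hux
    rw [← hux t (mem_Ioi.1 ht0).le, hx, sub_self]

theorem hlap_equation (h : IsPathSolution α F w u g) (hα1 : α < 1) (hF : IsH1HalfLine F F')
    (hw : Continuous w) {s : ℂ} (hs : s.re = 1) :
    IntegrableOn (fun x => (s ^ ((α / 2 : ℝ) : ℂ)) ^ 2 * hlap (u x) s) (Ioo (0 : ℝ) 1) ∧
    ∀ᵐ x ∂(volume.restrict (Ioo (0 : ℝ) 1)),
      hlap (u x) s = hlap F s * (∫ z in x..1, (w z : ℂ))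
        - ∫ y in (0 : ℝ)..1, ((1 - max x y : ℝ) : ℂ)
          * ((s ^ ((α / 2 : ℝ) : ℂ)) ^ 2 * hlap (u y) s) := by
  have hs0 : 0 < s.re := by rw [hs]; exact one_pos
  have hi := h.integrable_exp_mul_caputo hα1 one_pos hs
  have hcap := h.hlap_caputo hα1 hs0
  refine ⟨hi.integral_prod_left.congr hcap, ?_⟩
  filter_upwards [h.ae_ae_equation hF hw, ae_restrict_mem measurableSet_Ioo] with x hx hmem
  have hk : Integrable (fun p : ℝ × ℝ => ((1 - max x p.1 : ℝ) : ℂ)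
      * (Complex.exp (-(s * p.2)) * caputo α (g p.1) p.2))
      ((volume.restrict (Ioo (0 : ℝ) 1)).prod (volume.restrict (Ioi (0 : ℝ)))) := by
    refine hi.bdd_mul (c := 1) (Measurable.aestronglyMeasurable (by fun_prop)) ?_
    filter_upwards [Measure.quasiMeasurePreserving_fst.ae (ae_restrict_mem measurableSet_Ioo)]
      with p hp
    have h1 : max x p.1 ≤ 1 := max_le hmem.2.le hp.2.le
    have h2 : 0 ≤ max x p.1 := le_max_of_le_left hmem.1.le
    rw [Complex.norm_real, Real.norm_eq_abs, abs_le]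
    constructor <;> linarith
  have i1 : IntegrableOn (fun t : ℝ => Complex.exp (-(s * t)) * F t * ∫ z in x..1, (w z : ℂ))
      (Ioi 0) := (integrableOn_exp_mul_of_memLp hF.memLp hs0).mul_const _
  calc hlap (u x) s
      = ∫ t in Ioi (0 : ℝ), (Complex.exp (-(s * t)) * F t * (∫ z in x..1, (w z : ℂ))
          - ∫ y in Ioo (0 : ℝ) 1, ((1 - max x y : ℝ) : ℂ)
            * (Complex.exp (-(s * t)) * caputo α (g y) t)) := by
        refine integral_congr_ae ?_
        filter_upwards [hx] with t ht
        rw [ht, mul_sub, intervalIntegral.integral_of_le zero_le_one,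
          ← restrict_Ioo_eq_restrict_Ioc, ← integral_const_mul, mul_assoc]
        congr 2
        ext y
        ring
    _ = hlap F s * (∫ z in x..1, (w z : ℂ)) - ∫ y in Ioo (0 : ℝ) 1, ∫ t in Ioi (0 : ℝ),
          ((1 - max x y : ℝ) : ℂ) * (Complex.exp (-(s * t)) * caputo α (g y) t) := by
        rw [integral_sub i1 hk.integral_prod_right, integral_mul_const]
        congr 1
        exact (integral_integral_swap (f := fun y t : ℝ => ((1 - max x y : ℝ) : ℂ)
          * (Complex.exp (-(s * t)) * caputo α (g y) t)) hk).symm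
    _ = _ := by
        rw [intervalIntegral.integral_of_le zero_le_one, ← restrict_Ioo_eq_restrict_Ioc]
        congr 1
        refine integral_congr_ae ?_
        filter_upwards [hcap] with y hy
        rw [integral_const_mul, ← hy]
        rfl

/-- The forcing terms are equal and cancel, so the difference of the transforms solves the
homogeneous resolvent problem. Its integrability is obtained from that of the Caputo term by
dividing by `r² ≠ 0`. -/
theorem ae_hlap_eq (h₁ : IsPathSolution α F w u₁ g₁) (h₂ : IsPathSolution α F w u₂ g₂)
    (hα0 : 0 < α) (hα1 : α < 1) (hF : IsH1HalfLine F F') (hw : Continuous w) {s : ℂ}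
    (hs : s.re = 1) :
    ∀ᵐ x ∂(volume.restrict (Ioo (0 : ℝ) 1)), hlap (u₁ x) s = hlap (u₂ x) s := by
  have hs0 : 0 < s.re := by rw [hs]; exact one_pos
  have hsne : s ≠ 0 := fun h => by simp [h] at hs0
  obtain ⟨i₁, e₁⟩ := h₁.hlap_equation hα1 hF hw hs
  obtain ⟨i₂, e₂⟩ := h₂.hlap_equation hα1 hF hw hs
  set r := s ^ ((α / 2 : ℝ) : ℂ) with hr
  have hr0 : r ^ 2 ≠ 0 := pow_ne_zero 2 (by
    rw [hr, Complex.cpow_ne_zero_iff_of_exponent_ne_zero] <;> simp [hsne, hα0.ne'])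
  have hk : ∀ {q : ℝ → ℂ}, IntegrableOn q (Ioo (0 : ℝ) 1) → ∀ x : ℝ,
      IntervalIntegrable (fun y => ((1 - max x y : ℝ) : ℂ) * q y) volume 0 1 := fun hq x => by
    refine IntervalIntegrable.continuousOn_mul ?_ (Continuous.continuousOn (by fun_prop))
    rwa [intervalIntegrable_iff_integrableOn_Ioo_of_le zero_le_one]
  have hD : IntegrableOn (fun x => hlap (u₁ x) s - hlap (u₂ x) s) (Ioo (0 : ℝ) 1) := by
    refine ((i₁.sub i₂).const_mul (r ^ 2)⁻¹).congr (Eventually.of_forall fun x => ?_)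
    simp only [Pi.sub_apply]
    rw [← mul_sub, inv_mul_cancel_left₀ hr0]
  have := ae_eq_zero_of_kernel_equation hD (cpow_mem_sector hα0 hα1 hs0.le) ?_
  · filter_upwards [this] with x hx
    exact sub_eq_zero.1 hx
  · filter_upwards [e₁, e₂] with x h1 h2
    rw [h1, h2, sub_sub_sub_cancel_left, ← intervalIntegral.integral_sub (hk i₂ x) (hk i₁ x),
      ← intervalIntegral.integral_neg]
    refine intervalIntegral.integral_congr fun y _ => ?_
    ring

theorem continuous_hlap_line {f : ℝ → ℂ}
    (hf : ∀ s : ℂ, 0 < s.re → IntegrableOn (fun t : ℝ => Complex.exp (-(s * t)) * f t) (Ioi 0)) :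
    Continuous fun q : ℝ => hlap f (1 + q * Complex.I) := by
  have h1 : ContinuousOn (hlap f) {s : ℂ | 0 < s.re} := by
    have := (lap_differentiableOn (indicator_Ioi_eq_zero f)
      fun s hs => (integrable_exp_mul_indicator_iff _ s).2 (hf s hs)).continuousOn
    exact this.congr fun s _ => (lap_indicator f s).symm
  exact h1.comp_continuous (by fun_prop) fun q => by simp

/-- Uniqueness for almost every path -/
theorem ae_eq (h₁ : IsPathSolution α F w u₁ g₁) (h₂ : IsPathSolution α F w u₂ g₂)
    (hα0 : 0 < α) (hα1 : α < 1) (hF : IsH1HalfLine F F') (hw : Continuous w) :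
    ∀ᵐ x ∂(volume.restrict (Ioo (0 : ℝ) 1)), ∀ᵐ t ∂(volume.restrict (Ioi (0 : ℝ))),
      g₁ x t = g₂ x t := by
  -- The exceptional set of `x` depends on `s`; rational heights on `Re s = 1` give a single null
  -- set, and continuity along the line covers the remaining heights.
  have hrat : ∀ᵐ x ∂(volume.restrict (Ioo (0 : ℝ) 1)), ∀ q : ℚ,
      hlap (u₁ x) (1 + ((q : ℝ) : ℂ) * Complex.I) = hlap (u₂ x) (1 + ((q : ℝ) : ℂ) * Complex.I) :=
    ae_all_iff.2 fun q => h₁.ae_hlap_eq h₂ hα0 hα1 hF hw (by simp)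
  filter_upwards [hrat, h₁.ae_memLp, h₂.ae_memLp, h₁.weakDeriv, h₂.weakDeriv, h₁.initial,
    h₂.initial] with x hx m₁ m₂ d₁ d₂ z₁ z₂
  have l₁ := fun (s : ℂ) (hs : 0 < s.re) =>
    hlap_weakDeriv d₁ z₁ hs (integrableOn_exp_mul_of_memLp m₁ hs)
  have l₂ := fun (s : ℂ) (hs : 0 < s.re) =>
    hlap_weakDeriv d₂ z₂ hs (integrableOn_exp_mul_of_memLp m₂ hs)
  have hline := Rat.denseRange_cast.equalizer
    (continuous_hlap_line fun s hs => (l₁ s hs).1) (continuous_hlap_line fun s hs => (l₂ s hs).1)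
    (funext hx)
  have := ae_eq_zero_of_hlap_eq_zero (f := fun t => g₁ x t - g₂ x t) (a := 1)
    (integrableOn_exp_mul_of_memLp (m₁.sub m₂) (by simp)) fun s hs => ?_
  · filter_upwards [this] with t ht
    exact sub_eq_zero.1 ht
  · have hs0 : 0 < s.re := by rw [hs]; exact one_pos
    have hsq : s = 1 + ((s.im : ℝ) : ℂ) * Complex.I := by
      conv_lhs => rw [← Complex.re_add_im s, hs]
      simp
    have he : hlap (u₁ x) s = hlap (u₂ x) s := by
      rw [hsq]; exact congrFun hline s.im
    calc hlap (fun t => g₁ x t - g₂ x t) s = hlap (g₁ x) s - hlap (g₂ x) s := by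
          simp only [hlap, mul_sub]
          exact integral_sub (integrableOn_exp_mul_of_memLp m₁ hs0)
            (integrableOn_exp_mul_of_memLp m₂ hs0)
      _ = 0 := by rw [(l₁ s hs0).2, (l₂ s hs0).2, he, sub_self]

end IsPathSolution

end PathUniqueness

/-! ### Uniqueness for random solutions -/

section Uniqueness

open Filter Topology

variable {Ω : Type*} [MeasurableSpace Ω] {μ : Measure Ω} [IsProbabilityMeasure μ]
  {W : ℝ≥0 → Ω → ℝ} {w : Ω → ℝ → ℝ} {α : ℝ} {F F' : ℝ → ℂ}

theorem ae_ae_of_ae_prod_swap {X Y : Type*} [MeasurableSpace X] [MeasurableSpace Y]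
    {μ : Measure X} {ν : Measure Y} [SFinite μ] [SFinite ν] {p : X × Y → Prop}
    (h : ∀ᵐ q ∂(μ.prod ν), p q) : ∀ᵐ y ∂ν, ∀ᵐ x ∂μ, p (x, y) :=
  Measure.ae_ae_of_ae_prod (p := fun q : Y × X => p (q.2, q.1))
    (Measure.measurePreserving_swap.quasiMeasurePreserving.ae h)

theorem ae_ae_of_ae_prod_prod {X T Y : Type*} [MeasurableSpace X] [MeasurableSpace T]
    [MeasurableSpace Y] {ν : Measure X} {τ : Measure T} {μ : Measure Y} [SFinite ν] [SFinite τ]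
    [SFinite μ] {p : (X × T) × Y → Prop} (h : ∀ᵐ q ∂((ν.prod τ).prod μ), p q) :
    ∀ᵐ q ∂(ν.prod μ), ∀ᵐ t ∂τ, p ((q.1, t), q.2) := by
  have e := (((measurePreserving_prodAssoc ν τ μ).symm).comp
    ((MeasurePreserving.id ν).prod (Measure.measurePreserving_swap (μ := μ) (ν := τ)))).comp
    (measurePreserving_prodAssoc ν μ τ)
  exact Measure.ae_ae_of_ae_prod (e.quasiMeasurePreserving.ae h)

theorem HasWeakDerivHalfLine.congr {f g g' : ℝ → ℂ} (h : HasWeakDerivHalfLine f g)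
    (hg : ∀ᵐ t ∂(volume.restrict (Ioi (0 : ℝ))), g t = g' t) : HasWeakDerivHalfLine f g' := by
  intro t ht
  have hc : g =ᵐ[volume.restrict (uIoc 0 t)] g' := by
    rw [uIoc_of_le ht]
    exact ae_mono (Measure.restrict_mono Ioc_subset_Ioi_self le_rfl) hg
  exact ⟨(h t ht).1.congr_ae hc, by
    rw [(h t ht).2, intervalIntegral.integral_congr_ae_restrict hc]⟩

theorem caputo_congr {g g' : ℝ → ℂ} (hg : ∀ᵐ t ∂(volume.restrict (Ioi (0 : ℝ))), g t = g' t)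
    {t : ℝ} (ht : 0 ≤ t) : caputo α g t = caputo α g' t := by
  rw [caputo, caputo]
  congr 1
  refine intervalIntegral.integral_congr_ae_restrict ?_
  rw [uIoc_of_le ht]
  filter_upwards [ae_mono (Measure.restrict_mono Ioc_subset_Ioi_self le_rfl) hg] with s hs
  rw [hs]

/-- Integrating `v'` from `x` to `1` uses `v(1) = 0` and eliminates derivatives, so that the
equation survives changes of `v` on null sets. -/
theorem integrated_equation {c v v' : ℝ → ℂ} {w : ℝ → ℝ} (hw : Continuous w) {φ : ℂ}
    (hc : IntegrableOn c (Ioo (0 : ℝ) 1)) (hv'c : ContinuousOn v' (Icc 0 1))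
    (hv : ∀ x ∈ Icc (0 : ℝ) 1, HasDerivWithinAt v (v' x) (Icc 0 1) x) (hv1 : v 1 = 0)
    (he : ∀ x ∈ Icc (0 : ℝ) 1, v' x = (∫ y in (0 : ℝ)..x, c y) - φ * w x)
    {x : ℝ} (hx : x ∈ Icc (0 : ℝ) 1) :
    v x = φ * (∫ z in x..1, (w z : ℂ)) - ∫ y in (0 : ℝ)..1, ((1 - max x y : ℝ) : ℂ) * c y := by
  have hsub : Icc x 1 ⊆ Icc 0 1 := Icc_subset_Icc_left hx.1
  have hii : IntervalIntegrable v' volume x 1 :=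
    (hv'c.mono (by rwa [uIcc_of_le hx.2])).intervalIntegrable
  have hftc : ∫ z in x..1, v' z = v 1 - v x :=
    intervalIntegral.integral_eq_sub_of_hasDerivAt_of_le hx.2
      (fun z hz => (hv z (hsub hz)).continuousWithinAt.mono hsub)
      (fun z hz => (hv z (hsub (Ioo_subset_Icc_self hz))).hasDerivAt
        (Icc_mem_nhds (hx.1.trans_lt hz.1) hz.2)) hii
  have hwi : IntervalIntegrable (fun z => φ * (w z : ℂ)) volume x 1 :=
    Continuous.intervalIntegrable (by fun_prop) _ _
  have hP : ∫ z in x..1, (∫ y in (0 : ℝ)..z, c y) = ∫ z in x..1, (v' z + φ * w z) := by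
    refine intervalIntegral.integral_congr fun z hz => ?_
    rw [uIcc_of_le hx.2] at hz
    rw [he z (hsub hz)]; ring
  rw [← integral_integral_eq_kernel hc hx, hP, intervalIntegral.integral_add hii hwi, hftc, hv1,
    intervalIntegral.integral_const_mul]
  ring

/-- Almost every path of a solution solves the integrated equation. -/
theorem IsTimeSolution.exists_isPathSolution {u ut : ℝ → ℝ → Ω → ℂ}
    (h : IsTimeSolution α F μ W u ut) (hw : IsPathModification μ W w) :
    ∃ G : (ℝ × ℝ) × Ω → ℂ, StronglyMeasurable G ∧
      (∀ᵐ p ∂((volume.restrict (Ioo (0 : ℝ) 1)).prod μ), ∀ᵐ t ∂(volume.restrict (Ioi (0 : ℝ))),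
        ut p.1 t p.2 = G ((p.1, t), p.2)) ∧
      ∀ᵐ ω ∂μ, IsPathSolution α F (w ω) (fun x t => u x t ω) (fun x t => G ((x, t), ω)) := by
  -- `ut` is only a.e. measurable. The weak derivative and the Caputo integral depend only on its
  -- class in time, so a strongly measurable version replaces it on almost every path.
  have hG := h.memLp_ut.1.ae_eq_mk
  have hGm := h.memLp_ut.1.stronglyMeasurable_mk
  set G := h.memLp_ut.1.mk _ with hGdef
  have h1 := ae_ae_of_ae_prod_prod hG
  have hfin : ∫⁻ ω, (∫⁻ q, ‖G (q, ω)‖ₑ ^ 2 ∂((volume.restrict (Ioo (0 : ℝ) 1)).prod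
      (volume.restrict (Ioi (0 : ℝ))))) ∂μ ≠ ∞ := by
    rw [← lintegral_prod_symm (fun p => ‖G p‖ₑ ^ 2) (hGm.enorm.pow_const 2).aemeasurable,
      ← eLpNorm_two_sq, ← eLpNorm_congr_ae hG]
    exact ENNReal.pow_ne_top h.memLp_ut.2.ne
  have hfin' := ae_lt_top (Measurable.lintegral_prod_left' (f := fun p => ‖G p‖ₑ ^ 2)
    (hGm.enorm.pow_const 2)) hfin
  refine ⟨G, hGm, h1, ?_⟩
  filter_upwards [hfin', ae_ae_of_ae_prod_swap h1, ae_ae_of_ae_prod_swap h.time_deriv,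
    ae_ae_of_ae_prod_swap h.initial, ae_ae_of_ae_prod_swap h.equation, hw.ae_eq]
    with ω hω1 hω2 hω3 hω4 hω5 hωw
  have hgm : StronglyMeasurable fun q : ℝ × ℝ => G (q, ω) :=
    hGm.comp_measurable (g := fun q : ℝ × ℝ => (q, ω)) (by fun_prop)
  refine ⟨hgm, ?_, ?_, hω4, ?_⟩
  · rw [lintegral_prod _ (hgm.enorm.pow_const 2).aemeasurable] at hω1
    exact hω1.ne
  · filter_upwards [hω2, hω3] with x hx2 hx3
    exact hx3.congr hx2
  · filter_upwards [hω5, ae_restrict_mem measurableSet_Ioi] with t ht ht0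
    obtain ⟨hint, v, v', huv, hv'c, hv, hv'0, hv1, he⟩ := ht
    filter_upwards [huv, ae_restrict_mem measurableSet_Ioo] with x hx hmem
    rw [hx, integrated_equation (hw.continuous ω) hint hv'c hv hv1 (φ := F t) (fun z hz => by
      have := he z hz
      rw [hv'0, sub_zero] at this
      rw [this, hωw]) (Ioo_subset_Icc_self hmem)]
    congr 1
    refine intervalIntegral.integral_congr_ae_restrict ?_
    rw [uIoc_of_le zero_le_one, ← restrict_Ioo_eq_restrict_Ioc]
    filter_upwards [hω2] with y hy
    rw [caputo_congr hy (mem_Ioi.1 ht0).le]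

theorem IsTimeSolution.unique {u₁ ut₁ u₂ ut₂ : ℝ → ℝ → Ω → ℂ}
    (h₁ : IsTimeSolution α F μ W u₁ ut₁) (h₂ : IsTimeSolution α F μ W u₂ ut₂)
    (hw : IsPathModification μ W w) (hα0 : 0 < α) (hα1 : α < 1) (hF : IsH1HalfLine F F') :
    ∀ᵐ p ∂((volume.restrict (Ioo (0 : ℝ) 1)).prod μ),
      ∀ t : ℝ, 0 ≤ t → u₁ p.1 t p.2 = u₂ p.1 t p.2 := by
  obtain ⟨G₁, m₁, e₁, s₁⟩ := h₁.exists_isPathSolution hw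
  obtain ⟨G₂, m₂, e₂, s₂⟩ := h₂.exists_isPathSolution hw
  have hmeas : Measurable fun q : ((ℝ × Ω) × ℝ) => ‖G₁ ((q.1.1, q.2), q.1.2)
      - G₂ ((q.1.1, q.2), q.1.2)‖ₑ :=
    ((m₁.comp_measurable (g := fun q : (ℝ × Ω) × ℝ => ((q.1.1, q.2), q.1.2)) (by fun_prop)).sub
      (m₂.comp_measurable (g := fun q : (ℝ × Ω) × ℝ => ((q.1.1, q.2), q.1.2))
        (by fun_prop))).enorm
  -- Writing a.e. equality in time as the vanishing of an integral makes it a measurable condition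
  -- on `(x, ω)`, as passing to the product measure requires.
  have hiff : ∀ p : ℝ × Ω, (∫⁻ t in Ioi (0 : ℝ), ‖G₁ ((p.1, t), p.2) - G₂ ((p.1, t), p.2)‖ₑ = 0)
      ↔ ∀ᵐ t ∂(volume.restrict (Ioi (0 : ℝ))), G₁ ((p.1, t), p.2) = G₂ ((p.1, t), p.2) := fun p => by
    have hm : Measurable fun t : ℝ => ‖G₁ ((p.1, t), p.2) - G₂ ((p.1, t), p.2)‖ₑ :=
      hmeas.comp (measurable_prodMk_left (x := p))
    rw [lintegral_eq_zero_iff hm]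
    refine eventually_congr (Eventually.of_forall fun t => ?_)
    simp [sub_eq_zero]
  have hae : ∀ᵐ p ∂((volume.restrict (Ioo (0 : ℝ) 1)).prod μ),
      ∫⁻ t in Ioi (0 : ℝ), ‖G₁ ((p.1, t), p.2) - G₂ ((p.1, t), p.2)‖ₑ = 0 := by
    refine ae_prod_of_forall_ae (p := fun p : ℝ × Ω => ∫⁻ t in Ioi (0 : ℝ),
      ‖G₁ ((p.1, t), p.2) - G₂ ((p.1, t), p.2)‖ₑ = 0)
      (hmeas.lintegral_prod_right' (measurableSet_singleton 0)) ?_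
    filter_upwards [s₁, s₂] with ω p₁ p₂
    filter_upwards [p₁.ae_eq p₂ hα0 hα1 hF (hw.continuous ω)] with x hx
    exact (hiff (x, ω)).2 hx
  filter_upwards [hae, e₁, e₂, h₁.time_deriv, h₂.time_deriv, h₁.initial, h₂.initial]
    with p hp q₁ q₂ d₁ d₂ i₁ i₂ t ht
  have hc : ∀ᵐ t ∂(volume.restrict (Ioi (0 : ℝ))), ut₁ p.1 t p.2 = ut₂ p.1 t p.2 := by
    filter_upwards [(hiff p).1 hp, q₁, q₂] with t h h1 h2
    rw [h1, h2, h]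
  have h1 := ((d₁.congr hc) t ht).2
  have h2 := (d₂ t ht).2
  simp only at h1 h2
  rw [h1, h2, i₁, i₂]

end Uniqueness

/-! ### Real data give real solutions -/

section RealValued

open Filter Topology ComplexConjugate

variable {α : ℝ} {F F' : ℝ → ℂ} {w : ℝ → ℝ} {x : ℝ}

theorem mode_conj (hx : x ∈ Icc (0 : ℝ) 1) (r : ℂ) : mode w x (conj r) = conj (mode w x r) := by
  have h1 : sinhInt w x (conj r) = conj (sinhInt w x r) := by
    rw [sinhInt, sinhInt, intervalIntegral.integral_of_le hx.1,
      intervalIntegral.integral_of_le hx.1, ← integral_conj]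
    simp [← Complex.sinh_conj]
  have h2 : coshInt w x (conj r) = conj (coshInt w x r) := by
    have : 0 ≤ 1 - x := by linarith [hx.2]
    rw [coshInt, coshInt, intervalIntegral.integral_of_le this,
      intervalIntegral.integral_of_le this, ← integral_conj]
    simp [← Complex.cosh_conj]
  rw [mode, mode, h1, h2]
  simp [← Complex.sinh_conj, ← Complex.cosh_conj]

theorem hlap_conj (f : ℝ → ℂ) (s : ℂ) :
    hlap (fun t => conj (f t)) s = conj (hlap f (conj s)) := by
  rw [hlap, hlap, ← integral_conj]
  refine integral_congr_ae (Eventually.of_forall fun t => ?_)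
  simp only [map_mul, ← Complex.exp_conj, map_neg, Complex.conj_conj, Complex.conj_ofReal]

/-- The conjugate of the solution has the same Laplace transform, because the principal power
commutes with conjugation away from the negative axis. Injectivity gives equality for almost every
`t`, and continuity for all `t`. -/
theorem pathSol_im_eq_zero (hα0 : 0 < α) (hα1 : α < 1) (hF : IsH1HalfLine F F') (h0 : F 0 = 0)
    (hw : Continuous w) (hx : x ∈ Icc (0 : ℝ) 1) (hFr : ∀ t : ℝ, 0 ≤ t → (F t).im = 0) (t : ℝ) :
    (pathSol α F w x t).im = 0 := by
  have hb := isSectorSymbol_mode hw hx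
  have hi := fun (s : ℂ) (hs : 0 < s.re) =>
    hb.integrableOn_exp_mul_timeSymbol hα0 hα1 hF h0 hs
  have hFc : ∀ s : ℂ, conj (hlap F (conj s)) = hlap F s := fun s => by
    rw [← hlap_conj]
    refine setIntegral_congr_fun measurableSet_Ioi fun t ht => ?_
    simp only
    rw [Complex.conj_eq_iff_im.2 (hFr t (mem_Ioi.1 ht).le)]
  have hic : ∀ s : ℂ, 0 < s.re → IntegrableOn
      (fun t : ℝ => Complex.exp (-(s * t)) * conj (pathSol α F w x t)) (Ioi 0) := fun s hs => by
    have := (Complex.conjLIE.toContinuousLinearEquiv.toContinuousLinearMap).integrable_comp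
      (hi (conj s) (by simpa using hs))
    refine this.congr (Eventually.of_forall fun t => ?_)
    simp [← Complex.exp_conj, pathSol]
  have hconj : ∀ s : ℂ, 0 < s.re →
      hlap (fun t => conj (pathSol α F w x t)) s = hlap (pathSol α F w x) s := fun s hs => by
    have hs' : 0 < (conj s).re := by simpa using hs
    have harg : s.arg ≠ Real.pi := fun h => absurd (Complex.arg_eq_pi_iff.1 h).1 hs.le.not_gt
    rw [hlap_conj, hlap_pathSol hα0 hα1 hF h0 hw hx hs', hlap_pathSol hα0 hα1 hF h0 hw hx hs,
      map_mul, hFc, ← mode_conj hx]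
    congr 2
    rw [← Complex.cpow_conj _ _ harg, Complex.conj_ofReal]
  have hae := ae_eq_zero_of_hlap_eq_zero
    (f := fun t => conj (pathSol α F w x t) - pathSol α F w x t) (a := 1)
    (by
      refine ((hic 1 (by simp)).sub (hi 1 (by simp))).congr (Eventually.of_forall fun t => ?_)
      simp only [Pi.sub_apply, Complex.ofReal_one, mul_sub, pathSol])
    fun s hs => by
      have hs0 : 0 < s.re := by rw [hs]; exact one_pos
      calc hlap (fun t => conj (pathSol α F w x t) - pathSol α F w x t) s
          = hlap (fun t => conj (pathSol α F w x t)) s - hlap (pathSol α F w x) s := by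
            simp only [hlap, mul_sub]
            exact integral_sub (hic s hs0) (hi s hs0)
        _ = 0 := by rw [hconj s hs0, sub_self]
  rw [ae_restrict_iff' measurableSet_Ioi] at hae
  have hcont : Continuous fun t => (pathSol α F w x t).im :=
    Complex.continuous_im.comp (hb.continuous_timeSymbol hα0 hα1 hF h0)
  have : (fun t => (pathSol α F w x t).im) =ᵐ[volume] fun _ => 0 := by
    filter_upwards [hae] with t ht
    rcases le_or_gt t 0 with h | h
    · have : pathSol α F w x t = 0 := hb.timeSymbol_eq_zero hα0 hα1 hF h0 h
      rw [this, Complex.zero_im]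
    · exact Complex.conj_eq_iff_im.1 (sub_eq_zero.1 (ht h))
  exact congrFun ((hcont.ae_eq_iff_eq volume continuous_const).1 this) t

end RealValued

end

/-! ### Assembly of the theorem -/

theorem mainTheorem2 (α : ℝ) (hα0 : 0 < α) (hα1 : α < 1) :
    ∃ C : ℝ, 0 < C ∧
      ∀ (Ω : Type*) [MeasurableSpace Ω] (μ : Measure Ω) [IsProbabilityMeasure μ]
        (W : ℝ≥0 → Ω → ℝ) (_ : IsBrownianReal W μ)
        (F F' : ℝ → ℂ) (_ : IsH1HalfLine F F') (_ : F 0 = 0),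
        ∃ u ut : ℝ → ℝ → Ω → ℂ,
          IsTimeSolution α F μ W u ut ∧
          -- `E ‖∂_t u‖² ≤ C ‖F‖²_{H¹}`
          (∫ ω, (∫ t in Ioi (0 : ℝ), ∫ x in Ioo (0 : ℝ) 1, ‖ut x t ω‖ ^ 2) ∂μ
            ≤ C * h1NormSq F F') ∧
          -- uniqueness
          (∀ u₂ ut₂ : ℝ → ℝ → Ω → ℂ, IsTimeSolution α F μ W u₂ ut₂ →
            ∀ᵐ p ∂((volume.restrict (Ioo (0 : ℝ) 1)).prod μ),
              ∀ t : ℝ, 0 ≤ t → u₂ p.1 t p.2 = u p.1 t p.2) ∧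
          -- the solution, extended by zero to negative times, is the inverse Fourier transform
          -- of the frequency-domain solution
          (∃ U : ℝ → ℝ → Ω → ℂ, IsFrequencyMildSolution α F μ W U ∧
            ∀ᵐ p ∂((volume.restrict (Ioo (0 : ℝ) 1)).prod μ),
              Integrable (fun ξ => U p.1 ξ p.2) ∧
              ∀ t : ℝ, invFourier (fun ξ => U p.1 ξ p.2) t =
                if 0 ≤ t then u p.1 t p.2 else 0) ∧
          -- the solution is real-valued if `F` is
          ((∀ t : ℝ, 0 ≤ t → (F t).im = 0) →
            ∀ᵐ p ∂((volume.restrict (Ioo (0 : ℝ) 1)).prod μ),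
              ∀ t : ℝ, 0 ≤ t → (u p.1 t p.2).im = 0) := by
  refine ⟨18, by norm_num, fun Ω _ μ _ W hW F F' hF h0 => ?_⟩
  obtain ⟨w, hwm, hwc, hw0, hwW⟩ := exists_measurable_modification hW
  have hw : IsPathModification μ W w := ⟨hwm, hwc, hw0, hwW⟩
  have hsol := isTimeSolution_pathSol hW hw hα0 hα1 hF h0
  have hmem : ∀ᵐ p ∂((volume.restrict (Ioo (0 : ℝ) 1)).prod μ), p.1 ∈ Ioo (0 : ℝ) 1 :=
    Measure.quasiMeasurePreserving_fst.ae (ae_restrict_mem measurableSet_Ioo)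
  refine ⟨fun x t ω => pathSol α F (w ω) x t, fun x t ω => pathSolDt α F (w ω) x t, hsol,
    integral_pathSolDt_le hW hw hα0 hα1 hF h0,
    fun u₂ ut₂ h₂ => h₂.unique hsol hw hα0 hα1 hF,
    ⟨fun x ξ ω => freqSymbol α F (mode (w ω) x) ξ,
      isFrequencyMildSolution_freqSymbol hW hw hα0 hα1, ?_⟩, fun hFr => ?_⟩
  · filter_upwards [hmem] with p hp
    exact ⟨(isSectorSymbol_mode (hwc p.2) (Ioo_subset_Icc_self hp)).integrable_freqSymbol
      hα0 hα1 hF h0, fun t => invFourier_freqSymbol_mode hα0 hα1 hF h0 (hwc p.2)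
        (Ioo_subset_Icc_self hp) t⟩
  · filter_upwards [hmem] with p hp t _
    exact pathSol_im_eq_zero hα0 hα1 hF h0 (hwc p.2) (Ioo_subset_Icc_self hp) hFr t
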